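/- Let $d\ge 2$ and let $P\subset\mathbb R^d$ be a $d$-dimensional polytope (a compact finite intersection of half-spaces) in general position: any $d$ distinct facets ($(d-1)$-dimensional faces) of $P$ have linearly independent normals, and the normals of the facets through any given vertex are linearly independent. A *contracting reflection law* is a $C^2$ map $f:[0,\frac\pi2)\to[0,\frac\pi2)$ with $f(0)=0$ and $0<\lambda(f):=\sup_{0\le\theta<\pi/2}|f'(\theta)|<1$; write $f(\frac\pi2^-)=\lim_{\theta\to\pi/2}f(\theta)$ (the limit exists because $f$ is Lipschitz). For a unit vector $\eta$ and a unit vector $v$ with $\langle v,\eta\rangle>0$ put $\theta=\arccos\langle v,\eta\rangle$ and $$C_\eta(v)=\frac{\cos f(\theta)}{\cos\theta}\,\langle v,\eta\rangle\eta+\frac{\sin f(\theta)}{\sin\theta}\,\bigl(v-\langle v,\eta\rangle\eta\bigr),\qquad C_\eta(\eta)=\eta .$$ Let $M$ be the set of pairs $(p,v)$ with $p$ in the relative interior of a facet of $P$, with interior unit normal $\eta(p)$, and $v$ a unit vector with $\langle v,\eta(p)\rangle>0$; let $M'$ be the set of $(p,v)\in M$ whose half-line $\{p+tv:t\ge0\}$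 misses the $(d-2)$-skeleton of $P$ (the union of the relative boundaries of the facets). The contracting billiard map $\Phi=\Phi_{f,P}:M'\to M$ is $\Phi(p,v)=\bigl(p',\,C_{\eta(p')}(v-2\langle v,\eta(p')\rangle\eta(p'))\bigr)$, where $p'=p+\tau v$ and $\tau>0$ is the least positive time with $p+\tau v\in\partial P$. Let $M^+=\{x\in M:\Phi^n(x)\in M'\ \text{for all } n\ge0\}$ and $D=\bigcap_{n\ge0}\Phi^n(M^+)$. $\Phi$ is *uniformly hyperbolic* if all its iterates are differentiable at the points of $D$ and there are a continuous splitting $T_xM=E^s(x)\oplus E^u(x)$, $x\in D$, that is $D\Phi$-invariant, and constants $\lambda<1<\sigma$, $C>0$ such that $\|D\Phi^n|_{E^s}\|\le C\lambda^n$ and $\|D\Phi^{-n}|_{E^u}\|\le C\sigma^{-n}$ for all $n\ge1$. Here $D\Phi^{-n}|_{E^u}$ is the inverse of $D\Phi^n:E^u(x)\to E^u(\Phi^n x)$. Invariance means $D\Phi(E^u(x))=E^u(\Phi(x))$ and $D\Phi(E^s(x))\subseteq E^s(\Phi(x))$, with equality in the latter wherever $D\Phi(x)$ is injective on $T_xM$.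 Then there is a constant $\lambda_0=\lambda_0(P)\in(0,1)$, depending only on $P$, such that for every contracting reflection law $f$ that is sufficiently close to the specular law $\theta\mapsto\theta$, in the sense that $$\frac{f(\pi/2^-)}{\pi/2}>\lambda_0 ,$$ the billiard map $\Phi_{f,P}$ is uniformly hyperbolic. (For the linear laws $f(\theta)=\lambda\theta$ the condition reads $\lambda(f)>\lambda_0$; it holds for every $f$ with $f'>\lambda_1$ on $[0,\frac\pi2)$ for some $\lambda_1>\lambda_0$.) -/

import Mathlib

open Set Filter Topology

noncomputable section

namespace PolytopeBilliard

/-! ### Polytopes, facets and general position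

The ambient space is `E d`, i.e. `ℝ^d` with its Euclidean structure. A facet (a face of dimension
`d - 1`) of a `d`-dimensional convex polytope is determined by its interior unit normal `η`: it is
the set of points of `P` at which the linear functional `⟪·, η⟫` is minimal. Facets are therefore
indexed by their interior unit normals. -/

/-- Euclidean space `ℝ^d`. -/
abbrev E (d : ℕ) : Type := EuclideanSpace ℝ (Fin d)

/-- A `d`-dimensional polytope in `ℝ^d`: a compact finite intersection of half-spaces
`{x | ⟪x, v⟫ ≤ c}`, `v ≠ 0`, whose affine span is the whole of `ℝ^d`. -/
def IsPolytope {d : ℕ} (P : Set (E d)) : Prop :=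
  IsCompact P ∧
  (∃ H : Finset (E d × ℝ), (∀ h ∈ H, h.1 ≠ 0) ∧ P = {x | ∀ h ∈ H, inner ℝ x h.1 ≤ h.2}) ∧
  affineSpan ℝ P = ⊤

/-- The set of points of `P` that lie furthest in the direction `-η`. -/
def face {d : ℕ} (P : Set (E d)) (η : E d) : Set (E d) :=
  {p | p ∈ P ∧ ∀ q ∈ P, inner ℝ p η ≤ inner ℝ q η}

/-- `η` is the interior unit normal of a facet of `P`, which is then `face P η`. -/
def IsFacetNormal {d : ℕ} (P : Set (E d)) (η : E d) : Prop :=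
  ‖η‖ = 1 ∧ Module.finrank ℝ (vectorSpan ℝ (face P η)) + 1 = d

/-- `P` is in general position: any `d` distinct facets have linearly independent normals, and so
do the facets through any vertex. -/
def InGeneralPosition {d : ℕ} (P : Set (E d)) : Prop :=
  (∀ S : Finset (E d), (∀ η ∈ S, IsFacetNormal P η) → S.card = d →
    LinearIndependent ℝ (fun η : S => (η : E d))) ∧
  (∀ p ∈ P.extremePoints ℝ,
    LinearIndependent ℝ (fun η : {η : E d // IsFacetNormal P η ∧ p ∈ face P η} => (η : E d)))

/-- The boundary of `P`: the union of the facets. -/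
def bdry {d : ℕ} (P : Set (E d)) : Set (E d) :=
  {p | ∃ η, IsFacetNormal P η ∧ p ∈ face P η}

/-- The `(d-2)`-skeleton of `P`: the union of the relative boundaries of the facets. -/
def skeleton {d : ℕ} (P : Set (E d)) : Set (E d) :=
  {p | ∃ η, IsFacetNormal P η ∧ p ∈ intrinsicFrontier ℝ (face P η)}

open Classical in
/-- The interior unit normal of the facet in whose relative interior `p` lies (`0` if there is
no such facet). -/
def normalAt {d : ℕ} (P : Set (E d)) (p : E d) : E d :=
  if h : ∃ η, IsFacetNormal P η ∧ p ∈ intrinsicInterior ℝ (face P η) then h.choose else 0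

/-! ### Contracting reflection laws -/

/-- `λ(f)`, the supremum of `|f'|` over `[0, π/2)`. -/
def contractionRate (f : ℝ → ℝ) : ℝ :=
  sSup ((fun θ => |derivWithin f (Ico 0 (Real.pi / 2)) θ|) '' Ico 0 (Real.pi / 2))

/-- A contracting reflection law: a `C²` map `f : [0, π/2) → [0, π/2)` with `f 0 = 0` and
`0 < sup |f'| < 1`. The values of `f` outside `[0, π/2)` are irrelevant. -/
structure IsContractingReflectionLaw (f : ℝ → ℝ) : Prop where
  contDiffOn : ContDiffOn ℝ 2 f (Ico 0 (Real.pi / 2))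
  mapsTo : MapsTo f (Ico 0 (Real.pi / 2)) (Ico 0 (Real.pi / 2))
  map_zero : f 0 = 0
  bddAbove : BddAbove
    ((fun θ => |derivWithin f (Ico 0 (Real.pi / 2)) θ|) '' Ico 0 (Real.pi / 2))
  rate_pos : 0 < contractionRate f
  rate_lt_one : contractionRate f < 1

/-- Orthogonal projection of `u` onto the line spanned by the unit vector `η`. -/
def projLine {d : ℕ} (η u : E d) : E d := inner ℝ u η • η

/-- Orthogonal projection of `u` onto the hyperplane orthogonal to the unit vector `η`. -/
def projHyp {d : ℕ} (η u : E d) : E d := u - inner ℝ u η • η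

/-- The specular reflection `R_η`. -/
def specular {d : ℕ} (η u : E d) : E d := u - (2 * inner ℝ u η) • η

/-- The map `C_η` of the open hemisphere `{v | ‖v‖ = 1, 0 < ⟪v, η⟫}` that replaces the angle `θ`
between `v` and `η` by `f θ`. (At `v = η` the second summand is `0`, since `projHyp η η = 0`.) -/
def contract {d : ℕ} (f : ℝ → ℝ) (η v : E d) : E d :=
  (Real.cos (f (Real.arccos (inner ℝ v η))) / Real.cos (Real.arccos (inner ℝ v η))) •
      projLine η v +
    (Real.sin (f (Real.arccos (inner ℝ v η))) / Real.sin (Real.arccos (inner ℝ v η))) •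
      projHyp η v

/-! ### The contracting billiard map -/

/-- The phase space `M`: pairs `(p, v)` with `p` in the relative interior of a facet and `v` a unit
vector pointing strictly inside `P`. -/
def phaseSpace {d : ℕ} (P : Set (E d)) : Set (E d × E d) :=
  {x | ∃ η, IsFacetNormal P η ∧ x.1 ∈ intrinsicInterior ℝ (face P η) ∧
    ‖x.2‖ = 1 ∧ 0 < inner ℝ x.2 η}

/-- The domain `M'` of the billiard map: the half-line from `p` in the direction `v` does not meet
the skeleton. -/
def billiardDomain {d : ℕ} (P : Set (E d)) : Set (E d × E d) :=
  {x | x ∈ phaseSpace P ∧ ∀ t : ℝ, 0 ≤ t → x.1 + t • x.2 ∉ skeleton P}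

/-- The flight time: the least `t > 0` with `p + t v` on the boundary. (For `(p, v)` in `M'` there
is exactly one such `t`.) -/
def flightTime {d : ℕ} (P : Set (E d)) (x : E d × E d) : ℝ :=
  sInf {t : ℝ | 0 < t ∧ x.1 + t • x.2 ∈ bdry P}

/-- The billiard map with the specular reflection law (meaningful on `billiardDomain P`). -/
def specularMap {d : ℕ} (P : Set (E d)) (x : E d × E d) : E d × E d :=
  (x.1 + flightTime P x • x.2,
    specular (normalAt P (x.1 + flightTime P x • x.2)) x.2)

/-- The map `χ_f (p, v) = (p, C_{η(p)} v)`. -/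
def lawMap {d : ℕ} (f : ℝ → ℝ) (P : Set (E d)) (x : E d × E d) : E d × E d :=
  (x.1, contract f (normalAt P x.1) x.2)

/-- The contracting billiard map `Φ_{f,P}`, the composition of `χ_f` with the specular billiard map
(meaningful on `billiardDomain P`). -/
def billiardMap {d : ℕ} (f : ℝ → ℝ) (P : Set (E d)) : E d × E d → E d × E d :=
  lawMap f P ∘ specularMap P

/-- `M⁺`: the points all of whose forward iterates are defined. -/
def forwardSet {d : ℕ} (f : ℝ → ℝ) (P : Set (E d)) : Set (E d × E d) :=
  {x | ∀ n : ℕ, (billiardMap f P)^[n] x ∈ billiardDomain P}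

/-- `D = ⋂ₙ Φⁿ(M⁺)`, the maximal invariant set, whose closure is the attractor. -/
def maximalInvariantSet {d : ℕ} (f : ℝ → ℝ) (P : Set (E d)) : Set (E d × E d) :=
  ⋂ n : ℕ, (billiardMap f P)^[n] '' forwardSet f P

/-! ### Uniform hyperbolicity -/

/-- The tangent space `T_x M = η(p)^⊥ × v^⊥` at `x = (p, v) ∈ M`. -/
def tangentSpace {d : ℕ} (P : Set (E d)) (x : E d × E d) : Submodule ℝ (E d × E d) :=
  (Submodule.span ℝ {normalAt P x.1})ᗮ.prod (Submodule.span ℝ {x.2})ᗮ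

/-- A derivative at `x` of the `n`-th iterate of the billiard map along the submanifold `M` of
`ℝ^d × ℝ^d`. Where this iterate is differentiable along `M`, the restriction of such a derivative
to `T_x M`, which is all that is used below, is unique and is the tangent map `DΦⁿ(x)`. -/
def tangentMap {d : ℕ} (f : ℝ → ℝ) (P : Set (E d)) (n : ℕ) (x : E d × E d) :
    (E d × E d) →L[ℝ] (E d × E d) :=
  fderivWithin ℝ ((billiardMap f P)^[n]) (phaseSpace P) x

/-- The family of subspaces `S x`, `x ∈ Λ`, is continuous: near each point of `Λ` it has a
continuous frame. -/
def ContinuousSubbundleOn {V : Type*} [NormedAddCommGroup V] [NormedSpace ℝ V]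
    (S : V → Submodule ℝ V) (Λ : Set V) : Prop :=
  ∀ x₀ ∈ Λ, ∃ U : Set V, IsOpen U ∧ x₀ ∈ U ∧ ∃ (k : ℕ) (e : Fin k → V → V),
    (∀ i, ContinuousOn (e i) (U ∩ Λ)) ∧
    ∀ x ∈ U ∩ Λ, LinearIndependent ℝ (fun i => e i x) ∧
      Submodule.span ℝ (range fun i => e i x) = S x

/-- `Φ_{f,P}` is uniformly hyperbolic on `Λ`: its iterates are differentiable along `M` at the
points of `Λ`, and there are a continuous splitting `T_x M = Eˢ(x) ⊕ Eᵘ(x)`, invariant under `DΦ`,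
and constants `0 < lam < 1 < σ` and `C > 0` such that `‖DΦⁿ|Eˢ‖ ≤ C lamⁿ` and
`‖DΦ⁻ⁿ|Eᵘ‖ ≤ C σ⁻ⁿ` for all `n ≥ 1`.

`DΦ⁻ⁿ|Eᵘ` is the inverse of the restriction of `DΦⁿ` to `Eᵘ`; its bound is expressed on the vectors
`DΦⁿ(x) ξ`, `ξ ∈ Eᵘ(x)`, which make up `Eᵘ(Φⁿ x)`.
A reflection law may have `f' = 0` somewhere and then `DΦ(x)` may have a kernel, necessarily in
`Eˢ(x)`; at such points invariance of `Eˢ` means `DΦ(Eˢ(x)) ⊆ Eˢ(Φ x)`. At all other points it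
means `DΦ(Eˢ(x)) = Eˢ(Φ x)`. -/
def UniformlyHyperbolicOn {d : ℕ} (f : ℝ → ℝ) (P : Set (E d)) (Λ : Set (E d × E d)) : Prop :=
  (∀ x ∈ Λ, ∀ n : ℕ,
    DifferentiableWithinAt ℝ ((billiardMap f P)^[n]) (phaseSpace P) x) ∧
  ∃ Es Eu : E d × E d → Submodule ℝ (E d × E d),
    ContinuousSubbundleOn Es Λ ∧ ContinuousSubbundleOn Eu Λ ∧
    (∀ x ∈ Λ, Disjoint (Es x) (Eu x) ∧ Es x ⊔ Eu x = tangentSpace P x) ∧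
    (∀ x ∈ Λ,
      (Es x).map (tangentMap f P 1 x).toLinearMap ≤ Es (billiardMap f P x) ∧
      (InjOn (tangentMap f P 1 x) (tangentSpace P x) →
        (Es x).map (tangentMap f P 1 x).toLinearMap = Es (billiardMap f P x)) ∧
      (Eu x).map (tangentMap f P 1 x).toLinearMap = Eu (billiardMap f P x)) ∧
    ∃ lam σ C : ℝ, 0 < lam ∧ lam < 1 ∧ 1 < σ ∧ 0 < C ∧
      ∀ x ∈ Λ, ∀ n : ℕ, 1 ≤ n →
        (∀ ξ ∈ Es x, ‖tangentMap f P n x ξ‖ ≤ C * lam ^ n * ‖ξ‖) ∧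
        (∀ ξ ∈ Eu x, ‖ξ‖ ≤ C * (σ ^ n)⁻¹ * ‖tangentMap f P n x ξ‖)

/-- The billiard map `Φ_{f,P}` is uniformly hyperbolic, i.e. uniformly hyperbolic on `D`. -/
def UniformlyHyperbolic {d : ℕ} (f : ℝ → ℝ) (P : Set (E d)) : Prop :=
  UniformlyHyperbolicOn f P (maximalInvariantSet f P)

end PolytopeBilliard

end

/-! The derivative of the billiard map is block triangular. Vectors `(ξ, 0)` keep this form and are
transported by projections along the velocity, while the velocity component follows its own cocycle
`velDeriv`. A reflection law scales angular displacements by `f'` along meridians and by `sin (f θ)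
/ sin θ` across them, both bounded by some `ρ < 1`, so the velocity cocycle contracts uniformly
(`norm_velDeriv_apply_le`). Hence `Eᵘ` can only be the space of vectors `(ξ, 0)`, and `Eˢ` is a
graph over the velocity directions, given by a series that converges geometrically
(`stableMap_spec`). This triangular structure gives the splitting, its invariance and the
contraction; what has to be proved is expansion on `Eᵘ`.

Measure `ξ` by its part orthogonal to the velocity. A flight does not change this quantity. After
the flight `ξ` is orthogonal to the normal of the wall, and the reflection multiplies its inner
product with the velocity by a factor at most `ρ` (`exists_inner_velocity`), so by Pythagoras the
orthogonal part grows. If it hardly grows during `K` collisions, then the projections hardly move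
`ξ`, which is therefore nearly orthogonal to `K` consecutive normals. That is impossible when these
normals span the space (`exists_expansion_factor`, `uMap_expansion`). On `D` velocities leave the
walls at angles bounded away from tangency, so the quantity is comparable to the norm there.

It remains to see that `K` consecutive normals span, with `K` depending on `P` only
(`exists_isGenerating`). Otherwise, by general position, the orbit meets fewer than `d` facets, with
independent normals. Some vector `e` then has inner product `1` with all of these normals, and every
collision increases the component of the velocity along `e`. `exists_bound_chain` turns this into a
bound on the number of collisions, uniform for all laws with `ε = π/2 - f(π/2⁻)` small. The delicate
case is that of grazing collisions, where specular reflection changes the velocity by an arbitrarily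
small amount; there the law itself supplies a push of order `ε`, the same order as its deviation
from the specular law. -/

noncomputable section

namespace PolytopeBilliard

/-! ### Bounds on the number of consecutive nearly specular reflections in independent walls. -/

section Chains

variable {V : Type*} [NormedAddCommGroup V] [InnerProductSpace ℝ V]

/-- A change of velocity from `v` to `v'` at a wall with unit normal `η` that is specular up to an
error of order `ε`, and that pushes the velocity by an amount at least of order `ε` in a direction
close to the normal. -/
structure NearSpecular (ε : ℝ) (η v v' : V) : Prop where
  neg : inner ℝ v η < 0
  pos : 0 < inner ℝ v' η
  push : ∃ (m : ℝ) (ω : V), ε / 2 ≤ m ∧ ‖ω - η‖ ≤ ε ∧ v' - v = m • ω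
  close : ‖v' - (v - (2 * inner ℝ v η) • η)‖ ≤ 2 * ε

/-- The projection is self-adjoint, does not increase norms and fixes the normal, so nothing in the
definition is lost. It reduces chains to velocities in the span of the normals, where the normals
control the norm; no unit length of the velocities is assumed for this reason. -/
theorem NearSpecular.proj {ε : ℝ} {η v v' : V} (h : NearSpecular ε η v v') (W : Submodule ℝ V)
    [W.HasOrthogonalProjection] (hη : η ∈ W) :
    NearSpecular ε η (W.starProjection v) (W.starProjection v') := by
  have hP : W.starProjection η = η := Submodule.starProjection_eq_self_iff.2 hη
  have hin : ∀ u : V, inner ℝ (W.starProjection u) η = inner ℝ u η := fun u => by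
    rw [Submodule.inner_starProjection_left_eq_right, hP]
  have hn : ∀ u : V, ‖W.starProjection u‖ ≤ ‖u‖ := fun u => by
    simpa using W.starProjection.le_of_opNorm_le W.starProjection_norm_le u
  obtain ⟨m, ω, hm, hω, hv⟩ := h.push
  refine ⟨by rw [hin]; exact h.neg, by rw [hin]; exact h.pos,
    ⟨m, W.starProjection ω, hm, ?_, ?_⟩, ?_⟩
  · calc _ = ‖W.starProjection (ω - η)‖ := by rw [map_sub, hP]
      _ ≤ _ := (hn _).trans hω
  · rw [← map_sub, hv, map_smul]
  · calc _ = ‖W.starProjection (v' - (v - (2 * inner ℝ v η) • η))‖ := by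
            rw [map_sub, map_sub, map_smul, hP, hin]
      _ ≤ _ := (hn _).trans h.close

/-- A finite family of vectors controls the norm on its span. -/
theorem exists_le_abs_inner_of_mem_span (S : Finset V) (hS : S.Nonempty) :
    ∃ κ : ℝ, 0 < κ ∧ ∀ u ∈ Submodule.span ℝ (S : Set V), ∃ η ∈ S, κ * ‖u‖ ≤ |inner ℝ u η| := by
  classical
  let W := Submodule.span ℝ (S : Set V)
  let T : W →ₗ[ℝ] (S → ℝ) :=
    { toFun := fun u η => inner ℝ (u : V) (η : V)
      map_add' := fun a b => by ext η; simp [inner_add_left]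
      map_smul' := fun a b => by ext η; simp [inner_smul_left] }
  have hT : LinearMap.ker T = ⊥ := by
    rw [LinearMap.ker_eq_bot']
    intro u hu
    have h0 : ∀ w ∈ W, inner ℝ (u : V) w = 0 := by
      intro w hw
      induction hw using Submodule.span_induction with
      | mem x hx => exact congrFun hu ⟨x, hx⟩
      | zero => simp
      | add a b _ _ ha hb => rw [inner_add_right, ha, hb, add_zero]
      | smul c a _ ha => rw [inner_smul_right, ha, mul_zero]
    exact Subtype.ext (inner_self_eq_zero.1 (h0 u u.2))
  obtain ⟨K, hK, hanti⟩ := T.exists_antilipschitzWith hT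
  refine ⟨(K : ℝ)⁻¹, by positivity, fun u hu => ?_⟩
  have : Nonempty S := hS.to_subtype
  have hne : (Finset.univ : Finset S).Nonempty := Finset.univ_nonempty
  obtain ⟨η, -, hη⟩ := Finset.exists_max_image Finset.univ (fun η : S => |inner ℝ u (η : V)|) hne
  refine ⟨η, η.2, ?_⟩
  have h1 := hanti.le_mul_dist (⟨u, hu⟩ : W) 0
  rw [map_zero, dist_zero_right, dist_zero_right] at h1
  have h2 : ‖T ⟨u, hu⟩‖ ≤ |inner ℝ u (η : V)| :=
    (pi_norm_le_iff_of_nonneg (abs_nonneg _)).2 fun i => hη i (Finset.mem_univ _)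
  rw [inv_mul_le_iff₀ (by exact_mod_cast hK)]
  exact h1.trans (mul_le_mul_of_nonneg_left h2 K.2)

/-- For a linearly independent finite family there is a vector having inner product `1` with each
member. -/
theorem exists_inner_eq_one (S : Finset V) (hli : LinearIndependent ℝ (fun η : S => (η : V))) :
    ∃ e : V, ∀ η ∈ S, inner ℝ e η = 1 := by
  let b := Module.Basis.span hli
  let W := Submodule.span ℝ (range fun η : S => (η : V))
  have : FiniteDimensional ℝ W := Module.Finite.of_basis b
  let φ : W →L[ℝ] ℝ := LinearMap.toContinuousLinearMap (b.constr ℝ fun _ => (1 : ℝ))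
  refine ⟨((InnerProductSpace.toDual ℝ W).symm φ : W), fun η hη => ?_⟩
  have h1 : inner ℝ ((InnerProductSpace.toDual ℝ W).symm φ) (b ⟨η, hη⟩) = φ (b ⟨η, hη⟩) :=
    InnerProductSpace.toDual_symm_apply
  have h2 : φ (b ⟨η, hη⟩) = 1 := b.constr_basis ℝ _ _
  have h3 : ((b ⟨η, hη⟩ : W) : V) = η :=
    congrArg Subtype.val (Module.Basis.span_apply hli ⟨η, hη⟩)
  rw [h2, Submodule.coe_inner, h3] at h1
  exact h1

/-- Steps in a fixed cone around `e` add up to a displacement in the same cone: the left side is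
subadditive and the right side additive. -/
theorem norm_sub_le_of_steps {u : ℕ → V} {e : V} {s n : ℕ}
    (h : ∀ j, s ≤ j → j < n → ‖u (j + 1) - u j‖ ≤ 4 * inner ℝ (u (j + 1) - u j) e)
    {i j : ℕ} (hi : s ≤ i) (hij : i ≤ j) (hj : j ≤ n) :
    ‖u j - u i‖ ≤ 4 * inner ℝ (u j - u i) e := by
  induction j, hij using Nat.le_induction with
  | base => simp
  | succ j hij ih =>
    have h1 := ih (by omega)
    have h2 := h j (by omega) (by omega)
    have h3 : u (j + 1) - u i = (u (j + 1) - u j) + (u j - u i) := by abel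
    rw [h3, inner_add_left]
    linarith [norm_add_le (u (j + 1) - u j) (u j - u i)]

/-- The inductive step of `exists_bound_chain`: a long chain in the span of `S` none of whose
subchains of length `L` avoids a member of `S` does not exist. -/
theorem exists_bound_chain_of_blocks (S : Finset V) (hS : S.Nonempty)
    (hunit : ∀ η ∈ S, ‖η‖ = 1) (hli : LinearIndependent ℝ (fun η : S => (η : V))) (L : ℕ) :
    ∃ K : ℕ, ∃ ε₀ : ℝ, 0 < ε₀ ∧ ∀ ε, 0 < ε → ε ≤ ε₀ → ∀ u η : ℕ → V,
      (∀ j, u j ∈ Submodule.span ℝ (S : Set V)) →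
      (∀ j < K, η j ∈ S ∧ NearSpecular ε (η j) (u j) (u (j + 1))) →
      (∀ s, s + L ≤ K → ∀ ν ∈ S, ∃ j, s ≤ j ∧ j < s + L ∧ η j = ν) → False := by
  obtain ⟨e, he⟩ := exists_inner_eq_one S hli
  obtain ⟨κ, hκ, hκS⟩ := exists_le_abs_inner_of_mem_span S hS
  -- `B` blocks, each gaining `κ * A / 8` along `e`, must exceed the total `5 / 2 * A * ‖e‖` that is
  -- available.
  obtain ⟨B, hB⟩ := exists_nat_gt (20 * ‖e‖ / κ)
  -- In `n` steps the pushes of size at least `ε / 4` along `e` exceed what a velocity of norm below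
  -- `R * ε` allows, where `R = 4 * B * L`.
  obtain ⟨n, hn⟩ := exists_nat_gt (8 * (4 * (B * L : ℕ) : ℝ) * ‖e‖)
  have he0 : 0 ≤ ‖e‖ := norm_nonneg e
  refine ⟨n + B * L, min 1 (1 / (2 * (‖e‖ + 1))), by positivity, ?_⟩
  intro ε hε hε₀ u η hu hstep hblock
  have hε1 : ε ≤ 1 := hε₀.trans (min_le_left _ _)
  have hεe : ε * ‖e‖ ≤ 1 / 2 := by
    have h := hε₀.trans (min_le_right _ _)
    rw [le_div_iff₀ (by positivity)] at h
    nlinarith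
  -- Since `⟪e, η j⟫ = 1` and `ε * ‖e‖ ≤ 1 / 2`, the direction `ω` of the push has `⟪ω, e⟫ ≥ 1 / 2`,
  -- and `‖ω‖ ≤ 2`: the step lies in a cone around `e`.
  have hgrow : ∀ j < n + B * L, ‖u (j + 1) - u j‖ ≤ 4 * inner ℝ (u (j + 1) - u j) e ∧
      ε / 4 ≤ inner ℝ (u (j + 1) - u j) e := by
    intro j hj
    obtain ⟨hjS, hns⟩ := hstep j hj
    obtain ⟨m, ω, hm, hω, hv⟩ := hns.push
    have hm0 : 0 < m := by linarith
    have h1 : (1 : ℝ) / 2 ≤ inner ℝ ω e := by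
      have h2 : inner ℝ ω e = inner ℝ (ω - η j) e + inner ℝ e (η j) := by
        rw [inner_sub_left, real_inner_comm (η j) e]; ring
      have h3 := neg_le_of_abs_le (abs_real_inner_le_norm (ω - η j) e)
      have h4 : ‖ω - η j‖ * ‖e‖ ≤ ε * ‖e‖ := mul_le_mul_of_nonneg_right hω he0
      rw [h2, he _ hjS]; linarith
    have h2 : ‖ω‖ ≤ 2 := by
      have := norm_add_le (ω - η j) (η j)
      rw [sub_add_cancel, hunit _ hjS] at this
      linarith
    rw [hv, norm_smul, Real.norm_of_nonneg hm0.le, real_inner_smul_left]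
    constructor <;> nlinarith
  -- The exact reflection is an isometry, so the norm drifts only by the error of `close`.
  have hnorm : ∀ j < n + B * L, |‖u (j + 1)‖ - ‖u j‖| ≤ 2 * ε := by
    intro j hj
    obtain ⟨hjS, hns⟩ := hstep j hj
    have h1 : ‖u j - (2 * inner ℝ (u j) (η j)) • η j‖ = ‖u j‖ := by
      rw [← sq_eq_sq₀ (norm_nonneg _) (norm_nonneg _), norm_sub_sq_real, norm_smul,
        real_inner_smul_right, hunit _ hjS, mul_one, Real.norm_eq_abs, sq_abs]
      ring
    rw [← h1]
    exact (abs_norm_sub_norm_le _ _).trans hns.close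
  have htv := fun {i j : ℕ} (hij : i ≤ j) (hj : j ≤ n + B * L) =>
    norm_sub_le_of_steps (u := u) (e := e) (s := 0) (fun j _ hj => (hgrow j hj).1)
      (Nat.zero_le i) hij hj
  set R : ℝ := 4 * (B * L : ℕ) with hR
  have hR0 : 0 ≤ R := by positivity
  -- The velocity cannot stay of order `ε`: the pushes would accumulate. From time `a` on it is
  -- large compared with all errors made in the remaining `B * L` steps.
  obtain ⟨a, han, ha⟩ : ∃ a ≤ n, R * ε ≤ ‖u a‖ := by
    by_contra! hcon
    have h1 : ∀ j ≤ n, (j : ℝ) * (ε / 4) ≤ inner ℝ (u j - u 0) e := by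
      intro j hj
      induction j with
      | zero => simp
      | succ j ih =>
        have h2 := ih (by omega)
        have h3 := (hgrow j (by omega)).2
        have h4 : u (j + 1) - u 0 = (u (j + 1) - u j) + (u j - u 0) := by abel
        rw [h4, inner_add_left]
        push_cast
        linarith
    have h2 := h1 n le_rfl
    have h3 := (real_inner_le_norm (u n - u 0) e).trans
      (mul_le_mul_of_nonneg_right (norm_sub_le _ _) he0)
    have h4 : (‖u n‖ + ‖u 0‖) * ‖e‖ ≤ (2 * (R * ε)) * ‖e‖ :=
      mul_le_mul_of_nonneg_right (by linarith [hcon n le_rfl, hcon 0 (Nat.zero_le _)]) he0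
    have h5 : 8 * R * ‖e‖ * (ε / 4) < n * (ε / 4) := mul_lt_mul_of_pos_right hn (by positivity)
    linarith
  set A := ‖u a‖ with hA
  have hB0 : 0 < B := by
    have : (0 : ℝ) < B := lt_of_le_of_lt (by positivity) hB
    exact_mod_cast this
  have hL0 : 0 < L := by
    obtain ⟨ν, hν⟩ := hS
    rcases Nat.eq_zero_or_pos L with h | h
    · obtain ⟨j, h1, h2, -⟩ := hblock 0 (by rw [h]; exact Nat.zero_le _) ν hν
      omega
    · exact h
  have hA0 : 0 < A := by
    refine lt_of_lt_of_le ?_ ha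
    have : 0 < B * L := Nat.mul_pos hB0 hL0
    positivity
  have hAj : ∀ j ≤ B * L, |‖u (a + j)‖ - A| ≤ j * (2 * ε) := by
    intro j hj
    induction j with
    | zero => simp [hA]
    | succ j ih =>
      have h1 := ih (by omega)
      have h2 := hnorm (a + j) (by omega)
      rw [← add_assoc]
      push_cast
      rw [abs_le] at *
      constructor <;> linarith [h1.1, h1.2, h2.1, h2.2]
  have hAj' : ∀ j ≤ B * L, A / 2 ≤ ‖u (a + j)‖ ∧ ‖u (a + j)‖ ≤ 3 / 2 * A := by
    intro j hj
    have h1 := hAj j hj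
    have h2 : (j : ℝ) ≤ (B * L : ℕ) := by exact_mod_cast hj
    have h3 : (j : ℝ) * (2 * ε) ≤ A / 2 := by nlinarith
    rw [abs_le] at h1
    constructor <;> linarith [h1.1, h1.2]
  -- Some `ν ∈ S` sees a fixed fraction of the velocity at the start of the block, and the wall `ν`
  -- is hit within the block. As `⟪·, ν⟫` is negative before the hit and positive after it, one of
  -- these two velocities has moved by at least `κ * A / 2`; the cone condition turns this into a
  -- gain along `e`.
  have hblk : ∀ b < B, κ * A / 8 ≤ inner ℝ (u (a + (b + 1) * L) - u (a + b * L)) e := by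
    intro b hb
    have hbL : (b + 1) * L ≤ B * L := Nat.mul_le_mul_right _ hb
    have hbL' : (b + 1) * L = b * L + L := by ring
    set s := a + b * L with hs
    have hsL : a + (b + 1) * L = s + L := by rw [hs, hbL', add_assoc]
    rw [hsL]
    obtain ⟨ν, hν, hνs⟩ := hκS (u s) (hu s)
    obtain ⟨j, hsj, hjs, hjν⟩ := hblock s (by omega) ν hν
    have hns := (hstep j (by omega)).2
    rw [hjν] at hns
    have hAs : κ * A / 2 ≤ |inner ℝ (u s) ν| :=
      le_trans (by nlinarith [(hAj' (b * L) (by omega)).1]) hνs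
    obtain ⟨i, hsi, hi, hiν⟩ : ∃ i, s ≤ i ∧ i ≤ s + L ∧ κ * A / 2 ≤ ‖u i - u s‖ := by
      rcases le_total 0 (inner ℝ (u s) ν) with h | h
      · refine ⟨j, hsj, hjs.le, ?_⟩
        rw [abs_of_nonneg h] at hAs
        have h1 := real_inner_le_norm (u s - u j) ν
        rw [inner_sub_left, hunit ν hν, mul_one, norm_sub_rev] at h1
        linarith [hns.neg]
      · refine ⟨j + 1, by omega, by omega, ?_⟩
        rw [abs_of_nonpos h] at hAs
        have h1 := real_inner_le_norm (u (j + 1) - u s) ν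
        rw [inner_sub_left, hunit ν hν, mul_one] at h1
        linarith [hns.pos]
    have h1 := htv hsi (by omega)
    have h2 := htv hi (by omega)
    have h3 : u (s + L) - u s = (u (s + L) - u i) + (u i - u s) := by abel
    rw [h3, inner_add_left]
    linarith [norm_nonneg (u (s + L) - u i)]
  have hsum : ∀ b ≤ B, b * (κ * A / 8) ≤ inner ℝ (u (a + b * L) - u a) e := by
    intro b hb
    induction b with
    | zero => simp
    | succ b ih =>
      have h1 := ih (by omega)
      have h2 := hblk b (by omega)
      have h3 : u (a + (b + 1) * L) - u a
          = (u (a + (b + 1) * L) - u (a + b * L)) + (u (a + b * L) - u a) := by abel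
      rw [h3, inner_add_left]
      push_cast
      linarith
  have h1 := hsum B le_rfl
  have h2 := (real_inner_le_norm (u (a + B * L) - u a) e).trans
      (mul_le_mul_of_nonneg_right (norm_sub_le _ _) he0)
  have h3 : (‖u (a + B * L)‖ + ‖u a‖) * ‖e‖ ≤ (5 / 2 * A) * ‖e‖ :=
    mul_le_mul_of_nonneg_right (by linarith [(hAj' (B * L) le_rfl).2]) he0
  rw [div_lt_iff₀ hκ] at hB
  have h4 : 20 * ‖e‖ * A < B * κ * A := mul_lt_mul_of_pos_right hB hA0
  linarith

/-- Nearly specular reflections in walls with linearly independent normals: the number of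
consecutive reflections is bounded. -/
theorem exists_bound_chain (S : Finset V) (hunit : ∀ η ∈ S, ‖η‖ = 1)
    (hli : LinearIndependent ℝ (fun η : S => (η : V))) :
    ∃ K : ℕ, ∃ ε₀ : ℝ, 0 < ε₀ ∧ ∀ ε, 0 < ε → ε ≤ ε₀ → ∀ v η : ℕ → V,
      ¬ ∀ j < K, η j ∈ S ∧ NearSpecular ε (η j) (v j) (v (j + 1)) := by
  classical
  induction S using Finset.strongInduction with
  | H S ih =>
  rcases S.eq_empty_or_nonempty with rfl | hS
  · exact ⟨1, 1, one_pos, fun ε _ _ v η h => by simpa using (h 0 one_pos).1⟩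
  -- Each proper subfamily `S.erase ν` already admits a bound, so a subchain longer than that bound
  -- hits `ν`.
  have ih' : ∀ ν : S, ∃ K : ℕ, ∃ ε₀ : ℝ, 0 < ε₀ ∧ ∀ ε, 0 < ε → ε ≤ ε₀ → ∀ v η : ℕ → V,
      ¬ ∀ j < K, η j ∈ S.erase ν ∧ NearSpecular ε (η j) (v j) (v (j + 1)) := by
    intro ν
    refine ih (S.erase ν) (Finset.erase_ssubset ν.2)
      (fun η hη => hunit η (Finset.mem_of_mem_erase hη)) ?_
    exact hli.comp (fun η : S.erase ν.1 => (⟨η, Finset.mem_of_mem_erase η.2⟩ : S))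
      fun a b hab => Subtype.ext (by simpa using hab)
  choose K ε₁ hε₁ hK using ih'
  have : Nonempty S := hS.to_subtype
  obtain ⟨ν₁, -, hν₁⟩ := Finset.exists_min_image Finset.univ ε₁
    (Finset.univ_nonempty (α := S))
  obtain ⟨ν₂, -, hν₂⟩ := Finset.exists_max_image Finset.univ K
    (Finset.univ_nonempty (α := S))
  obtain ⟨N, ε₂, hε₂, hN⟩ := exists_bound_chain_of_blocks S hS hunit hli (K ν₂)
  refine ⟨N, min ε₂ (ε₁ ν₁), lt_min hε₂ (hε₁ _), fun ε hε hεle v η hstep => ?_⟩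
  let W := Submodule.span ℝ (S : Set V)
  refine hN ε hε (hεle.trans (min_le_left _ _)) (fun j => W.starProjection (v j)) η
    (fun j => W.starProjection_apply_mem _)
    (fun j hj => ⟨(hstep j hj).1, (hstep j hj).2.proj W (Submodule.subset_span (hstep j hj).1)⟩) ?_
  -- A block of the maximal length `K ν₂` that avoids `ν` would be a forbidden chain for `S.erase
  -- ν`; the unprojected velocities are used here.
  intro s hs ν hν
  by_contra! hcon
  have hle := hν₂ ⟨ν, hν⟩ (Finset.mem_univ _)
  refine hK ⟨ν, hν⟩ ε hε ((hεle.trans (min_le_right _ _)).trans (hν₁ _ (Finset.mem_univ _)))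
    (fun j => v (s + j)) (fun j => η (s + j)) fun j hj => ?_
  exact ⟨Finset.mem_erase.2 ⟨hcon _ (by omega) (by omega), (hstep _ (by omega)).1⟩,
    (hstep _ (by omega)).2⟩

end Chains

/-! ### Estimates for contracting reflection laws. -/

section Law

variable {f : ℝ → ℝ}

/-- The derivative of a reflection law on `[0, π/2)`. -/
def lawDeriv (f : ℝ → ℝ) (θ : ℝ) : ℝ := derivWithin f (Ico 0 (Real.pi / 2)) θ

/-- The ratio `sin (f θ) / sin θ`, extended to `θ = 0` by the derivative of `f`. -/
def sinRatio (f : ℝ → ℝ) (θ : ℝ) : ℝ :=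
  if θ = 0 then lawDeriv f 0 else Real.sin (f θ) / Real.sin θ

theorem sinRatio_mul_sin (hf : IsContractingReflectionLaw f) {θ : ℝ} (h : θ ∈ Ico 0 (Real.pi / 2)) :
    sinRatio f θ * Real.sin θ = Real.sin (f θ) := by
  unfold sinRatio
  split_ifs with h0
  · rw [h0, Real.sin_zero, hf.map_zero, Real.sin_zero, mul_zero]
  · exact div_mul_cancel₀ _ (Real.sin_pos_of_pos_of_lt_pi (lt_of_le_of_ne h.1 (Ne.symm h0))
      (by linarith [h.2, Real.pi_pos])).ne'

theorem IsContractingReflectionLaw.hasDerivWithinAt (hf : IsContractingReflectionLaw f) {θ : ℝ}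
    (h : θ ∈ Ico 0 (Real.pi / 2)) :
    HasDerivWithinAt f (lawDeriv f θ) (Ico 0 (Real.pi / 2)) θ :=
  ((hf.contDiffOn.differentiableOn (by norm_num)) θ h).hasDerivWithinAt

theorem IsContractingReflectionLaw.abs_lawDeriv_le (hf : IsContractingReflectionLaw f) {θ : ℝ}
    (h : θ ∈ Ico 0 (Real.pi / 2)) : |lawDeriv f θ| ≤ contractionRate f :=
  le_csSup hf.bddAbove ⟨θ, h, rfl⟩

theorem IsContractingReflectionLaw.continuousOn_lawDeriv (hf : IsContractingReflectionLaw f) :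
    ContinuousOn (lawDeriv f) (Ico 0 (Real.pi / 2)) :=
  hf.contDiffOn.continuousOn_derivWithin (uniqueDiffOn_Ico _ _) (by norm_num)

theorem IsContractingReflectionLaw.abs_sub_le (hf : IsContractingReflectionLaw f) {a b : ℝ}
    (ha : a ∈ Ico 0 (Real.pi / 2)) (hb : b ∈ Ico 0 (Real.pi / 2)) :
    |f b - f a| ≤ contractionRate f * |b - a| :=
  (convex_Ico _ _).norm_image_sub_le_of_norm_derivWithin_le
    (hf.contDiffOn.differentiableOn (by norm_num)) (fun _ hx => hf.abs_lawDeriv_le hx) ha hb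

theorem IsContractingReflectionLaw.le_rate_mul (hf : IsContractingReflectionLaw f) {θ : ℝ}
    (h : θ ∈ Ico 0 (Real.pi / 2)) : f θ ≤ contractionRate f * θ := by
  have h1 := hf.abs_sub_le (left_mem_Ico.2 (h.1.trans_lt h.2)) h
  rw [hf.map_zero, sub_zero, sub_zero, abs_of_nonneg h.1] at h1
  exact (le_abs_self _).trans h1

theorem IsContractingReflectionLaw.le_self (hf : IsContractingReflectionLaw f) {θ : ℝ}
    (h : θ ∈ Ico 0 (Real.pi / 2)) : f θ ≤ θ := by
  nlinarith [hf.le_rate_mul h, hf.rate_lt_one, h.1]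

/-- As `|f'| < 1`, the defect `θ - f θ` has slope between `0` and `2`; both bounds follow by
comparing `θ` with points tending to `π/2`. Thus `π/2 - ℓ` bounds the defect everywhere and is
nearly attained at grazing angles. -/
theorem IsContractingReflectionLaw.defect_bounds (hf : IsContractingReflectionLaw f) {ℓ : ℝ}
    (hℓ : Tendsto f (𝓝[<] (Real.pi / 2)) (𝓝 ℓ)) {θ : ℝ} (h : θ ∈ Ico 0 (Real.pi / 2)) :
    θ - f θ ≤ Real.pi / 2 - ℓ ∧ Real.pi / 2 - ℓ ≤ θ - f θ + 2 * (Real.pi / 2 - θ) := by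
  have hid : Tendsto (fun b : ℝ => b) (𝓝[<] (Real.pi / 2)) (𝓝 (Real.pi / 2)) :=
    tendsto_id.mono_left nhdsWithin_le_nhds
  have key : ∀ᶠ b in 𝓝[<] (Real.pi / 2), θ - f θ ≤ b - f b ∧
      b - f b ≤ θ - f θ + 2 * (b - θ) := by
    filter_upwards [Ico_mem_nhdsLT h.2] with b hb
    have h1 := hf.abs_sub_le h (b := b) ⟨h.1.trans hb.1, hb.2⟩
    rw [abs_of_nonneg (sub_nonneg.2 hb.1)] at h1
    have h2 := hf.rate_lt_one
    have h3 := sub_nonneg.2 hb.1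
    rw [abs_le] at h1
    constructor <;> nlinarith [h1.1, h1.2]
  exact ⟨ge_of_tendsto (hid.sub hℓ) (key.mono fun _ h => h.1),
    le_of_tendsto_of_tendsto (hid.sub hℓ) (((hid.sub_const θ).const_mul 2).const_add _)
      (key.mono fun _ h => h.2)⟩

theorem IsContractingReflectionLaw.limit_lt (hf : IsContractingReflectionLaw f) {ℓ : ℝ}
    (hℓ : Tendsto f (𝓝[<] (Real.pi / 2)) (𝓝 ℓ)) : ℓ < Real.pi / 2 := by
  have hid : Tendsto (fun b : ℝ => b) (𝓝[<] (Real.pi / 2)) (𝓝 (Real.pi / 2)) :=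
    tendsto_id.mono_left nhdsWithin_le_nhds
  have h1 : ℓ ≤ contractionRate f * (Real.pi / 2) := by
    refine le_of_tendsto_of_tendsto hℓ (hid.const_mul _) ?_
    filter_upwards [Ico_mem_nhdsLT (show (0 : ℝ) < Real.pi / 2 by positivity)] with b hb
    exact hf.le_rate_mul hb
  nlinarith [hf.rate_lt_one, Real.pi_pos]

/-- A uniform contraction factor for the tangent maps of the velocity component. -/
theorem IsContractingReflectionLaw.exists_factor (hf : IsContractingReflectionLaw f) :
    ∃ ρ : ℝ, 0 < ρ ∧ ρ < 1 ∧ ∀ θ ∈ Ico 0 (Real.pi / 2),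
      |lawDeriv f θ| ≤ ρ ∧ |sinRatio f θ| ≤ ρ := by
  set lam := contractionRate f with hlam
  have h0 := hf.rate_pos
  have h1 := hf.rate_lt_one
  have hpi := Real.pi_pos
  -- Write `sin θ - sin (f θ)` as `2 sin ((θ - f θ)/2) cos ((θ + f θ)/2)`. Jordan's inequality and
  -- `f θ ≤ lam * θ` bound it below by `κ * θ ≥ κ * sin θ`.
  set κ := Real.cos ((1 + lam) * (Real.pi / 4)) * ((1 - lam) * (2 / Real.pi)) with hκ
  have hcos : 0 < Real.cos ((1 + lam) * (Real.pi / 4)) :=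
    Real.cos_pos_of_mem_Ioo ⟨by nlinarith, by nlinarith⟩
  have hκ0 : 0 < κ := by
    have : 0 < 1 - lam := by linarith
    positivity
  refine ⟨max lam (1 - κ), lt_max_of_lt_left h0, max_lt h1 (by linarith), fun θ hθ =>
    ⟨(hf.abs_lawDeriv_le hθ).trans (le_max_left _ _), ?_⟩⟩
  unfold sinRatio
  split_ifs with hz
  · exact (hf.abs_lawDeriv_le (left_mem_Ico.2 (by positivity))).trans (le_max_left _ _)
  refine le_max_of_le_right ?_
  have hθ0 : 0 < θ := lt_of_le_of_ne hθ.1 (Ne.symm hz)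
  have hsin : 0 < Real.sin θ := Real.sin_pos_of_pos_of_lt_pi hθ0 (by linarith [hθ.2])
  have hfθ := hf.mapsTo hθ
  have hsf : 0 ≤ Real.sin (f θ) := Real.sin_nonneg_of_nonneg_of_le_pi hfθ.1 (by linarith [hfθ.2])
  rw [abs_of_nonneg (div_nonneg hsf hsin.le), div_le_iff₀ hsin]
  have hfl := hf.le_rate_mul hθ
  have e1 : Real.sin θ - Real.sin (f θ)
      = 2 * Real.sin ((θ - f θ) / 2) * Real.cos ((θ + f θ) / 2) := Real.sin_sub_sin _ _
  have h2 : Real.cos ((1 + lam) * (Real.pi / 4)) ≤ Real.cos ((θ + f θ) / 2) :=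
    Real.cos_le_cos_of_nonneg_of_le_pi (by linarith [hfθ.1]) (by nlinarith)
      (by nlinarith [hθ.2])
  have h3 : 2 / Real.pi * ((θ - f θ) / 2) ≤ Real.sin ((θ - f θ) / 2) :=
    Real.mul_le_sin (by nlinarith) (by linarith [hfθ.1, hθ.2])
  have h4 : (1 - lam) * (2 / Real.pi) * θ ≤ 2 * Real.sin ((θ - f θ) / 2) := by
    have : 2 / Real.pi * ((1 - lam) * θ) ≤ 2 / Real.pi * (θ - f θ) :=
      mul_le_mul_of_nonneg_left (by linarith) (by positivity)
    linarith
  have h5 : κ * θ ≤ Real.sin θ - Real.sin (f θ) := by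
    rw [e1, hκ]
    calc _ = ((1 - lam) * (2 / Real.pi) * θ) * Real.cos ((1 + lam) * (Real.pi / 4)) := by ring
      _ ≤ _ := mul_le_mul h4 h2 hcos.le (le_trans (mul_nonneg (mul_nonneg (sub_nonneg.2 h1.le)
          (div_pos two_pos hpi).le) hθ0.le) h4)
  nlinarith [mul_le_mul_of_nonneg_left (Real.sin_le hθ.1) hκ0.le]

/-- Only `θ = 0` needs an argument: there the ratio is the quotient of the difference quotients of
`sin ∘ f` and `sin`. -/
theorem IsContractingReflectionLaw.continuousOn_sinRatio (hf : IsContractingReflectionLaw f) :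
    ContinuousOn (sinRatio f) (Ico 0 (Real.pi / 2)) := by
  have hpi := Real.pi_pos
  intro θ hθ
  by_cases hz : θ = 0
  · subst hz
    rw [← continuousWithinAt_sdiff_self]
    have h1 := (hf.hasDerivWithinAt hθ).sin
    rw [hf.map_zero, Real.cos_zero, one_mul, hasDerivWithinAt_iff_tendsto_slope] at h1
    have h2 := ((Real.hasDerivAt_sin 0).hasDerivWithinAt (s := Ico 0 (Real.pi / 2)))
    rw [Real.cos_zero, hasDerivWithinAt_iff_tendsto_slope] at h2
    have h3 := h1.div h2 one_ne_zero
    rw [div_one] at h3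
    have h4 : sinRatio f 0 = lawDeriv f 0 := if_pos rfl
    unfold ContinuousWithinAt
    rw [h4]
    refine h3.congr' ?_
    filter_upwards [self_mem_nhdsWithin] with t ht
    have ht0 : t ≠ 0 := ht.2
    simp only [slope_def_field, hf.map_zero, Real.sin_zero, sub_zero, sinRatio, if_neg ht0,
      Pi.div_apply]
    rw [div_div_div_cancel_right₀ ht0]
  · have hsin : Real.sin θ ≠ 0 := (Real.sin_pos_of_pos_of_lt_pi
      (lt_of_le_of_ne hθ.1 (Ne.symm hz)) (by linarith [hθ.2])).ne'
    have h1 : ContinuousWithinAt (fun t => Real.sin (f t) / Real.sin t)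
        (Ico 0 (Real.pi / 2)) θ :=
      (Real.continuous_sin.continuousAt.comp_continuousWithinAt
        (hf.hasDerivWithinAt hθ).continuousWithinAt).div
        Real.continuous_sin.continuousWithinAt hsin
    refine h1.congr_of_eventuallyEq ?_ (if_neg hz)
    filter_upwards [mem_nhdsWithin_of_mem_nhds (isOpen_ne.mem_nhds hz)] with t ht
    exact if_neg ht

end Law

/-! ### Rank one operators and orthogonal projections. -/

section RankOne

variable {V : Type*} [NormedAddCommGroup V] [InnerProductSpace ℝ V] {η : V}

/-- The rank one operator `w ↦ ⟪a, w⟫ b`. -/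
def rankOneMap (a b : V) : V →L[ℝ] V := (innerSL ℝ a).smulRight b

/-- The operator `w ↦ w - ⟪a, w⟫ a`, the orthogonal projection onto `a^⊥` for a unit vector `a`. -/
def orthMap (a : V) : V →L[ℝ] V := ContinuousLinearMap.id ℝ (V) - rankOneMap a a

@[simp] theorem rankOneMap_apply (a b w : V) : rankOneMap a b w = inner ℝ a w • b := by
  simp [rankOneMap]

@[simp] theorem orthMap_apply (a w : V) : orthMap a w = w - inner ℝ a w • a := by
  simp [orthMap]

theorem norm_rankOneMap (a b : V) : ‖rankOneMap a b‖ = ‖a‖ * ‖b‖ := by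
  simp [rankOneMap]

theorem _root_.Continuous.rankOneMap {X : Type*} [TopologicalSpace X] {g h : X → V}
    (hg : Continuous g) (hh : Continuous h) : Continuous fun x => rankOneMap (g x) (h x) := by
  have e : (fun x => PolytopeBilliard.rankOneMap (g x) (h x))
      = fun x => (ContinuousLinearMap.smulRightL ℝ V V) (innerSL ℝ (g x)) (h x) := by
    ext x; simp [PolytopeBilliard.rankOneMap]
  rw [e]
  fun_prop

theorem continuous_orthMap : Continuous fun a : V => orthMap a :=
  continuous_const.sub (continuous_id.rankOneMap continuous_id)

theorem inner_orthMap_self (hη : ‖η‖ = 1) (w : V) : inner ℝ η (orthMap η w) = 0 := by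
  rw [orthMap_apply, inner_sub_right, real_inner_smul_right, real_inner_self_eq_norm_sq, hη]
  ring

theorem norm_sq_orthMap (hη : ‖η‖ = 1) (w : V) :
    ‖orthMap η w‖ ^ 2 = ‖w‖ ^ 2 - inner ℝ η w ^ 2 := by
  rw [orthMap_apply, norm_sub_sq_real, real_inner_smul_right, norm_smul, hη, mul_one,
    Real.norm_eq_abs, sq_abs, real_inner_comm]
  ring

theorem norm_orthMap_le (hη : ‖η‖ = 1) (w : V) : ‖orthMap η w‖ ≤ ‖w‖ := by
  refine le_of_sq_le_sq ?_ (norm_nonneg _) 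
  rw [norm_sq_orthMap hη]; nlinarith [sq_nonneg (inner ℝ η w)]

end RankOne

/-! ### The contraction of velocities at a wall. -/

section Contract

variable {d : ℕ} {f : ℝ → ℝ} {η u v : E d}

theorem projHyp_eq (η u : E d) : projHyp η u = orthMap η u := by
  rw [projHyp, orthMap_apply, real_inner_comm]

/-- The angle between `u` and the normal `η`. -/
def normalAngle (η u : E d) : ℝ := Real.arccos (inner ℝ u η)

theorem continuous_normalAngle (η : E d) : Continuous (normalAngle η) :=
  Real.continuous_arccos.comp (by fun_prop)

theorem abs_inner_le_one (hη : ‖η‖ = 1) (hu : ‖u‖ = 1) : |inner ℝ u η| ≤ 1 := by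
  simpa [hη, hu] using abs_real_inner_le_norm u η

theorem normalAngle_mem (hc : 0 < inner ℝ u η) : normalAngle η u ∈ Ico 0 (Real.pi / 2) :=
  ⟨Real.arccos_nonneg _, Real.arccos_lt_pi_div_two.2 hc⟩

theorem cos_normalAngle (hη : ‖η‖ = 1) (hu : ‖u‖ = 1) :
    Real.cos (normalAngle η u) = inner ℝ u η :=
  have h := abs_le.1 (abs_inner_le_one hη hu)
  Real.cos_arccos h.1 h.2

theorem sin_normalAngle (hη : ‖η‖ = 1) (hu : ‖u‖ = 1) :
    Real.sin (normalAngle η u) = ‖orthMap η u‖ := by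
  rw [normalAngle, Real.sin_arccos, ← Real.sqrt_sq (norm_nonneg (orthMap η u)),
    norm_sq_orthMap hη, hu, one_pow, real_inner_comm]

theorem eq_of_normalAngle_eq_zero (hη : ‖η‖ = 1) (hu : ‖u‖ = 1) (h : normalAngle η u = 0) :
    u = η := by
  have h1 := cos_normalAngle hη hu
  rw [h, Real.cos_zero] at h1
  exact (inner_eq_one_iff_of_norm_eq_one hu hη).1 h1.symm

/-- This form has no quotient that degenerates at `u = η`: the value `f' 0` built into `sinRatio`
multiplies a zero vector there. -/
theorem contract_eq (f : ℝ → ℝ) (hη : ‖η‖ = 1) (hu : ‖u‖ = 1)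
    (hc : 0 < inner ℝ u η) :
    contract f η u = Real.cos (f (normalAngle η u)) • η
      + sinRatio f (normalAngle η u) • orthMap η u := by
  have h1 := cos_normalAngle hη hu
  rw [contract, projLine, projHyp_eq, ← normalAngle, h1, smul_smul, div_mul_cancel₀ _ hc.ne']
  congr 1
  unfold sinRatio
  split_ifs with h0
  · have : orthMap η u = 0 := by
      rw [← norm_eq_zero, ← sin_normalAngle hη hu, h0, Real.sin_zero]
    rw [this, smul_zero, smul_zero]
  · rfl

theorem inner_contract (f : ℝ → ℝ) (hη : ‖η‖ = 1) (hu : ‖u‖ = 1)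
    (hc : 0 < inner ℝ u η) :
    inner ℝ (contract f η u) η = Real.cos (f (normalAngle η u)) := by
  rw [contract_eq f hη hu hc, inner_add_left, real_inner_smul_left, real_inner_smul_left,
    real_inner_self_eq_norm_sq, hη, real_inner_comm, inner_orthMap_self hη]
  ring

theorem norm_contract (hf : IsContractingReflectionLaw f) (hη : ‖η‖ = 1) (hu : ‖u‖ = 1)
    (hc : 0 < inner ℝ u η) : ‖contract f η u‖ = 1 := by
  rw [← sq_eq_sq₀ (norm_nonneg _) zero_le_one, contract_eq f hη hu hc, norm_add_sq_real,
    real_inner_smul_left, real_inner_smul_right, inner_orthMap_self hη, norm_smul, norm_smul,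
    ← sin_normalAngle hη hu, Real.norm_eq_abs, Real.norm_eq_abs, hη, mul_pow, mul_pow, sq_abs,
    sq_abs, ← mul_pow, ← mul_pow, sinRatio_mul_sin hf (normalAngle_mem hc)]
  nlinarith [Real.sin_sq_add_cos_sq (f (normalAngle η u))]

theorem specular_eq (η v : E d) : specular η v = v - (2 * inner ℝ v η) • η := rfl

theorem inner_specular (hη : ‖η‖ = 1) (v : E d) : inner ℝ (specular η v) η = - inner ℝ v η := by
  rw [specular_eq, inner_sub_left, real_inner_smul_left, real_inner_self_eq_norm_sq, hη]; ring

theorem norm_specular (hη : ‖η‖ = 1) (v : E d) : ‖specular η v‖ = ‖v‖ := by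
  rw [← sq_eq_sq₀ (norm_nonneg _) (norm_nonneg _), specular_eq, norm_sub_sq_real, norm_smul,
    real_inner_smul_right, hη, mul_one, Real.norm_eq_abs, sq_abs]
  ring

theorem orthMap_specular (hη : ‖η‖ = 1) (v : E d) : orthMap η (specular η v) = orthMap η v := by
  rw [orthMap_apply, real_inner_comm, inner_specular hη, specular_eq, orthMap_apply,
    real_inner_comm]
  module

/-- Reflections by laws with `f(π/2⁻) = ℓ` are specular up to an error of order `π/2 - ℓ`. -/
theorem nearSpecular_contract (hf : IsContractingReflectionLaw f) {ℓ : ℝ}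
    (hℓ : Tendsto f (𝓝[<] (Real.pi / 2)) (𝓝 ℓ)) (hℓ1 : Real.pi / 2 - ℓ ≤ 1)
    (hη : ‖η‖ = 1) (hv : ‖v‖ = 1) (hc : inner ℝ v η < 0) :
    NearSpecular (Real.pi / 2 - ℓ) η v (contract f η (specular η v)) := by
  have hu : ‖specular η v‖ = 1 := by rw [norm_specular hη, hv]
  have hcu : 0 < inner ℝ (specular η v) η := by rw [inner_specular hη]; linarith
  set u := specular η v with hudef
  have hθ := normalAngle_mem hcu
  have hcos := cos_normalAngle hη hu
  have hsin := sin_normalAngle hη hu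
  have hC := contract_eq f hη hu hcu
  have hg := sinRatio_mul_sin hf hθ
  have hinn := inner_contract f hη hu hcu
  set θ := normalAngle η u
  set g := sinRatio f θ
  have hfθ := hf.mapsTo hθ
  obtain ⟨hd1, hd2⟩ := hf.defect_bounds hℓ hθ
  have hlim := hf.limit_lt hℓ
  have hle := hf.le_self hθ
  have hpi := Real.pi_pos
  set y := orthMap η u with hy
  have hyv : orthMap η v = y := by rw [hy, hudef, orthMap_specular hη]
  have hu' : u = Real.cos θ • η + y := by
    rw [hcos, hy, orthMap_apply, real_inner_comm]; module
  have hv' : v = - Real.cos θ • η + y := by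
    rw [hcos, hudef, inner_specular hη, ← hyv, orthMap_apply, real_inner_comm]; module
  have hs0 : 0 ≤ Real.sin θ := hsin ▸ norm_nonneg _
  refine ⟨hc, ?_, ?_, ?_⟩
  · rw [hinn]
    exact Real.cos_pos_of_mem_Ioo ⟨by linarith [hfθ.1], hfθ.2⟩
  -- By the sum-to-product formulas `cos (f θ) + cos θ` and `sin θ - sin (f θ)` share the factor `2
  -- cos ((θ + f θ)/2)`. It is the size of the push, and what remains is a direction within `θ - f
  -- θ` of `η`.
  · refine ⟨2 * Real.cos ((θ + f θ) / 2), Real.cos ((θ - f θ) / 2) • η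
      - (Real.sin ((θ - f θ) / 2) / Real.sin θ) • y, ?_, ?_, ?_⟩
    · have h1 : Real.cos ((θ + f θ) / 2) = Real.sin (Real.pi / 2 - (θ + f θ) / 2) :=
        (Real.sin_pi_div_two_sub _).symm
      have h2 : 2 / Real.pi * (Real.pi / 2 - (θ + f θ) / 2)
          ≤ Real.sin (Real.pi / 2 - (θ + f θ) / 2) :=
        Real.mul_le_sin (by linarith [hθ.2, hfθ.2]) (by linarith [hθ.1, hfθ.1])
      -- This is the second defect bound; it makes even a grazing collision push by an amount of
      -- order `π/2 - ℓ`.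
      have h3 : (Real.pi / 2 - ℓ) / 2 ≤ Real.pi / 2 - (θ + f θ) / 2 := by linarith
      have h4 : 1 / 2 ≤ 2 / Real.pi := by
        rw [div_le_div_iff₀ two_pos hpi]; linarith [Real.pi_lt_four]
      rw [h1]
      nlinarith
    · have e1 : Real.cos ((θ - f θ) / 2) • η - (Real.sin ((θ - f θ) / 2) / Real.sin θ) • y - η
          = (Real.cos ((θ - f θ) / 2) - 1) • η
            - (Real.sin ((θ - f θ) / 2) / Real.sin θ) • y := by module
      have hx0 : 0 ≤ (θ - f θ) / 2 := by linarith
      have h1 : ‖(Real.cos ((θ - f θ) / 2) - 1) • η‖ ≤ (θ - f θ) / 2 := by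
        rw [norm_smul, hη, mul_one, Real.norm_eq_abs, abs_le]
        have := Real.one_sub_sq_div_two_le_cos (x := (θ - f θ) / 2)
        constructor <;> nlinarith [Real.cos_le_one ((θ - f θ) / 2)]
      have h2 : ‖(Real.sin ((θ - f θ) / 2) / Real.sin θ) • y‖ ≤ (θ - f θ) / 2 := by
        have h3 : 0 ≤ Real.sin ((θ - f θ) / 2) :=
          Real.sin_nonneg_of_nonneg_of_le_pi hx0 (by linarith [hθ.2, hfθ.1])
        rw [norm_smul, ← hsin, Real.norm_of_nonneg (div_nonneg h3 hs0)]
        refine le_trans ?_ (Real.sin_le hx0)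
        rcases hs0.eq_or_lt with h0 | h0
        · rw [← h0, mul_zero]; exact h3
        · rw [div_mul_cancel₀ _ h0.ne']
      rw [e1]
      linarith [norm_sub_le ((Real.cos ((θ - f θ) / 2) - 1) • η)
        ((Real.sin ((θ - f θ) / 2) / Real.sin θ) • y)]
    · have e1 : Real.cos (f θ) + Real.cos θ
          = 2 * Real.cos ((θ + f θ) / 2) * Real.cos ((θ - f θ) / 2) := by
        rw [add_comm, Real.cos_add_cos]
      have e2 : Real.sin θ - Real.sin (f θ)
          = 2 * Real.sin ((θ - f θ) / 2) * Real.cos ((θ + f θ) / 2) := Real.sin_sub_sin _ _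
      have e3 : (g - 1) • y
          = - (2 * Real.cos ((θ + f θ) / 2) * (Real.sin ((θ - f θ) / 2) / Real.sin θ)) • y := by
        rcases eq_or_ne y 0 with h0 | h0
        · rw [h0, smul_zero, smul_zero]
        · have hs : Real.sin θ ≠ 0 := by rw [hsin]; exact norm_ne_zero_iff.2 h0
          congr 1
          field_simp
          linarith
      calc contract f η u - v = (Real.cos (f θ) + Real.cos θ) • η + (g - 1) • y := by
            rw [hC, hv']; module
        _ = _ := by rw [e1, e3]; module
  · have e1 : contract f η u - u = (Real.cos (f θ) - Real.cos θ) • η + (g - 1) • y := by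
      rw [hC, hu']; module
    change ‖contract f η u - u‖ ≤ _
    have h1 : ‖(Real.cos (f θ) - Real.cos θ) • η‖ ≤ θ - f θ := by
      rw [norm_smul, hη, mul_one, Real.norm_eq_abs]
      refine (Real.abs_cos_sub_cos_le _ _).trans ?_
      rw [abs_sub_comm, abs_of_nonneg (by linarith)]
    have h2 : ‖(g - 1) • y‖ ≤ θ - f θ := by
      rw [norm_smul, ← hsin, ← Real.norm_of_nonneg hs0, ← norm_mul, sub_mul, hg, one_mul,
        Real.norm_eq_abs]
      refine (Real.abs_sin_sub_sin_le _ _).trans ?_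
      rw [abs_sub_comm, abs_of_nonneg (by linarith)]
    rw [e1]
    linarith [norm_add_le ((Real.cos (f θ) - Real.cos θ) • η) ((g - 1) • y)]

end Contract

/-! ### The derivative of the contraction along the sphere. -/

section ContractDeriv

variable {d : ℕ} {f : ℝ → ℝ} {η u v : E d}

/-- The coefficient of the part of `contractDeriv` along the meridian. -/
def meridianCoeff (f : ℝ → ℝ) (θ : ℝ) : ℝ :=
  sinRatio f θ - lawDeriv f θ * Real.cos (f θ) / Real.cos θ

/-- The derivative of `contract f η` at the unit vector `u` along the unit sphere, precomposed with
the orthogonal projection onto `u^⊥`. -/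
def contractDeriv (f : ℝ → ℝ) (η u : E d) : E d →L[ℝ] E d :=
  (sinRatio f (normalAngle η u) • orthMap η
    + (lawDeriv f (normalAngle η u) * sinRatio f (normalAngle η u)) • rankOneMap η η
    - (meridianCoeff f (normalAngle η u) / ‖orthMap η u‖ ^ 2) •
        rankOneMap (orthMap η u) (orthMap η u)) ∘L orthMap u

theorem contractDeriv_apply (f : ℝ → ℝ) (η u w : E d) :
    contractDeriv f η u w = sinRatio f (normalAngle η u) • orthMap η (orthMap u w)
    + (lawDeriv f (normalAngle η u) * sinRatio f (normalAngle η u)) •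
        inner ℝ η (orthMap u w) • η
    - (meridianCoeff f (normalAngle η u) / ‖orthMap η u‖ ^ 2) •
        inner ℝ (orthMap η u) (orthMap u w) • orthMap η u := by
  simp only [contractDeriv, ContinuousLinearMap.comp_apply, sub_apply, add_apply,
    smul_apply, rankOneMap_apply]

theorem inner_orthMap_of_orthogonal (hη : ‖η‖ = 1) (hu : ‖u‖ = 1) {z : E d}
    (hz : inner ℝ u z = 0) :
    inner ℝ (orthMap η u) z = - (Real.cos (normalAngle η u) * inner ℝ η z) := by
  rw [cos_normalAngle hη hu, orthMap_apply, inner_sub_left, real_inner_smul_left, hz,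
    real_inner_comm]
  ring

/-- The contraction maps unit vectors to unit vectors, so its derivative is tangent to the sphere at
the image; here this is checked on the formula. -/
theorem inner_contractDeriv_contract (hf : IsContractingReflectionLaw f) (hη : ‖η‖ = 1)
    (hu : ‖u‖ = 1) (hc : 0 < inner ℝ u η) (w : E d) :
    inner ℝ (contract f η u) (contractDeriv f η u w) = 0 := by
  have hz := inner_orthMap_self hu w
  rw [contractDeriv_apply, contract_eq f hη hu hc]
  set z := orthMap u w
  have hyz := inner_orthMap_of_orthogonal hη hu hz
  have hηy := inner_orthMap_self hη u
  have hηHz := inner_orthMap_self hη z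
  have hyHz : inner ℝ (orthMap η u) (orthMap η z) = inner ℝ (orthMap η u) z := by
    rw [orthMap_apply η z, inner_sub_right, real_inner_smul_right, real_inner_comm η, hηy]; ring
  have hcos : 0 < Real.cos (normalAngle η u) := by rw [cos_normalAngle hη hu]; exact hc
  have hsin := sin_normalAngle hη hu
  have hg := sinRatio_mul_sin hf (normalAngle_mem hc)
  unfold meridianCoeff
  set θ := normalAngle η u
  set y := orthMap η u
  have hyη : inner ℝ y η = 0 := by rw [real_inner_comm, hηy]
  have hηη : inner ℝ η η = (1 : ℝ) := by rw [real_inner_self_eq_norm_sq, hη, one_pow]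
  have hyy : inner ℝ y y = ‖y‖ ^ 2 := real_inner_self_eq_norm_sq y
  simp only [inner_add_left, inner_add_right, inner_sub_right, real_inner_smul_left,
    real_inner_smul_right, hηHz, hηη, hηy, hyHz, hyη, hyy, hyz]
  rcases eq_or_ne y 0 with h0 | h0
  · have hs : inner ℝ η z = 0 := by
      rw [h0, inner_zero_left] at hyz
      have := neg_eq_zero.1 hyz.symm
      exact (mul_eq_zero.1 this).resolve_left hcos.ne'
    rw [hs]; ring
  · have hn : ‖y‖ ≠ 0 := norm_ne_zero_iff.2 h0
    field_simp
    ring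

/-- The meridian component of a tangent vector is multiplied by `f'` and the components across it by
`sin (f θ) / sin θ`, with orthogonal images. With `z` tangent, `s = ⟪η, z⟫` and `y` the tangential
part of `u`, the squared meridian component is `s ^ 2 / ‖y‖ ^ 2`, which gives the identity behind
`key`. -/
theorem norm_contractDeriv_apply_le (hf : IsContractingReflectionLaw f) (hη : ‖η‖ = 1)
    (hu : ‖u‖ = 1) (hc : 0 < inner ℝ u η) {ρ : ℝ} (hρ0 : 0 ≤ ρ)
    (hρ : ∀ θ ∈ Ico 0 (Real.pi / 2), |lawDeriv f θ| ≤ ρ ∧ |sinRatio f θ| ≤ ρ) (w : E d) :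
    ‖contractDeriv f η u w‖ ≤ ρ * ‖w‖ := by
  refine le_trans ?_ (mul_le_mul_of_nonneg_left (norm_orthMap_le hu w) hρ0)
  have hz := inner_orthMap_self hu w
  rw [contractDeriv_apply]
  set z := orthMap u w
  have hyz := inner_orthMap_of_orthogonal hη hu hz
  have hηy := inner_orthMap_self hη u
  have hηHz := inner_orthMap_self hη z
  have hyHz : inner ℝ (orthMap η u) (orthMap η z) = inner ℝ (orthMap η u) z := by
    rw [orthMap_apply η z, inner_sub_right, real_inner_smul_right, real_inner_comm η, hηy]; ring
  have hHz := norm_sq_orthMap hη z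
  have hcos : 0 < Real.cos (normalAngle η u) := by rw [cos_normalAngle hη hu]; exact hc
  have hsin := sin_normalAngle hη hu
  have hg := sinRatio_mul_sin hf (normalAngle_mem hc)
  obtain ⟨hρ1, hρ2⟩ := hρ _ (normalAngle_mem hc)
  have hs2 : inner ℝ η z ^ 2 ≤ ‖orthMap η u‖ ^ 2 * ‖z‖ ^ 2 := by
    have h1 : inner ℝ η z = inner ℝ (orthMap u η) z := by
      rw [orthMap_apply, inner_sub_left, real_inner_smul_left, hz]; ring
    have h2 : ‖orthMap u η‖ ^ 2 = ‖orthMap η u‖ ^ 2 := by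
      rw [norm_sq_orthMap hu, norm_sq_orthMap hη, hη, hu, real_inner_comm]
    rw [h1, ← h2, ← mul_pow, sq_le_sq, abs_of_nonneg (a := _ * _) (by positivity)]
    exact abs_real_inner_le_norm _ _
  unfold meridianCoeff
  set θ := normalAngle η u
  set y := orthMap η u
  have hηη : inner ℝ η η = (1 : ℝ) := by rw [real_inner_self_eq_norm_sq, hη, one_pow]
  have hyη : inner ℝ y η = 0 := by rw [real_inner_comm, hηy]
  have hyy : inner ℝ y y = ‖y‖ ^ 2 := real_inner_self_eq_norm_sq y
  have hHzη : inner ℝ (orthMap η z) η = 0 := by rw [real_inner_comm, hηHz]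
  have hHzy : inner ℝ (orthMap η z) y = inner ℝ y z := by rw [real_inner_comm, hyHz]
  have hHzz : inner ℝ (orthMap η z) (orthMap η z) = ‖z‖ ^ 2 - inner ℝ η z ^ 2 := by
    rw [real_inner_self_eq_norm_sq, hHz]
  have hg1 : sinRatio f θ ^ 2 ≤ ρ ^ 2 := sq_le_sq.2 (by rwa [abs_of_nonneg hρ0])
  have hF1 : lawDeriv f θ ^ 2 ≤ ρ ^ 2 := sq_le_sq.2 (by rwa [abs_of_nonneg hρ0])
  refine le_of_sq_le_sq ?_ (by positivity)
  rw [← real_inner_self_eq_norm_sq]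
  simp only [inner_add_left, inner_add_right, inner_sub_left, inner_sub_right,
    real_inner_smul_left, real_inner_smul_right, hηHz, hηη, hηy, hyHz, hyη, hyy, hyz, hHzη, hHzy,
    hHzz]
  set s := inner ℝ η z
  rcases eq_or_ne y 0 with h0 | h0
  · have hs : s = 0 := by
      rw [h0, norm_zero] at hs2
      nlinarith
    rw [hs, h0, norm_zero]
    nlinarith [mul_le_mul_of_nonneg_right hg1 (sq_nonneg ‖z‖)]
  · have hn : 0 < ‖y‖ := norm_pos_iff.2 h0
    have hcs : Real.cos θ ^ 2 = 1 - ‖y‖ ^ 2 := by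
      rw [← hsin]; linarith [Real.sin_sq_add_cos_sq θ]
    have hcf : Real.cos (f θ) ^ 2 = 1 - sinRatio f θ ^ 2 * ‖y‖ ^ 2 := by
      rw [← hsin, ← mul_pow, hg]; linarith [Real.sin_sq_add_cos_sq (f θ)]
    set g := sinRatio f θ
    set F := lawDeriv f θ
    have hs3 : s ^ 2 / ‖y‖ ^ 2 ≤ ‖z‖ ^ 2 := by
      rw [div_le_iff₀ (by positivity)]; linarith
    have key : ∀ X : ℝ, X = g ^ 2 * ‖z‖ ^ 2 + s ^ 2 / ‖y‖ ^ 2 * (F ^ 2 - g ^ 2) →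
        X ≤ (ρ * ‖z‖) ^ 2 := by
      rintro X rfl
      have h1 : 0 ≤ s ^ 2 / ‖y‖ ^ 2 := by positivity
      have h2 : g ^ 2 * (‖z‖ ^ 2 - s ^ 2 / ‖y‖ ^ 2) ≤ ρ ^ 2 * (‖z‖ ^ 2 - s ^ 2 / ‖y‖ ^ 2) :=
        mul_le_mul_of_nonneg_right hg1 (by linarith)
      have h3 := mul_le_mul_of_nonneg_right hF1 h1
      linarith
    apply key
    have e1 : ∀ C N c : ℝ, c ≠ 0 → N ≠ 0 → c ^ 2 = 1 - N ^ 2 → C ^ 2 = 1 - g ^ 2 * N ^ 2 →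
        g * (g * (‖z‖ ^ 2 - s ^ 2)) + F * g * (s * (F * g * (s * 1)))
          + (g - F * C / c) / N ^ 2 * (- (c * s)) *
            (2 * g * (c * s) + (g - F * C / c) * (- (c * s)))
          = g ^ 2 * ‖z‖ ^ 2 + s ^ 2 / N ^ 2 * (F ^ 2 - g ^ 2) := by
      intro C N c hc hN h1 h2
      have e2 : (g - F * C / c) / N ^ 2 * (- (c * s)) *
            (2 * g * (c * s) + (g - F * C / c) * (- (c * s)))
            = s ^ 2 / N ^ 2 * (F ^ 2 * C ^ 2 - g ^ 2 * c ^ 2) := by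
        field_simp
        ring
      rw [e2, h1, h2]
      field_simp
      ring
    rw [← e1 (Real.cos (f θ)) ‖y‖ (Real.cos θ) hcos.ne' hn.ne' hcs hcf]
    field_simp
    ring

/-- The meridian direction is undefined at `u = η`, but the rank one operator divided by `‖orthMap η
u‖ ^ 2` has norm at most `1`, and its coefficient `meridianCoeff` tends to `0` there. -/
theorem continuousOn_contractDeriv (hf : IsContractingReflectionLaw f) (hη : ‖η‖ = 1) :
    ContinuousOn (contractDeriv f η) {u : E d | ‖u‖ = 1 ∧ 0 < inner ℝ u η} := by
  set A := {u : E d | ‖u‖ = 1 ∧ 0 < inner ℝ u η} with hA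
  have hmaps : MapsTo (normalAngle η) A (Ico 0 (Real.pi / 2)) := fun u hu => normalAngle_mem hu.2
  have hang : ContinuousOn (normalAngle η) A := (continuous_normalAngle η).continuousOn
  have hg : ContinuousOn (fun u => sinRatio f (normalAngle η u)) A :=
    hf.continuousOn_sinRatio.comp hang hmaps
  have hF : ContinuousOn (fun u => lawDeriv f (normalAngle η u)) A :=
    hf.continuousOn_lawDeriv.comp hang hmaps
  have hff : ContinuousOn (fun u => f (normalAngle η u)) A :=
    hf.contDiffOn.continuousOn.comp hang hmaps
  have hk : ContinuousOn (fun u => meridianCoeff f (normalAngle η u)) A := by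
    refine hg.sub ((hF.mul (Real.continuous_cos.comp_continuousOn hff)).div
      (Real.continuous_cos.comp_continuousOn hang) fun u hu => ?_)
    rw [cos_normalAngle hη hu.1]
    exact hu.2.ne'
  have hy : Continuous fun u : E d => orthMap η u := (orthMap η).continuous
  have hyy : Continuous fun u : E d => rankOneMap (orthMap η u) (orthMap η u) :=
    hy.rankOneMap hy
  have h3 : ContinuousOn (fun u => (meridianCoeff f (normalAngle η u) / ‖orthMap η u‖ ^ 2) •
      rankOneMap (orthMap η u) (orthMap η u)) A := by
    intro u hu
    by_cases h0 : orthMap η u = 0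
    · have hθ : normalAngle η u = 0 := by
        have h1 := sin_normalAngle hη hu.1
        rw [h0, norm_zero] at h1
        have h2 := normalAngle_mem hu.2
        refine le_antisymm (le_of_not_gt fun h => ?_) h2.1
        exact (Real.sin_pos_of_pos_of_lt_pi h (by linarith [h2.2, Real.pi_pos])).ne' h1
      have hk0 : meridianCoeff f (normalAngle η u) = 0 := by
        rw [hθ, meridianCoeff, hf.map_zero, sinRatio, if_pos rfl, Real.cos_zero]; ring
      have hkt : Tendsto (fun u => |meridianCoeff f (normalAngle η u)|) (𝓝[A] u) (𝓝 0) := by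
        have := (hk u hu).abs
        rw [ContinuousWithinAt, hk0, abs_zero] at this
        exact this
      rw [ContinuousWithinAt, h0, norm_zero]
      have e0 : (meridianCoeff f (normalAngle η u) / 0 ^ 2) • rankOneMap (0 : E d) 0 = 0 := by
        rw [hk0, zero_div, zero_smul]
      rw [e0]
      refine squeeze_zero_norm (fun w => ?_) hkt
      rw [norm_smul, norm_rankOneMap, norm_div, Real.norm_eq_abs, norm_pow, norm_norm, ← sq]
      rcases eq_or_ne ‖orthMap η w‖ 0 with h | h
      · rw [h]; simp
      · rw [div_mul_cancel₀ _ (pow_ne_zero 2 h)]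
    · refine ContinuousWithinAt.smul ((hk u hu).div ?_ ?_) hyy.continuousWithinAt
      · exact (hy.norm.pow 2).continuousWithinAt
      · exact pow_ne_zero 2 (norm_ne_zero_iff.2 h0)
  have h1 : ContinuousOn (fun u => sinRatio f (normalAngle η u) • orthMap η) A :=
    hg.smul continuousOn_const
  have h2 : ContinuousOn (fun u => (lawDeriv f (normalAngle η u) * sinRatio f (normalAngle η u)) •
      rankOneMap η η) A := (hF.mul hg).smul continuousOn_const
  have h4 : ContinuousOn (fun u : E d => orthMap u) A := continuous_orthMap.continuousOn
  have h5 := (h1.add h2).sub h3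
  exact ContinuousOn.clm_comp h5 h4

/-- Derivatives within the sphere are not unique in radial directions. On the sphere the identity
agrees with `v - (‖v‖² - 1)/2 • u`, whose derivative is the projection; composing with it lets
formulas on the ambient space be differentiated along the sphere. -/
theorem hasFDerivWithinAt_id_sphere (hu : ‖u‖ = 1) :
    HasFDerivWithinAt (fun v : E d => v) (orthMap u) (Metric.sphere 0 1) u := by
  have h1 : HasFDerivAt (fun v : E d => v - ((1 / 2 : ℝ) * (‖v‖ ^ 2 - 1)) • u) (orthMap u) u := by
    have h2 : HasFDerivAt (fun v : E d => ‖v‖ ^ 2) (2 • innerSL ℝ u) u :=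
      (hasStrictFDerivAt_norm_sq u).hasFDerivAt
    have h3 := ((h2.sub_const 1).const_mul (1 / 2 : ℝ)).smul_const u
    refine HasFDerivAt.congr_fderiv ((hasFDerivAt_id u).sub h3) ?_
    ext1 w
    simp
  refine h1.hasFDerivWithinAt.congr (fun v hv => ?_) ?_
  · simp [mem_sphere_zero_iff_norm.1 hv]
  · simp [hu]

theorem hasFDerivWithinAt_contract (hf : IsContractingReflectionLaw f) (hη : ‖η‖ = 1)
    (hu : ‖u‖ = 1) (hc : 0 < inner ℝ u η) :
    HasFDerivWithinAt (contract f η) (contractDeriv f η u) (Metric.sphere 0 1) u := by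
  have hθ := normalAngle_mem hc
  have hcos := cos_normalAngle hη hu
  have hsin := sin_normalAngle hη hu
  have hopen : {v : E d | 0 < inner ℝ v η} ∈ 𝓝[Metric.sphere 0 1] u :=
    mem_nhdsWithin_of_mem_nhds
      ((isOpen_lt continuous_const (by fun_prop)).mem_nhds hc)
  -- At the pole `arccos` is not differentiable, so the remainder is estimated directly. Its normal
  -- part is quadratic and its tangential part is small because `sinRatio` tends to `f' 0`. Away
  -- from the pole the chain rule applies.
  by_cases hz : normalAngle η u = 0
  · obtain rfl : u = η := eq_of_normalAngle_eq_zero hη hu hz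
    have hy0 : orthMap u u = 0 := by simp [hη]
    have hCD : contractDeriv f u u = lawDeriv f 0 • orthMap u := by
      ext1 w
      rw [contractDeriv_apply, hz, hy0, inner_orthMap_self hu, smul_zero, smul_zero, sub_zero,
        zero_smul, smul_zero, add_zero, sinRatio, if_pos rfl, orthMap_apply u (orthMap u w),
        inner_orthMap_self hu, zero_smul, sub_zero, smul_apply]
    have hlit : (fun v => contract f u v - contract f u u - lawDeriv f 0 • orthMap u (v - u))
        =ᶠ[𝓝[Metric.sphere 0 1] u] fun v => (Real.cos (f (normalAngle u v)) - 1) • u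
          + (sinRatio f (normalAngle u v) - lawDeriv f 0) • orthMap u (v - u) := by
      filter_upwards [hopen, self_mem_nhdsWithin] with v hv hv1
      rw [contract_eq f hu (mem_sphere_zero_iff_norm.1 hv1) hv, contract_eq f hu hu hc, hz,
        hf.map_zero, Real.cos_zero, map_sub, hy0]
      module
    rw [hasFDerivWithinAt_iff_isLittleO, hCD]
    refine hlit.trans_isLittleO ?_
    have hg : Tendsto (fun v => sinRatio f (normalAngle u v) - lawDeriv f 0)
        (𝓝[Metric.sphere 0 1] u) (𝓝 0) := by
      have h1 := (hf.continuousOn_sinRatio 0 (hz ▸ hθ)).tendsto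
      have h2 : Tendsto (normalAngle u) (𝓝[Metric.sphere 0 1] u)
          (𝓝[Ico 0 (Real.pi / 2)] 0) := by
        refine tendsto_nhdsWithin_iff.2 ⟨?_, ?_⟩
        · rw [← hz]; exact (continuous_normalAngle u).continuousWithinAt.tendsto
        · filter_upwards [hopen] with v hv using normalAngle_mem hv
      have h3 := (h1.comp h2).sub_const (lawDeriv f 0)
      rw [sinRatio, if_pos rfl, sub_self] at h3
      exact h3
    have hO : (fun v => orthMap u (v - u)) =O[𝓝[Metric.sphere 0 1] u] fun v => v - u :=
      Asymptotics.isBigO_of_le _ fun v => norm_orthMap_le hu _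
    refine Asymptotics.IsLittleO.add ?_ ?_
    · have h1 : (fun v => (Real.cos (f (normalAngle u v)) - 1) • u)
          =O[𝓝[Metric.sphere 0 1] u] fun v => ‖v - u‖ ^ 2 := by
        -- The constant comes from `1 - cos (f θ) ≤ θ ^ 2 / 2` and `θ ≤ π/2 * sin θ ≤ π/2 * ‖v -
        -- u‖`.
        refine Asymptotics.IsBigO.of_bound (Real.pi ^ 2 / 8) ?_
        filter_upwards [hopen, self_mem_nhdsWithin] with v hv hv1
        have hv1 := mem_sphere_zero_iff_norm.1 hv1
        have hv2 := normalAngle_mem hv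
        have h3 := hf.mapsTo hv2
        have h4 := hf.le_self hv2
        have h5 := Real.mul_le_sin hv2.1 hv2.2.le
        have hpi := Real.pi_pos
        have h6 : Real.sin (normalAngle u v) ≤ ‖v - u‖ := by
          rw [sin_normalAngle hu hv1]
          have : orthMap u v = orthMap u (v - u) := by rw [map_sub, hy0, sub_zero]
          rw [this]; exact norm_orthMap_le hu _
        rw [norm_smul, hu, mul_one, norm_pow, norm_norm, Real.norm_eq_abs, abs_sub_comm,
          abs_of_nonneg (by linarith [Real.cos_le_one (f (normalAngle u v))])]
        have h7 := Real.one_sub_sq_div_two_le_cos (x := f (normalAngle u v))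
        have h8 : normalAngle u v ≤ Real.pi / 2 * ‖v - u‖ := by
          have := h5.trans h6
          rw [div_mul_eq_mul_div, div_le_iff₀ hpi] at this
          linarith
        have h9 : f (normalAngle u v) ^ 2 ≤ (Real.pi / 2 * ‖v - u‖) ^ 2 :=
          pow_le_pow_left₀ h3.1 (h4.trans h8) 2
        nlinarith
      refine h1.trans_isLittleO ?_
      have h2 : Tendsto (fun v => ‖v - u‖) (𝓝[Metric.sphere 0 1] u) (𝓝 0) := by
        have : Continuous fun v : E d => ‖v - u‖ := by fun_prop
        simpa using this.continuousWithinAt.tendsto (x := u) (s := Metric.sphere 0 1)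
      have h3 := ((Asymptotics.isLittleO_one_iff ℝ).2 h2).mul_isBigO
        (Asymptotics.isBigO_refl (fun v => ‖v - u‖) (𝓝[Metric.sphere 0 1] u))
      simp only [one_mul, ← sq] at h3
      exact h3.trans_isBigO (Asymptotics.isBigO_refl _ _).norm_left
    · have h1 := ((Asymptotics.isLittleO_one_iff ℝ).2 hg).smul_isBigO hO
      simpa using h1
  · have hθ0 : 0 < normalAngle η u := lt_of_le_of_ne hθ.1 (Ne.symm hz)
    have hs0 : 0 < Real.sin (normalAngle η u) :=
      Real.sin_pos_of_pos_of_lt_pi hθ0 (by linarith [hθ.2, Real.pi_pos])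
    have hc1 : inner ℝ u η ≠ (1 : ℝ) := by
      intro h; exact hz (by rw [normalAngle, h, Real.arccos_one])
    have hfd : HasDerivAt f (lawDeriv f (normalAngle η u)) (normalAngle η u) :=
      (hf.hasDerivWithinAt hθ).hasDerivAt (Ico_mem_nhds hθ0 hθ.2)
    have harc : HasDerivAt Real.arccos (- (1 / Real.sin (normalAngle η u))) (inner ℝ u η) := by
      have := Real.hasDerivAt_arccos (x := inner ℝ u η) (by linarith) hc1
      rwa [← Real.sin_arccos] at this
    have hin : HasFDerivAt (fun v : E d => inner ℝ v η) (innerSL ℝ η) u := by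
      have h1 : (fun v : E d => inner ℝ v η) = fun v => innerSL ℝ η v := by
        ext v; rw [innerSL_apply_apply, real_inner_comm]
      rw [h1]; exact (innerSL ℝ η).hasFDerivAt
    have hang : HasFDerivAt (normalAngle η)
        ((- (1 / Real.sin (normalAngle η u))) • innerSL ℝ η) u := harc.comp_hasFDerivAt u hin
    have ha := (hfd.cos.comp_hasFDerivAt u hang).smul_const η
    have hb := ((hfd.sin.div (Real.hasDerivAt_sin _) hs0.ne').comp_hasFDerivAt u hang).smul
      (orthMap η).hasFDerivAt
    have hC := ((ha.add hb).hasFDerivWithinAt (s := Metric.sphere 0 1)).comp u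
      (hasFDerivWithinAt_id_sphere hu) (mapsTo_id _)
    refine (hC.congr_of_eventuallyEq ?_ ?_).congr_fderiv ?_
    · filter_upwards [hopen, self_mem_nhdsWithin,
        mem_nhdsWithin_of_mem_nhds ((isOpen_ne.preimage (continuous_normalAngle η)).mem_nhds hz)]
        with v hv hv1 hv2
      rw [contract_eq f hη (mem_sphere_zero_iff_norm.1 hv1) hv, sinRatio, if_neg hv2]
      rfl
    · rw [contract_eq f hη hu hc, sinRatio, if_neg hz]
      rfl
    · ext1 w
      have hyz := inner_orthMap_of_orthogonal hη hu (inner_orthMap_self hu w)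
      rw [contractDeriv_apply, hyz, meridianCoeff, ← hsin]
      have hcpos : Real.cos (normalAngle η u) ≠ 0 := by rw [hcos]; exact hc.ne'
      have hg : sinRatio f (normalAngle η u)
          = Real.sin (f (normalAngle η u)) / Real.sin (normalAngle η u) := if_neg hz
      rw [hg]
      simp only [ContinuousLinearMap.comp_apply, add_apply,
        smul_apply, ContinuousLinearMap.smulRight_apply, innerSL_apply_apply, smul_eq_mul,
        Function.comp_apply, Pi.div_apply, smul_smul]
      set s := inner ℝ η (orthMap u w)
      set S := Real.sin (normalAngle η u)
      have hS : S ≠ 0 := hs0.ne'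
      match_scalars <;> field_simp
      all_goals ring

end ContractDeriv

/-! ### Points of the relative interior. -/

section RelativeInterior

variable {V : Type*} [NormedAddCommGroup V] [InnerProductSpace ℝ V] {s : Set V} {p q : V}

theorem exists_add_smul_sub_mem_of_mem_intrinsicInterior (hp : p ∈ intrinsicInterior ℝ s)
    (hq : q ∈ s) : ∃ t : ℝ, 0 < t ∧ p + t • (p - q) ∈ s := by
  obtain ⟨y, hy, rfl⟩ := mem_intrinsicInterior.1 hp
  have hqs : q ∈ affineSpan ℝ s := subset_affineSpan ℝ s hq
  have hmem : ∀ t : ℝ, (y : V) + t • ((y : V) - q) ∈ affineSpan ℝ s := by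
    intro t
    have h := AffineSubspace.vadd_mem_of_mem_direction ((affineSpan ℝ s).direction.smul_mem t
      (AffineSubspace.vsub_mem_direction y.2 hqs)) y.2
    rwa [vadd_eq_add, vsub_eq_sub, add_comm] at h
  let γ : ℝ → affineSpan ℝ s := fun t => ⟨(y : V) + t • ((y : V) - q), hmem t⟩
  have hγ : Continuous γ := by
    refine Continuous.subtype_mk ?_ _
    fun_prop
  have h0 : γ 0 = y := Subtype.ext (by simp [γ])
  have h1 : γ ⁻¹' interior ((↑) ⁻¹' s) ∈ 𝓝 (0 : ℝ) :=
    (isOpen_interior.preimage hγ).mem_nhds (by rw [mem_preimage, h0]; exact hy)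
  obtain ⟨ε, hε, hball⟩ := Metric.mem_nhds_iff.1 h1
  refine ⟨ε / 2, by positivity, ?_⟩
  have h2 : ε / 2 ∈ Metric.ball (0 : ℝ) ε := by
    rw [Metric.mem_ball, dist_zero_right, Real.norm_of_nonneg (by positivity)]; linarith
  have h3 : γ (ε / 2) ∈ ((↑) : affineSpan ℝ s → V) ⁻¹' s := interior_subset (hball h2)
  exact h3

/-- If the functional were larger at `q`, continuing the segment from `q` slightly beyond `p` would
give a value below the minimum. -/
theorem inner_eq_of_mem_intrinsicInterior {η : V} (hp : p ∈ intrinsicInterior ℝ s)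
    (hmin : ∀ x ∈ s, inner ℝ p η ≤ inner ℝ x η) (hq : q ∈ s) : inner ℝ q η = inner ℝ p η := by
  obtain ⟨t, ht, hmem⟩ := exists_add_smul_sub_mem_of_mem_intrinsicInterior hp hq
  have h1 := hmin _ hmem
  rw [inner_add_left, real_inner_smul_left, inner_sub_left] at h1
  have h2 := hmin q hq
  nlinarith

end RelativeInterior

/-! ### Facets of a polytope and their normals. -/

section Polytope

variable {d : ℕ} {P : Set (E d)} {η η' p : E d}

/-- The minimum of `⟪·, η⟫` on `P`. -/
def supportVal (P : Set (E d)) (η : E d) : ℝ := sInf ((fun p => inner ℝ p η) '' P)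

theorem IsPolytope.nonempty (hP : IsPolytope P) : P.Nonempty := by
  by_contra h
  rw [Set.not_nonempty_iff_eq_empty] at h
  have h1 := hP.2.2
  rw [h, AffineSubspace.span_empty] at h1
  exact bot_ne_top h1

theorem IsPolytope.convex (hP : IsPolytope P) : Convex ℝ P := by
  obtain ⟨H, -, rfl⟩ := hP.2.1
  intro x hx y hy a b ha hb hab h hh
  rw [inner_add_left, real_inner_smul_left, real_inner_smul_left]
  have h1 := hx h hh
  have h2 := hy h hh
  calc _ ≤ a * h.2 + b * h.2 := by gcongr
    _ = h.2 := by rw [← add_mul, hab, one_mul]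

theorem IsPolytope.isLeast_supportVal (hP : IsPolytope P) (η : E d) :
    IsLeast ((fun p => inner ℝ p η) '' P) (supportVal P η) :=
  (hP.1.image (by fun_prop)).isLeast_sInf (hP.nonempty.image _)

theorem IsPolytope.supportVal_le (hP : IsPolytope P) (hp : p ∈ P) (η : E d) :
    supportVal P η ≤ inner ℝ p η := (hP.isLeast_supportVal η).2 ⟨p, hp, rfl⟩

theorem IsPolytope.mem_face_iff (hP : IsPolytope P) :
    p ∈ face P η ↔ p ∈ P ∧ inner ℝ p η = supportVal P η := by
  obtain ⟨⟨q, hq, hqη⟩, hle⟩ := hP.isLeast_supportVal η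
  refine ⟨fun h => ⟨h.1, le_antisymm (hqη ▸ h.2 q hq) (hP.supportVal_le h.1 η)⟩, fun h =>
    ⟨h.1, fun x hx => h.2 ▸ hP.supportVal_le hx η⟩⟩

theorem IsPolytope.face_nonempty (hP : IsPolytope P) (η : E d) : (face P η).Nonempty := by
  obtain ⟨⟨q, hq, hqη⟩, -⟩ := hP.isLeast_supportVal η
  exact ⟨q, hP.mem_face_iff.2 ⟨hq, hqη⟩⟩

theorem IsPolytope.convex_face (hP : IsPolytope P) (η : E d) : Convex ℝ (face P η) := by
  intro x hx y hy a b ha hb hab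
  rw [hP.mem_face_iff] at *
  refine ⟨hP.convex hx.1 hy.1 ha hb hab, ?_⟩
  rw [inner_add_left, real_inner_smul_left, real_inner_smul_left, hx.2, hy.2, ← add_mul, hab,
    one_mul]

theorem vectorSpan_face_le (P : Set (E d)) (η : E d) :
    vectorSpan ℝ (face P η) ≤ (Submodule.span ℝ {η})ᗮ := by
  rw [vectorSpan_def, Submodule.span_le]
  rintro _ ⟨x, hx, y, hy, rfl⟩
  rw [SetLike.mem_coe, Submodule.mem_orthogonal_singleton_iff_inner_left]
  change inner ℝ (x - y) η = 0
  rw [inner_sub_left, le_antisymm (hx.2 y hy.1) (hy.2 x hx.1), sub_self]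

theorem finrank_orthogonal_unit (hη : ‖η‖ = 1) :
    Module.finrank ℝ (Submodule.span ℝ {η})ᗮ + 1 = d := by
  have h1 := Submodule.finrank_add_finrank_orthogonal (Submodule.span ℝ {η})
  have h2 : η ≠ 0 := by rintro rfl; simp at hη
  rw [finrank_span_singleton h2, finrank_euclideanSpace_fin] at h1
  omega

theorem IsFacetNormal.vectorSpan_eq (h : IsFacetNormal P η) :
    vectorSpan ℝ (face P η) = (Submodule.span ℝ {η})ᗮ :=
  Submodule.eq_of_le_of_finrank_eq (vectorSpan_face_le P η)
    (by have := finrank_orthogonal_unit h.1; have := h.2; omega)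

/-- A supporting hyperplane that locally bounds `P` near one of its points determines a facet. -/
theorem isFacetNormal_of_ball (hη : ‖η‖ = 1) (hp : p ∈ face P η) {r : ℝ} (hr : 0 < r)
    (hball : ∀ q ∈ Metric.ball p r, inner ℝ q η = inner ℝ p η → q ∈ P) :
    IsFacetNormal P η := by
  refine ⟨hη, ?_⟩
  have : vectorSpan ℝ (face P η) = (Submodule.span ℝ {η})ᗮ := by
    refine le_antisymm (vectorSpan_face_le P η) fun w hw => ?_
    rw [Submodule.mem_orthogonal_singleton_iff_inner_left] at hw
    set t := r / (2 * (‖w‖ + 1)) with ht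
    have ht0 : 0 < t := by positivity
    have h1 : inner ℝ (p + t • w) η = inner ℝ p η := by
      rw [inner_add_left, real_inner_smul_left, hw, mul_zero, add_zero]
    have h2 : p + t • w ∈ face P η := by
      refine ⟨hball _ ?_ h1, fun q hq => by rw [h1]; exact hp.2 q hq⟩
      rw [Metric.mem_ball, dist_self_add_left, norm_smul, Real.norm_of_nonneg ht0.le, ht,
        div_mul_eq_mul_div, div_lt_iff₀ (by positivity)]
      nlinarith [norm_nonneg w]
    have h3 := vsub_mem_vectorSpan ℝ h2 hp
    rw [vsub_eq_sub, add_sub_cancel_left] at h3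
    simpa [smul_smul, ht0.ne'] using Submodule.smul_mem _ t⁻¹ h3
  rw [this]
  exact finrank_orthogonal_unit hη

theorem IsPolytope.exists_forall_inner_lt (hP : IsPolytope P) {H : Finset (E d × ℝ)}
    (h0 : ∀ h ∈ H, h.1 ≠ 0) (hPH : P = {x | ∀ h ∈ H, inner ℝ x h.1 ≤ h.2}) :
    ∃ x, ∀ h ∈ H, inner ℝ x h.1 < h.2 := by
  obtain ⟨x, hx⟩ := (hP.convex.interior_nonempty_iff_affineSpan_eq_top).2 hP.2.2
  refine ⟨x, fun h hh => ?_⟩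
  obtain ⟨r, hr, hball⟩ := Metric.mem_nhds_iff.1 (mem_interior_iff_mem_nhds.1 hx)
  have hn : 0 < ‖h.1‖ := norm_pos_iff.2 (h0 h hh)
  have hmem : x + (r / (2 * ‖h.1‖)) • h.1 ∈ P := by
    apply hball
    rw [Metric.mem_ball, dist_self_add_left, norm_smul, Real.norm_of_nonneg (by positivity)]
    field_simp
    norm_num
  rw [hPH] at hmem
  have h1 := hmem h hh
  rw [inner_add_left, real_inner_smul_left, real_inner_self_eq_norm_sq] at h1
  have h2 : 0 < r / (2 * ‖h.1‖) * ‖h.1‖ ^ 2 := by positivity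
  linarith

/-- The interior unit normal of the half-space `{x | ⟪x, h.1⟫ ≤ h.2}`. -/
def halfSpaceNormal (h : E d × ℝ) : E d := -(‖h.1‖⁻¹ • h.1)

theorem norm_halfSpaceNormal {h : E d × ℝ} (h0 : h.1 ≠ 0) : ‖halfSpaceNormal h‖ = 1 := by
  rw [halfSpaceNormal, norm_neg, norm_smul, norm_inv, norm_norm,
    inv_mul_cancel₀ (norm_ne_zero_iff.2 h0)]

theorem inner_halfSpaceNormal (h : E d × ℝ) (x : E d) :
    inner ℝ x (halfSpaceNormal h) = - (‖h.1‖⁻¹ * inner ℝ x h.1) := by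
  rw [halfSpaceNormal, inner_neg_right, real_inner_smul_right]

/-- An irredundant description of a polytope by half-spaces, each of which determines a facet. -/
theorem IsPolytope.exists_irredundant (hP : IsPolytope P) :
    ∃ H : Finset (E d × ℝ), (∀ h ∈ H, h.1 ≠ 0) ∧ P = {x | ∀ h ∈ H, inner ℝ x h.1 ≤ h.2} ∧
      ∀ h ∈ H, IsFacetNormal P (halfSpaceNormal h) ∧
        supportVal P (halfSpaceNormal h) = - (‖h.1‖⁻¹ * h.2) := by
  classical
  let A : Set (Finset (E d × ℝ)) :=
    {H | (∀ h ∈ H, h.1 ≠ 0) ∧ P = {x | ∀ h ∈ H, inner ℝ x h.1 ≤ h.2}}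
  have hA : A.Nonempty := hP.2.1
  -- A description with the fewest half-spaces is irredundant.
  obtain ⟨H, ⟨h0, hPH⟩, hmin⟩ : ∃ H ∈ A, ∀ H' ∈ A, H.card ≤ H'.card := by
    refine ⟨Function.argminOn Finset.card A hA, Function.argminOn_mem _ _ _, fun H' h' => ?_⟩
    exact Function.argminOn_le _ _ h'
  refine ⟨H, h0, hPH, fun h hh => ?_⟩
  obtain ⟨x, hx⟩ := hP.exists_forall_inner_lt h0 hPH
  -- By minimality, dropping `h` admits a new point `y`. The segment to `y` from the interior point
  -- `x` crosses the hyperplane of `h` at a point strictly inside all other half-spaces, so near it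
  -- the hyperplane is contained in `P`.
  obtain ⟨y, hy, hyh⟩ : ∃ y, (∀ h' ∈ H.erase h, inner ℝ y h'.1 ≤ h'.2) ∧ h.2 < inner ℝ y h.1 := by
    by_contra! hcon
    have h1 : H.erase h ∈ A := by
      refine ⟨fun h' hh' => h0 h' (Finset.mem_of_mem_erase hh'), ?_⟩
      rw [hPH]
      ext z
      refine ⟨fun hz h' hh' => hz h' (Finset.mem_of_mem_erase hh'), fun hz h' hh' => ?_⟩
      by_cases he : h' = h
      · rw [he]; exact hcon z hz
      · exact hz h' (Finset.mem_erase.2 ⟨he, hh'⟩)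
    have h2 := hmin _ h1
    rw [Finset.card_erase_of_mem hh] at h2
    have := Finset.card_pos.2 ⟨h, hh⟩
    omega
  set t := (h.2 - inner ℝ x h.1) / (inner ℝ y h.1 - inner ℝ x h.1) with ht
  have hxh := hx h hh
  have hD : 0 < inner ℝ y h.1 - inner ℝ x h.1 := by linarith
  have ht0 : 0 < t := div_pos (by linarith) hD
  have ht1 : t < 1 := by rw [ht, div_lt_one hD]; linarith
  set z := x + t • (y - x) with hz
  have hzin : ∀ w : E d, inner ℝ z w = (1 - t) * inner ℝ x w + t * inner ℝ y w := by
    intro w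
    rw [hz, inner_add_left, real_inner_smul_left, inner_sub_left]; ring
  have hzh : inner ℝ z h.1 = h.2 := by
    rw [hzin]
    have : t * (inner ℝ y h.1 - inner ℝ x h.1) = h.2 - inner ℝ x h.1 := div_mul_cancel₀ _ hD.ne'
    linarith
  have hz' : ∀ h' ∈ H, h' ≠ h → inner ℝ z h'.1 < h'.2 := by
    intro h' hh' hne
    rw [hzin]
    have h1 := hx h' hh'
    have h2 := hy h' (Finset.mem_erase.2 ⟨hne, hh'⟩)
    nlinarith
  have hzP : z ∈ P := by
    rw [hPH]
    intro h' hh'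
    by_cases he : h' = h
    · rw [he, hzh]
    · exact (hz' h' hh' he).le
  have hn : 0 < ‖h.1‖ := norm_pos_iff.2 (h0 h hh)
  have hface : z ∈ face P (halfSpaceNormal h) := by
    refine ⟨hzP, fun q hq => ?_⟩
    rw [inner_halfSpaceNormal, inner_halfSpaceNormal, neg_le_neg_iff, hzh]
    rw [hPH] at hq
    exact mul_le_mul_of_nonneg_left (hq h hh) (by positivity)
  refine ⟨?_, ?_⟩
  · have hopen : IsOpen {q : E d | ∀ h' ∈ H.erase h, inner ℝ q h'.1 < h'.2} := by
      have : {q : E d | ∀ h' ∈ H.erase h, inner ℝ q h'.1 < h'.2}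
          = ⋂ h' ∈ H.erase h, {q : E d | inner ℝ q h'.1 < h'.2} := by ext; simp
      rw [this]
      exact isOpen_biInter_finset fun h' _ => isOpen_lt (by fun_prop) continuous_const
    obtain ⟨r, hr, hball⟩ := Metric.isOpen_iff.1 hopen z
      fun h' hh' => hz' h' (Finset.mem_of_mem_erase hh') (Finset.ne_of_mem_erase hh')
    refine isFacetNormal_of_ball (norm_halfSpaceNormal (h0 h hh)) hface hr fun q hq hqη => ?_
    rw [inner_halfSpaceNormal, inner_halfSpaceNormal, neg_inj,
      mul_right_inj' (inv_ne_zero hn.ne'), hzh] at hqη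
    rw [hPH]
    intro h' hh'
    by_cases he : h' = h
    · rw [he, hqη]
    · exact (hball hq h' (Finset.mem_erase.2 ⟨he, hh'⟩)).le
  · rw [← (hP.mem_face_iff.1 hface).2, inner_halfSpaceNormal, hzh]

/-- A polytope is the intersection of the half-spaces determined by its facets. -/
theorem IsPolytope.mem_iff (hP : IsPolytope P) :
    p ∈ P ↔ ∀ η, IsFacetNormal P η → supportVal P η ≤ inner ℝ p η := by
  refine ⟨fun hp η _ => hP.supportVal_le hp η, fun h => ?_⟩
  obtain ⟨H, h0, hPH, hH⟩ := hP.exists_irredundant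
  rw [hPH]
  intro g hg
  obtain ⟨h1, h2⟩ := hH g hg
  have h3 := h _ h1
  rw [h2, inner_halfSpaceNormal, neg_le_neg_iff] at h3
  exact le_of_mul_le_mul_left h3 (inv_pos.2 (norm_pos_iff.2 (h0 g hg)))

/-- The functional `⟪·, η'⟫` is minimal at a relative interior point of the facet of `η`, hence
constant on that facet. So `η' = ± η`, and the sign `-` would make `P` flat. -/
theorem facetNormal_unique (hP : IsPolytope P) (h : IsFacetNormal P η) (h' : IsFacetNormal P η')
    (hp : p ∈ intrinsicInterior ℝ (face P η)) (hp' : p ∈ face P η') : η' = η := by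
  have hpf := intrinsicInterior_subset hp
  have h1 : (Submodule.span ℝ {η})ᗮ ≤ (Submodule.span ℝ {η'})ᗮ := by
    rw [← h.vectorSpan_eq, vectorSpan_def, Submodule.span_le]
    rintro _ ⟨x, hx, y, hy, rfl⟩
    rw [SetLike.mem_coe, Submodule.mem_orthogonal_singleton_iff_inner_left]
    change inner ℝ (x - y) η' = 0
    have hmin : ∀ x ∈ face P η, inner ℝ p η' ≤ inner ℝ x η' := fun x hx => hp'.2 x hx.1
    rw [inner_sub_left, inner_eq_of_mem_intrinsicInterior hp hmin hx,
      inner_eq_of_mem_intrinsicInterior hp hmin hy, sub_self]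
  have h2 := Submodule.orthogonal_le h1
  rw [Submodule.orthogonal_orthogonal, Submodule.orthogonal_orthogonal] at h2
  obtain ⟨c, hc⟩ := Submodule.mem_span_singleton.1 (h2 (Submodule.mem_span_singleton_self η'))
  have h3 : |c| = 1 := by
    have := h'.1
    rwa [← hc, norm_smul, h.1, mul_one] at this
  rcases (abs_eq one_pos.le).1 h3 with rfl | rfl
  · rw [← hc, one_smul]
  · exfalso
    rw [neg_smul, one_smul] at hc
    have h4 : P ⊆ face P η := by
      intro q hq
      refine ⟨hq, fun x hx => ?_⟩
      have h5 := hp'.2 q hq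
      rw [← hc, inner_neg_right, inner_neg_right, neg_le_neg_iff] at h5
      exact h5.trans (hpf.2 x hx)
    have h6 : vectorSpan ℝ P ≤ (Submodule.span ℝ {η})ᗮ :=
      (vectorSpan_mono ℝ h4).trans (vectorSpan_face_le P η)
    rw [← direction_affineSpan, hP.2.2, AffineSubspace.direction_top] at h6
    have h7 := h6 (Submodule.mem_top (x := η))
    rw [Submodule.mem_orthogonal_singleton_iff_inner_left, real_inner_self_eq_norm_sq, h.1] at h7
    norm_num at h7

/-- A relative interior point of a facet lies on the boundary of some half-space of the description,
for otherwise it could be moved inside `P` along `-η`. By uniqueness `η` is the normal of that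
half-space. -/
theorem IsPolytope.finite_facetNormals (hP : IsPolytope P) :
    {η | IsFacetNormal P η}.Finite := by
  obtain ⟨H, h0, hPH, hH⟩ := hP.exists_irredundant
  refine (H.finite_toSet.image halfSpaceNormal).subset fun η hη => ?_
  obtain ⟨p, hp⟩ := (hP.face_nonempty η).intrinsicInterior (hP.convex_face η)
  have hpf := intrinsicInterior_subset hp
  obtain ⟨h, hh, htight⟩ : ∃ h ∈ H, inner ℝ p h.1 = h.2 := by
    by_contra! hcon
    have hpP := hpf.1
    rw [hPH] at hpP
    have hopen : IsOpen {q : E d | ∀ h' ∈ H, inner ℝ q h'.1 < h'.2} := by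
      have : {q : E d | ∀ h' ∈ H, inner ℝ q h'.1 < h'.2}
          = ⋂ h' ∈ H, {q : E d | inner ℝ q h'.1 < h'.2} := by ext; simp
      rw [this]
      exact isOpen_biInter_finset fun h' _ => isOpen_lt (by fun_prop) continuous_const
    obtain ⟨r, hr, hball⟩ := Metric.isOpen_iff.1 hopen p
      fun h' hh' => lt_of_le_of_ne (hpP h' hh') (hcon h' hh')
    have h1 : p - (r / 2) • η ∈ P := by
      rw [hPH]
      refine fun h' hh' => (hball ?_ h' hh').le
      rw [Metric.mem_ball, dist_self_sub_left, norm_smul, hη.1,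
        Real.norm_of_nonneg (by positivity)]
      linarith
    have h2 := hpf.2 _ h1
    rw [inner_sub_left, real_inner_smul_left, real_inner_self_eq_norm_sq, hη.1] at h2
    linarith
  refine ⟨h, hh, ?_⟩
  obtain ⟨h1, h2⟩ := hH h hh
  refine facetNormal_unique hP hη h1 hp (hP.mem_face_iff.2 ⟨hpf.1, ?_⟩)
  rw [inner_halfSpaceNormal, htight, h2]

theorem IsPolytope.isOpen_strict (hP : IsPolytope P) (η : E d) :
    IsOpen {q : E d | ∀ η', IsFacetNormal P η' → η' ≠ η → supportVal P η' < inner ℝ q η'} := by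
  have : {q : E d | ∀ η', IsFacetNormal P η' → η' ≠ η → supportVal P η' < inner ℝ q η'}
      = ⋂ η' ∈ {η' | IsFacetNormal P η' ∧ η' ≠ η},
        {q : E d | supportVal P η' < inner ℝ q η'} := by
    ext; simp
  rw [this]
  exact (hP.finite_facetNormals.subset fun η' h => h.1).isOpen_biInter
    fun η' _ => isOpen_lt continuous_const (by fun_prop)

/-- The relative interior of a facet consists of the points that lie on no other facet. -/
theorem IsPolytope.mem_facetInterior_iff (hP : IsPolytope P) (h : IsFacetNormal P η) :
    p ∈ intrinsicInterior ℝ (face P η) ↔ inner ℝ p η = supportVal P η ∧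
      ∀ η', IsFacetNormal P η' → η' ≠ η → supportVal P η' < inner ℝ p η' := by
  constructor
  · intro hp
    have hpf := hP.mem_face_iff.1 (intrinsicInterior_subset hp)
    refine ⟨hpf.2, fun η' h' hne => lt_of_le_of_ne (hP.supportVal_le hpf.1 η') fun heq => hne ?_⟩
    exact facetNormal_unique hP h h' hp (hP.mem_face_iff.2 ⟨hpf.1, heq.symm⟩)
  · rintro ⟨h1, h2⟩
    have hmem : ∀ q : E d, inner ℝ q η = supportVal P η →
        (∀ η', IsFacetNormal P η' → η' ≠ η → supportVal P η' < inner ℝ q η') → q ∈ face P η := by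
      intro q hq1 hq2
      refine hP.mem_face_iff.2 ⟨hP.mem_iff.2 fun η' h' => ?_, hq1⟩
      by_cases he : η' = η
      · rw [he, hq1]
      · exact (hq2 η' h' he).le
    have hpf := hmem p h1 h2
    refine mem_intrinsicInterior.2 ⟨⟨p, subset_affineSpan ℝ _ hpf⟩, ?_, rfl⟩
    refine mem_interior.2 ⟨((↑) : affineSpan ℝ (face P η) → E d) ⁻¹' {q : E d | ∀ η', IsFacetNormal P η' → η' ≠ η →
      supportVal P η' < inner ℝ q η'}, ?_, (hP.isOpen_strict η).preimage continuous_subtype_val,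
      h2⟩
    intro y hy
    refine hmem y ?_ hy
    have h3 : (y : E d) -ᵥ p ∈ (affineSpan ℝ (face P η)).direction :=
      AffineSubspace.vsub_mem_direction y.2 (subset_affineSpan ℝ _ hpf)
    rw [direction_affineSpan] at h3
    have h4 := vectorSpan_face_le P η h3
    rw [Submodule.mem_orthogonal_singleton_iff_inner_left, vsub_eq_sub, inner_sub_left] at h4
    linarith

theorem normalAt_eq (hP : IsPolytope P) (h : IsFacetNormal P η)
    (hp : p ∈ intrinsicInterior ℝ (face P η)) : normalAt P p = η := by
  have hex : ∃ η, IsFacetNormal P η ∧ p ∈ intrinsicInterior ℝ (face P η) := ⟨η, h, hp⟩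
  rw [normalAt, dif_pos hex]
  exact facetNormal_unique hP h hex.choose_spec.1 hp
    (intrinsicInterior_subset hex.choose_spec.2)

theorem mem_facetInterior_of_notMem_skeleton (h : IsFacetNormal P η) (hp : p ∈ face P η)
    (hs : p ∉ skeleton P) : p ∈ intrinsicInterior ℝ (face P η) := by
  by_contra hcon
  refine hs ⟨η, h, ?_⟩
  rw [← intrinsicClosure_sdiff_intrinsicInterior]
  exact ⟨subset_intrinsicClosure hp, hcon⟩

/-- A nonzero direction always leaves a polytope. -/
theorem IsPolytope.exists_inner_neg (hP : IsPolytope P) {w : E d} (hw : w ≠ 0) :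
    ∃ η, IsFacetNormal P η ∧ inner ℝ w η < 0 := by
  by_contra! hcon
  obtain ⟨x, hx⟩ := hP.nonempty
  obtain ⟨R, hR⟩ := hP.1.isBounded.exists_norm_le
  have hn : 0 < ‖w‖ := norm_pos_iff.2 hw
  obtain ⟨n, hn'⟩ := exists_nat_gt ((R + ‖x‖) / ‖w‖)
  have hmem : x + (n : ℝ) • w ∈ P := by
    refine hP.mem_iff.2 fun η h => ?_
    rw [inner_add_left, real_inner_smul_left]
    have h1 := hP.supportVal_le hx η
    have h2 := mul_nonneg (Nat.cast_nonneg (α := ℝ) n) (hcon η h)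
    linarith
  have h1 := hR _ hmem
  have h2 : ‖(n : ℝ) • w‖ ≤ ‖x + (n : ℝ) • w‖ + ‖x‖ := by
    have := norm_sub_le (x + (n : ℝ) • w) x
    rwa [add_sub_cancel_left] at this
  rw [norm_smul, Real.norm_of_nonneg (Nat.cast_nonneg _)] at h2
  rw [div_lt_iff₀ hn] at hn'
  linarith

/-- Otherwise some nonzero direction is orthogonal to all normals and never leaves `P`. -/
theorem IsPolytope.le_card_facetNormals (hP : IsPolytope P) :
    d ≤ hP.finite_facetNormals.toFinset.card := by
  by_contra! hcon
  set F := hP.finite_facetNormals.toFinset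
  have h1 : Module.finrank ℝ (Submodule.span ℝ (F : Set (E d))) < d :=
    (finrank_span_finset_le_card F).trans_lt hcon
  have h2 : (Submodule.span ℝ (F : Set (E d)))ᗮ ≠ ⊥ := by
    intro h
    have := Submodule.finrank_add_finrank_orthogonal (Submodule.span ℝ (F : Set (E d)))
    rw [h, finrank_bot, finrank_euclideanSpace_fin] at this
    omega
  obtain ⟨w, hw, hw0⟩ := Submodule.exists_mem_ne_zero_of_ne_bot h2
  obtain ⟨η, hη, hneg⟩ := hP.exists_inner_neg hw0
  have h3 := (Submodule.mem_orthogonal _ w).1 hw η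
    (Submodule.subset_span (by simpa [F] using hη))
  rw [real_inner_comm] at h3
  linarith

/-- There are at least `d` facets, so the family can be enlarged to exactly `d` normals, where
general position applies. -/
theorem linearIndependent_of_card_le (hP : IsPolytope P) (hgen : InGeneralPosition P)
    {S : Finset (E d)} (hS : ∀ η ∈ S, IsFacetNormal P η) (hcard : S.card ≤ d) :
    LinearIndependent ℝ (fun η : S => (η : E d)) := by
  obtain ⟨T, hST, hTF, hT⟩ := Finset.exists_subsuperset_card_eq
    (s := S) (t := hP.finite_facetNormals.toFinset) (fun η hη => by simpa using hS η hη) hcard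
    hP.le_card_facetNormals
  have h1 := hgen.1 T (fun η hη => by simpa using hTF hη) hT
  exact h1.comp (fun η : S => (⟨η, hST η.2⟩ : T)) fun a b hab => Subtype.ext (by simpa using hab)

theorem span_eq_top_of_le_card (hgen : InGeneralPosition P)
    {S : Finset (E d)} (hS : ∀ η ∈ S, IsFacetNormal P η) (hcard : d ≤ S.card) :
    Submodule.span ℝ (S : Set (E d)) = ⊤ := by
  obtain ⟨T, hTS, hT⟩ := Finset.exists_subset_card_eq hcard
  have h1 := hgen.1 T (fun η hη => hS η (hTS hη)) hT
  have h2 := h1.span_eq_top_of_card_eq_finrank' (by simp [hT])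
  rw [Subtype.range_coe_subtype] at h2
  rw [eq_top_iff, ← h2]
  exact Submodule.span_mono fun x hx => hTS hx

end Polytope

/-! ### Free flights and the derivative of the billiard map. -/

section Flight

variable {d : ℕ} {P : Set (E d)} {f : ℝ → ℝ} {η η' : E d} {x : E d × E d} {τ : ℝ}

/-- The particle at `x` moves from the interior of the facet with normal `η` to the interior of the
facet with normal `η'` in time `τ`. -/
structure IsFlight (P : Set (E d)) (x : E d × E d) (η η' : E d) (τ : ℝ) : Prop where
  facet : IsFacetNormal P η
  facet' : IsFacetNormal P η'
  start : x.1 ∈ intrinsicInterior ℝ (face P η)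
  unit : ‖x.2‖ = 1
  outgoing : 0 < inner ℝ x.2 η
  time_pos : 0 < τ
  hit : x.1 + τ • x.2 ∈ intrinsicInterior ℝ (face P η')
  incoming : inner ℝ x.2 η' < 0

/-- The time in which the particle at `y` reaches the hyperplane supporting `P` with normal `η'`. -/
def hittingTime (P : Set (E d)) (η' : E d) (y : E d × E d) : ℝ :=
  (supportVal P η' - inner ℝ y.1 η') * (inner ℝ y.2 η')⁻¹

/-- The facet hit next minimises the hitting time among the walls that the particle approaches; as
the half-line misses the skeleton, the hit point is interior to this facet. -/
theorem exists_isFlight (hP : IsPolytope P) (hx : x ∈ billiardDomain P) :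
    ∃ η η' τ, IsFlight P x η η' τ := by
  obtain ⟨⟨η, hη, hstart, hunit, hout⟩, hskel⟩ := hx
  have hstart' := (hP.mem_facetInterior_iff hη).1 hstart
  have hv0 : x.2 ≠ 0 := by intro h; rw [h, norm_zero] at hunit; exact zero_ne_one hunit
  let G := {η' | IsFacetNormal P η' ∧ inner ℝ x.2 η' < 0}
  have hGfin : G.Finite := hP.finite_facetNormals.subset fun _ h => h.1
  obtain ⟨η', ⟨hη', hin⟩, hmin⟩ := Set.exists_min_image G (fun η' => hittingTime P η' x) hGfin
    (hP.exists_inner_neg hv0)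
  have hpP := (intrinsicInterior_subset hstart).1
  have hne : η' ≠ η := by rintro rfl; linarith
  have hτ : 0 < hittingTime P η' x :=
    mul_pos_of_neg_of_neg (by linarith [hstart'.2 η' hη' hne]) (inv_lt_zero.2 hin)
  have hval : ∀ η'', inner ℝ (x.1 + hittingTime P η' x • x.2) η''
      = inner ℝ x.1 η'' + hittingTime P η' x * inner ℝ x.2 η'' := fun η'' => by
    rw [inner_add_left, real_inner_smul_left]
  refine ⟨η, η', hittingTime P η' x, hη, hη', hstart, hunit, hout, hτ, ?_, hin⟩
  refine mem_facetInterior_of_notMem_skeleton hη' (hP.mem_face_iff.2 ⟨?_, ?_⟩) (hskel _ hτ.le)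
  · refine hP.mem_iff.2 fun η'' h'' => ?_
    rw [hval]
    have h1 := hP.supportVal_le hpP η''
    rcases le_or_gt 0 (inner ℝ x.2 η'') with h | h
    · nlinarith
    · have h2 := hmin η'' ⟨h'', h⟩
      have h3 : hittingTime P η'' x * inner ℝ x.2 η'' = supportVal P η'' - inner ℝ x.1 η'' :=
        inv_mul_cancel_right₀ h.ne _
      nlinarith [mul_le_mul_of_nonpos_right h2 h.le]
  · rw [hval, hittingTime, inv_mul_cancel_right₀ hin.ne]; ring

namespace IsFlight

theorem ne (h : IsFlight P x η η' τ) : η' ≠ η := by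
  rintro rfl; exact lt_asymm h.outgoing h.incoming

/-- Before time `τ` all facet inequalities are strict, by interpolation between the start and the
hit (on the starting facet since the particle moves away from it). After `τ` the inequality of `η'`
fails. -/
theorem flightTime_eq (h : IsFlight P x η η' τ) (hP : IsPolytope P) : flightTime P x = τ := by
  have hs := (hP.mem_facetInterior_iff h.facet).1 h.start
  have hh := (hP.mem_facetInterior_iff h.facet').1 h.hit
  have hset : {t : ℝ | 0 < t ∧ x.1 + t • x.2 ∈ bdry P} = {τ} := by
    ext t
    rw [mem_ofPred_eq, mem_singleton_iff]
    constructor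
    · rintro ⟨ht, η'', h'', hmem⟩
      have hmem := hP.mem_face_iff.1 hmem
      have h1 := hP.supportVal_le (intrinsicInterior_subset h.hit).1 η''
      have h2 := hP.supportVal_le hmem.1 η'
      have h3 := h.time_pos
      have h4 := h.incoming
      have h5 := h.outgoing
      have h6 := hh.1
      have h7 := hmem.2
      rw [inner_add_left, real_inner_smul_left] at h1 h2 h6 h7
      rcases lt_trichotomy t τ with hlt | heq | hgt
      · exfalso
        by_cases he : η'' = η
        · rw [he] at h7
          nlinarith [hs.1, mul_pos ht h5]
        · have h8 := hs.2 η'' h'' he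
          have h9 : t * (supportVal P η'' - inner ℝ x.1 η'') ≤ t * (τ * inner ℝ x.2 η'') :=
            mul_le_mul_of_nonneg_left (by linarith) ht.le
          nlinarith
      · exact heq
      · nlinarith
    · rintro rfl
      exact ⟨h.time_pos, η', h.facet', intrinsicInterior_subset h.hit⟩
  rw [flightTime, hset, csInf_singleton]

theorem eq_hittingTime (h : IsFlight P x η η' τ) (hP : IsPolytope P) :
    τ = hittingTime P η' x := by
  have hh := ((hP.mem_facetInterior_iff h.facet').1 h.hit).1
  rw [inner_add_left, real_inner_smul_left] at hh
  rw [hittingTime, ← hh, add_sub_cancel_left, mul_inv_cancel_right₀ h.incoming.ne]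

theorem normalAt_hit (h : IsFlight P x η η' τ) (hP : IsPolytope P) :
    normalAt P (x.1 + τ • x.2) = η' := normalAt_eq hP h.facet' h.hit

theorem billiardMap_eq (h : IsFlight P x η η' τ) (hP : IsPolytope P) :
    billiardMap f P x = (x.1 + τ • x.2, contract f η' (specular η' x.2)) := by
  simp only [billiardMap, Function.comp_apply, specularMap, lawMap, h.flightTime_eq hP,
    h.normalAt_hit hP]

theorem norm_specular (h : IsFlight P x η η' τ) : ‖specular η' x.2‖ = 1 := by
  rw [PolytopeBilliard.norm_specular h.facet'.1, h.unit]

theorem inner_specular_pos (h : IsFlight P x η η' τ) : 0 < inner ℝ (specular η' x.2) η' := by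
  rw [inner_specular h.facet'.1]; linarith [h.incoming]

theorem billiardMap_mem (h : IsFlight P x η η' τ) (hP : IsPolytope P)
    (hf : IsContractingReflectionLaw f) : billiardMap f P x ∈ phaseSpace P := by
  rw [h.billiardMap_eq hP]
  refine ⟨η', h.facet', h.hit, norm_contract hf h.facet'.1 h.norm_specular h.inner_specular_pos, ?_⟩
  have h1 := hf.mapsTo (normalAngle_mem h.inner_specular_pos)
  change 0 < inner ℝ (contract f η' (specular η' x.2)) η'
  rw [inner_contract f h.facet'.1 h.norm_specular h.inner_specular_pos]
  exact Real.cos_pos_of_mem_Ioo ⟨by linarith [h1.1, Real.pi_pos], h1.2⟩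

theorem continuousAt_hittingTime (h : IsFlight P x η η' τ) :
    ContinuousAt (hittingTime P η') x := by
  refine ContinuousAt.mul (by fun_prop) (ContinuousAt.inv₀ (by fun_prop) h.incoming.ne)

/-- Both facets are determined by open conditions, so they are locally constant, and the infimum
defining the flight time may be replaced by the smooth function `hittingTime`. -/
theorem eventually (h : IsFlight P x η η' τ) (hP : IsPolytope P) :
    ∀ᶠ y in 𝓝[phaseSpace P] x, IsFlight P y η η' (hittingTime P η' y) := by
  have hs := (hP.mem_facetInterior_iff h.facet).1 h.start
  have hh := (hP.mem_facetInterior_iff h.facet').1 h.hit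
  have hc := h.continuousAt_hittingTime
  rw [h.eq_hittingTime hP] at hh
  have e1 : ∀ᶠ y : E d × E d in 𝓝 x, ∀ η'', IsFacetNormal P η'' → η'' ≠ η →
      supportVal P η'' < inner ℝ y.1 η'' :=
    continuous_fst.continuousAt.eventually ((hP.isOpen_strict η).mem_nhds hs.2)
  have hc2 : ContinuousAt (fun y : E d × E d => y.1 + hittingTime P η' y • y.2) x :=
    continuousAt_fst.add (hc.smul continuousAt_snd)
  have e2 := hc2.eventually ((hP.isOpen_strict η').mem_nhds hh.2)
  have hc3 : ContinuousAt (fun y : E d × E d => inner ℝ y.2 η') x := by fun_prop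
  have e3 := hc3.eventually (Iio_mem_nhds h.incoming)
  have e4 := hc.eventually (Ioi_mem_nhds (h.eq_hittingTime hP ▸ h.time_pos))
  filter_upwards [mem_nhdsWithin_of_mem_nhds e1, mem_nhdsWithin_of_mem_nhds e2,
    mem_nhdsWithin_of_mem_nhds e3, mem_nhdsWithin_of_mem_nhds e4, self_mem_nhdsWithin]
    with y h1 h2 h3 h4 hy
  obtain ⟨η₁, hη₁, hy1, hy2, hy3⟩ := hy
  obtain rfl : η₁ = η := by
    by_contra hne
    have := h1 η₁ hη₁ hne
    rw [((hP.mem_facetInterior_iff hη₁).1 hy1).1] at this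
    exact lt_irrefl _ this
  refine ⟨h.facet, h.facet', hy1, hy2, hy3, h4, (hP.mem_facetInterior_iff h.facet').2 ⟨?_, h2⟩, h3⟩
  rw [inner_add_left, real_inner_smul_left, hittingTime, inv_mul_cancel_right₀ h3.ne]
  ring

end IsFlight

/-- The normal of the facet that the particle hits next. -/
def nextNormal (P : Set (E d)) (x : E d × E d) : E d := normalAt P (x.1 + flightTime P x • x.2)

theorem IsFlight.nextNormal_eq (h : IsFlight P x η η' τ) (hP : IsPolytope P) :
    nextNormal P x = η' := by rw [nextNormal, h.flightTime_eq hP, h.normalAt_hit hP]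

theorem IsFlight.normalAt_eq (h : IsFlight P x η η' τ) (hP : IsPolytope P) :
    normalAt P x.1 = η := PolytopeBilliard.normalAt_eq hP h.facet h.start

/-- The data of the flight that starts at a point of the domain of the billiard map. -/
theorem isFlight_of_mem (hP : IsPolytope P) (hx : x ∈ billiardDomain P) :
    IsFlight P x (normalAt P x.1) (nextNormal P x) (flightTime P x) := by
  obtain ⟨η, η', τ, h⟩ := exists_isFlight hP hx
  rw [h.normalAt_eq hP, h.nextNormal_eq hP, h.flightTime_eq hP]
  exact h

theorem IsFlight.normalAt_billiardMap (h : IsFlight P x η η' τ) (hP : IsPolytope P) :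
    normalAt P (billiardMap f P x).1 = η' := by
  rw [h.billiardMap_eq hP, h.normalAt_hit hP]

/-- The projection along `v` onto the hyperplane orthogonal to `η`. -/
def obliqueMap (v η : E d) : E d →L[ℝ] E d :=
  ContinuousLinearMap.id ℝ (E d) - (inner ℝ v η)⁻¹ • rankOneMap η v

@[simp] theorem obliqueMap_apply (v η w : E d) :
    obliqueMap v η w = w - (inner ℝ v η)⁻¹ • inner ℝ η w • v := by
  simp [obliqueMap]

/-- The specular reflection as a continuous linear map. -/
def specularCLM (η : E d) : E d →L[ℝ] E d :=
  ContinuousLinearMap.id ℝ (E d) - (2 : ℝ) • rankOneMap η η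

theorem specularCLM_apply (η w : E d) : specularCLM η w = specular η w := by
  simp [specularCLM, specular, real_inner_comm, smul_smul]

/-- The derivative of the velocity component of the billiard map. -/
def velDeriv (f : ℝ → ℝ) (P : Set (E d)) (x : E d × E d) : E d →L[ℝ] E d :=
  contractDeriv f (nextNormal P x) (specular (nextNormal P x) x.2) ∘L specularCLM (nextNormal P x)

/-- The derivative of the billiard map along the phase space. -/
def billiardDeriv (f : ℝ → ℝ) (P : Set (E d)) (x : E d × E d) :
    (E d × E d) →L[ℝ] (E d × E d) :=
  (obliqueMap x.2 (nextNormal P x) ∘L (ContinuousLinearMap.fst ℝ (E d) (E d)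
    + flightTime P x • ContinuousLinearMap.snd ℝ (E d) (E d))).prod
    (velDeriv f P x ∘L ContinuousLinearMap.snd ℝ (E d) (E d))

theorem billiardDeriv_apply (f : ℝ → ℝ) (P : Set (E d)) (x w : E d × E d) :
    billiardDeriv f P x w
      = (obliqueMap x.2 (nextNormal P x) (w.1 + flightTime P x • w.2), velDeriv f P x w.2) := rfl

theorem IsFlight.hasFDerivAt_hittingTime (h : IsFlight P x η η' τ) (hP : IsPolytope P) :
    HasFDerivAt (hittingTime P η') ((-(inner ℝ x.2 η')⁻¹) •
      (innerSL ℝ η' ∘L (ContinuousLinearMap.fst ℝ (E d) (E d)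
        + τ • ContinuousLinearMap.snd ℝ (E d) (E d)))) x := by
  have h1 : HasFDerivAt (fun y : E d × E d => inner ℝ y.1 η')
      (innerSL ℝ η' ∘L ContinuousLinearMap.fst ℝ (E d) (E d)) x := by
    have e : (fun y : E d × E d => inner ℝ y.1 η')
        = (innerSL ℝ η' ∘L ContinuousLinearMap.fst ℝ (E d) (E d)) := by
      ext y; simp [real_inner_comm]
    rw [e]; exact ContinuousLinearMap.hasFDerivAt _
  have h2 : HasFDerivAt (fun y : E d × E d => inner ℝ y.2 η')
      (innerSL ℝ η' ∘L ContinuousLinearMap.snd ℝ (E d) (E d)) x := by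
    have e : (fun y : E d × E d => inner ℝ y.2 η')
        = (innerSL ℝ η' ∘L ContinuousLinearMap.snd ℝ (E d) (E d)) := by
      ext y; simp [real_inner_comm]
    rw [e]; exact ContinuousLinearMap.hasFDerivAt _
  have h3 := (h1.const_sub (supportVal P η')).mul
    ((hasDerivAt_inv h.incoming.ne).comp_hasFDerivAt x h2)
  refine h3.congr_fderiv ?_
  have hτ := h.eq_hittingTime hP
  have hne := h.incoming.ne
  rw [hittingTime] at hτ
  ext w
  all_goals
    simp [hτ]
    try field_simp
    try ring

theorem hasFDerivWithinAt_billiardMap (hP : IsPolytope P) (hf : IsContractingReflectionLaw f)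
    (hx : x ∈ billiardDomain P) :
    HasFDerivWithinAt (billiardMap f P) (billiardDeriv f P x) (phaseSpace P) x := by
  have h := isFlight_of_mem hP hx
  have hev := h.eventually hP
  have ht := h.hasFDerivAt_hittingTime hP
  have hτ := h.eq_hittingTime hP
  unfold billiardDeriv velDeriv
  set η' := nextNormal P x
  set τ := flightTime P x
  have h1 := (hasFDerivAt_fst (p := x) (𝕜 := ℝ)).add (ht.smul (hasFDerivAt_snd (p := x) (𝕜 := ℝ)))
  have hs : HasFDerivWithinAt (fun y : E d × E d => specular η' y.2)
      (specularCLM η' ∘L ContinuousLinearMap.snd ℝ (E d) (E d)) (phaseSpace P) x := by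
    have e : (fun y : E d × E d => specular η' y.2)
        = (specularCLM η' ∘L ContinuousLinearMap.snd ℝ (E d) (E d)) := by
      ext1 y; exact (specularCLM_apply η' y.2).symm
    rw [e]; exact (ContinuousLinearMap.hasFDerivAt _).hasFDerivWithinAt
  have h2 := (hasFDerivWithinAt_contract hf h.facet'.1 h.norm_specular h.inner_specular_pos).comp x
    hs (fun y hy => by
      obtain ⟨_, _, _, hy, _⟩ := hy
      rw [mem_sphere_zero_iff_norm, norm_specular h.facet'.1, hy])
  have h3 := h1.hasFDerivWithinAt.prodMk h2
  refine (h3.congr_of_eventuallyEq ?_ ?_).congr_fderiv ?_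
  · filter_upwards [hev] with y hy
    exact hy.billiardMap_eq hP
  · have := h.billiardMap_eq (f := f) hP
    rw [this, hτ]
    rfl
  · have hpos : ContinuousLinearMap.fst ℝ (E d) (E d) +
        (hittingTime P η' x • ContinuousLinearMap.snd ℝ (E d) (E d) +
          ((-(inner ℝ x.2 η')⁻¹) • (innerSL ℝ η' ∘L (ContinuousLinearMap.fst ℝ (E d) (E d)
        + τ • ContinuousLinearMap.snd ℝ (E d) (E d)))).smulRight x.2)
        = obliqueMap x.2 η' ∘L (ContinuousLinearMap.fst ℝ (E d) (E d)
          + τ • ContinuousLinearMap.snd ℝ (E d) (E d)) := by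
      rw [← hτ]
      refine ContinuousLinearMap.ext fun w => ?_
      simp only [add_apply, smul_apply, ContinuousLinearMap.comp_apply,
        ContinuousLinearMap.smulRight_apply, ContinuousLinearMap.coe_fst',
        ContinuousLinearMap.coe_snd', innerSL_apply_apply, obliqueMap_apply, smul_eq_mul]
      module
    exact congrArg₂ ContinuousLinearMap.prod hpos rfl

end Flight

/-! ### Continuity, tangent vectors and derivatives of iterates. -/

section Derivative

variable {d : ℕ} {P : Set (E d)} {f : ℝ → ℝ} {x : E d × E d}

theorem eventually_flight_data (hP : IsPolytope P) (hx : x ∈ billiardDomain P) :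
    ∀ᶠ y in 𝓝[billiardDomain P] x, normalAt P y.1 = normalAt P x.1 ∧
      nextNormal P y = nextNormal P x ∧ flightTime P y = hittingTime P (nextNormal P x) y := by
  have h := (isFlight_of_mem hP hx).eventually hP
  filter_upwards [h.filter_mono (nhdsWithin_mono x fun y hy => hy.1)] with y hy
  exact ⟨hy.normalAt_eq hP, hy.nextNormal_eq hP, hy.flightTime_eq hP⟩

theorem continuousOn_billiardMap (hP : IsPolytope P) (hf : IsContractingReflectionLaw f) :
    ContinuousOn (billiardMap f P) (billiardDomain P) := fun _ hx =>
  (hasFDerivWithinAt_billiardMap hP hf hx).continuousWithinAt.mono fun _ hy => hy.1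

theorem continuousOn_flightTime (hP : IsPolytope P) :
    ContinuousOn (flightTime P) (billiardDomain P) := fun x hx => by
  have h := isFlight_of_mem hP hx
  exact h.continuousAt_hittingTime.continuousWithinAt.congr_of_eventuallyEq
    ((eventually_flight_data hP hx).mono fun y hy => hy.2.2) (h.eq_hittingTime hP)

theorem continuousOn_obliqueMap_normalAt (hP : IsPolytope P) :
    ContinuousOn (fun x : E d × E d => obliqueMap x.2 (normalAt P x.1)) (billiardDomain P) :=
  fun x hx => by
  have h := isFlight_of_mem hP hx
  have h1 : ContinuousAt (fun y : E d × E d => obliqueMap y.2 (normalAt P x.1)) x := by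
    have h2 : Continuous fun y : E d × E d => rankOneMap (normalAt P x.1) y.2 :=
      continuous_const.rankOneMap continuous_snd
    have h3 : ContinuousAt (fun y : E d × E d => (inner ℝ y.2 (normalAt P x.1))⁻¹) x :=
      ContinuousAt.inv₀ (by fun_prop) h.outgoing.ne'
    exact continuousAt_const.sub (h3.smul h2.continuousAt)
  refine h1.continuousWithinAt.congr_of_eventuallyEq ?_ rfl
  filter_upwards [eventually_flight_data hP hx] with y hy
  rw [hy.1]

theorem continuousOn_velDeriv (hP : IsPolytope P) (hf : IsContractingReflectionLaw f) :
    ContinuousOn (velDeriv f P) (billiardDomain P) := fun x hx => by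
  have h := isFlight_of_mem hP hx
  have h1 : ContinuousWithinAt (fun y : E d × E d => contractDeriv f (nextNormal P x)
      (specular (nextNormal P x) y.2)) (billiardDomain P ∩ {y | inner ℝ y.2 (nextNormal P x) < 0})
      x := by
    have h2 := continuousOn_contractDeriv hf h.facet'.1 (specular (nextNormal P x) x.2)
      ⟨h.norm_specular, h.inner_specular_pos⟩
    refine ContinuousWithinAt.comp (f := fun y : E d × E d => specular (nextNormal P x) y.2) h2
      ?_ ?_
    · have : Continuous fun y : E d × E d => specular (nextNormal P x) y.2 := by
        unfold specular; fun_prop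
      exact this.continuousWithinAt
    · rintro y ⟨hy, hy2⟩
      obtain ⟨⟨_, _, _, hy1, _⟩, _⟩ := hy
      refine ⟨by rw [norm_specular h.facet'.1, hy1], ?_⟩
      rw [inner_specular h.facet'.1]
      exact neg_pos.2 hy2
  have h3 : ContinuousWithinAt (fun y : E d × E d => contractDeriv f (nextNormal P x)
      (specular (nextNormal P x) y.2)) (billiardDomain P) x := by
    refine h1.mono_of_mem_nhdsWithin (inter_mem self_mem_nhdsWithin (mem_nhdsWithin_of_mem_nhds ?_))
    exact (isOpen_lt (by fun_prop) continuous_const).mem_nhds h.incoming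
  refine (h3.clm_comp continuousWithinAt_const).congr_of_eventuallyEq
    (g := velDeriv f P) ?_ rfl
  filter_upwards [eventually_flight_data hP hx] with y hy
  rw [velDeriv, hy.2.1]

theorem norm_velDeriv_apply_le (hP : IsPolytope P) (hf : IsContractingReflectionLaw f) {ρ : ℝ}
    (hρ0 : 0 ≤ ρ)
    (hρ : ∀ θ ∈ Ico 0 (Real.pi / 2), |lawDeriv f θ| ≤ ρ ∧ |sinRatio f θ| ≤ ρ)
    (hx : x ∈ billiardDomain P) (w : E d) : ‖velDeriv f P x w‖ ≤ ρ * ‖w‖ := by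
  have h := isFlight_of_mem hP hx
  have h1 := norm_contractDeriv_apply_le hf h.facet'.1 h.norm_specular h.inner_specular_pos hρ0 hρ
    (specularCLM (nextNormal P x) w)
  rw [specularCLM_apply (nextNormal P x) w, norm_specular h.facet'.1] at h1
  simpa only [velDeriv, ContinuousLinearMap.comp_apply, specularCLM_apply] using h1

/-- `w` is tangent to the phase space at `x`. -/
theorem mem_tangentSpace_iff {w : E d × E d} :
    w ∈ tangentSpace P x ↔ inner ℝ w.1 (normalAt P x.1) = 0 ∧ inner ℝ w.2 x.2 = 0 := by
  rw [tangentSpace, Submodule.mem_prod, Submodule.mem_orthogonal_singleton_iff_inner_left,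
    Submodule.mem_orthogonal_singleton_iff_inner_left]

theorem inner_obliqueMap {v η : E d} (hv : inner ℝ v η ≠ 0) (w : E d) :
    inner ℝ (obliqueMap v η w) η = 0 := by
  rw [obliqueMap_apply, inner_sub_left, real_inner_smul_left, real_inner_smul_left,
    real_inner_comm η w]
  field_simp
  ring

theorem inner_velDeriv (hP : IsPolytope P) (hf : IsContractingReflectionLaw f)
    (hx : x ∈ billiardDomain P) (w : E d) :
    inner ℝ (velDeriv f P x w) (billiardMap f P x).2 = 0 := by
  have h := isFlight_of_mem hP hx
  rw [real_inner_comm, h.billiardMap_eq hP]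
  exact inner_contractDeriv_contract hf h.facet'.1 h.norm_specular h.inner_specular_pos _

/-- Every tangent vector of the phase space is the velocity of a curve. -/
theorem exists_curve (hP : IsPolytope P) (hx : x ∈ phaseSpace P) {w : E d × E d}
    (hw : w ∈ tangentSpace P x) :
    ∃ γ : ℝ → E d × E d, γ 0 = x ∧ HasDerivAt γ w 0 ∧ ∀ᶠ s in 𝓝 (0 : ℝ), γ s ∈ phaseSpace P := by
  obtain ⟨η, hη, hp, hv, hvη⟩ := hx
  rw [mem_tangentSpace_iff, normalAt_eq hP hη hp] at hw
  obtain ⟨hw1, hw2⟩ := hw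
  -- `c` normalises the velocity. As `w.2` is orthogonal to `x.2`, the norm changes only to second
  -- order, so `c` does not contribute to the derivative.
  let c : ℝ → ℝ := fun s => (Real.sqrt (1 + s ^ 2 * ‖w.2‖ ^ 2))⁻¹
  let γ : ℝ → E d × E d := fun s => (x.1 + s • w.1, c s • (x.2 + s • w.2))
  have hc0 : c 0 = 1 := by simp [c]
  have hγ0 : γ 0 = x := by simp [γ, hc0]
  have hcd : HasDerivAt c 0 0 := by
    have h1 : HasDerivAt (fun s : ℝ => 1 + s ^ 2 * ‖w.2‖ ^ 2) 0 0 := by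
      have := (((hasDerivAt_id (0 : ℝ)).pow 2).mul_const (‖w.2‖ ^ 2)).const_add 1
      simpa using this
    have h2 := (h1.sqrt (by norm_num)).inv (by norm_num)
    exact h2.congr_deriv (by simp)
  have hlin : ∀ a b : E d, HasDerivAt (fun s : ℝ => a + s • b) b 0 := by
    intro a b
    have := ((hasDerivAt_id (0 : ℝ)).smul_const b).const_add a
    simpa using this
  have hγd : HasDerivAt γ w 0 := by
    have h1 := (hlin x.1 w.1).prodMk (hcd.smul (hlin x.2 w.2))
    refine h1.congr_deriv ?_
    simp [hc0]
  have hcont : ContinuousAt γ 0 := hγd.continuousAt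
  have hs := (hP.mem_facetInterior_iff hη).1 hp
  have e1 : ∀ᶠ s in 𝓝 (0 : ℝ), ∀ η', IsFacetNormal P η' → η' ≠ η →
      supportVal P η' < inner ℝ (γ s).1 η' := by
    refine (continuousAt_fst.comp hcont).eventually ((hP.isOpen_strict η).mem_nhds ?_)
    rw [Function.comp_apply, hγ0]; exact hs.2
  have e2 : ∀ᶠ s in 𝓝 (0 : ℝ), 0 < inner ℝ (γ s).2 η := by
    have h1 : ContinuousAt (fun s => inner ℝ (γ s).2 η) 0 :=
      (continuousAt_snd.comp hcont).inner continuousAt_const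
    refine h1.eventually (Ioi_mem_nhds ?_)
    change 0 < inner ℝ (γ 0).2 η
    rw [hγ0]; exact hvη
  refine ⟨γ, hγ0, hγd, ?_⟩
  filter_upwards [e1, e2] with s h1 h2
  refine ⟨η, hη, (hP.mem_facetInterior_iff hη).2 ⟨?_, h1⟩, ?_, h2⟩
  · change inner ℝ (x.1 + s • w.1) η = _
    rw [inner_add_left, real_inner_smul_left, hw1, hs.1]; ring
  · have h3 : ‖x.2 + s • w.2‖ = Real.sqrt (1 + s ^ 2 * ‖w.2‖ ^ 2) := by
      rw [← Real.sqrt_sq (norm_nonneg (x.2 + s • w.2)), norm_add_sq_real, real_inner_smul_right,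
        real_inner_comm, hw2, hv, norm_smul, mul_pow, Real.norm_eq_abs, sq_abs]
      congr 1; ring
    change ‖c s • (x.2 + s • w.2)‖ = 1
    have h4 : 0 < Real.sqrt (1 + s ^ 2 * ‖w.2‖ ^ 2) := Real.sqrt_pos.2 (by positivity)
    rw [norm_smul, h3, norm_inv, Real.norm_of_nonneg h4.le, inv_mul_cancel₀ h4.ne']

/-- Derivatives within the phase space may differ transversally, but curves determine them on
tangent vectors. This identifies `tangentMap` with the explicit `iterDeriv`. -/
theorem eq_on_tangentSpace (hP : IsPolytope P) (hx : x ∈ phaseSpace P) {F : E d × E d → E d × E d}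
    {A B : (E d × E d) →L[ℝ] (E d × E d)} (hA : HasFDerivWithinAt F A (phaseSpace P) x)
    (hB : HasFDerivWithinAt F B (phaseSpace P) x) {w : E d × E d} (hw : w ∈ tangentSpace P x) :
    A w = B w := by
  obtain ⟨γ, h0, hγ, hev⟩ := exists_curve hP hx hw
  exact (hA.comp_hasDerivAt_of_eq 0 hγ hev h0.symm).unique
    (hB.comp_hasDerivAt_of_eq 0 hγ hev h0.symm)

/-- The derivative of the iterates of the billiard map. -/
def iterDeriv (f : ℝ → ℝ) (P : Set (E d)) : ℕ → E d × E d → (E d × E d) →L[ℝ] (E d × E d)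
  | 0, _ => ContinuousLinearMap.id ℝ _
  | n + 1, x => iterDeriv f P n (billiardMap f P x) ∘L billiardDeriv f P x

theorem forwardSet_subset : forwardSet f P ⊆ billiardDomain P := fun _ hx => hx 0

theorem mapsTo_forwardSet : MapsTo (billiardMap f P) (forwardSet f P) (forwardSet f P) :=
  fun x hx n => by
    rw [← Function.iterate_succ_apply]; exact hx (n + 1)

theorem hasFDerivWithinAt_iterate (hP : IsPolytope P) (hf : IsContractingReflectionLaw f) (n : ℕ)
    (hx : x ∈ forwardSet f P) :
    HasFDerivWithinAt ((billiardMap f P)^[n]) (iterDeriv f P n x) (phaseSpace P) x := by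
  induction n generalizing x with
  | zero => exact hasFDerivWithinAt_id _ _
  | succ n ih =>
    have hxd := forwardSet_subset hx
    have h1 := ih (mapsTo_forwardSet hx)
    have h2 := hasFDerivWithinAt_billiardMap hP hf hxd
    rw [Function.iterate_succ]
    -- The chain rule within the phase space only needs nearby points of it to be mapped back into
    -- it.
    refine h1.comp_of_tendsto x h2 (tendsto_nhdsWithin_iff.2 ⟨h2.continuousWithinAt, ?_⟩)
    filter_upwards [(isFlight_of_mem hP hxd).eventually hP] with y hy
    exact hy.billiardMap_mem hP hf

theorem tangentMap_eq (hP : IsPolytope P) (hf : IsContractingReflectionLaw f) (n : ℕ)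
    (hx : x ∈ forwardSet f P) {w : E d × E d} (hw : w ∈ tangentSpace P x) :
    tangentMap f P n x w = iterDeriv f P n x w := by
  have h := hasFDerivWithinAt_iterate hP hf n hx
  exact eq_on_tangentSpace hP (forwardSet_subset hx).1 h.differentiableWithinAt.hasFDerivWithinAt
    h hw

end Derivative

/-! ### Growth of vectors under successive oblique projections. -/

section Expansion

variable {V : Type*} [NormedAddCommGroup V] [InnerProductSpace ℝ V]

/-- Vectors transported by oblique projections grow, in the norm orthogonal to the velocity, by a
definite factor in a number of steps in which the normals generate the space. -/
theorem exists_expansion_factor {ρ μ : ℝ} (hρ0 : 0 ≤ ρ) (hρ1 : ρ < 1) (hμ : 0 < μ) {K : ℕ}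
    (hK : 0 < K) : ∃ r : ℝ, 0 < r ∧ ∀ (v η ξ : ℕ → V) (s g : ℕ → ℝ),
      (∀ j, ‖v j‖ = 1) → (∀ j, ‖η j‖ = 1) → (∀ j, ξ (j + 1) = ξ j + s j • v j) →
      (∀ j, inner ℝ (ξ (j + 1)) (η j) = 0) → (∀ j, |g j| ≤ ρ) →
      (∀ j, inner ℝ (v (j + 1)) (ξ (j + 1)) = g j * inner ℝ (v j) (ξ (j + 1))) →
      (∃ j < K, μ * ‖ξ 1‖ ≤ |inner ℝ (ξ 1) (η j)|) →
      (1 + r) * ‖orthMap (v 0) (ξ 0)‖ ^ 2 ≤ ‖orthMap (v K) (ξ K)‖ ^ 2 := by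
  have hρ2 : 0 < 1 - ρ ^ 2 := by nlinarith
  have hK' : (0 : ℝ) < K := by exact_mod_cast hK
  refine ⟨(1 - ρ ^ 2) * (μ / (4 * K)) ^ 2, by positivity, ?_⟩
  intro v η ξ s g hv hη hξ hξη hg hvg ⟨i, hiK, hi⟩
  -- Adding a multiple of the velocity leaves the orthogonal part unchanged; it can only change when
  -- the velocity does.
  have hN : ∀ j, ‖orthMap (v j) (ξ (j + 1))‖ ^ 2 = ‖orthMap (v j) (ξ j)‖ ^ 2 := by
    intro j
    rw [hξ j, map_add, map_smul]
    simp [hv j]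
  have hstep : ∀ j, (1 - ρ ^ 2) * inner ℝ (v j) (ξ (j + 1)) ^ 2
      ≤ ‖orthMap (v (j + 1)) (ξ (j + 1))‖ ^ 2 - ‖orthMap (v j) (ξ j)‖ ^ 2 := by
    intro j
    rw [← hN j, norm_sq_orthMap (hv _), norm_sq_orthMap (hv _), hvg j]
    have h1 : g j ^ 2 ≤ ρ ^ 2 := sq_le_sq.2 (by rw [abs_of_nonneg hρ0]; exact hg j)
    nlinarith [mul_le_mul_of_nonneg_right h1 (sq_nonneg (inner ℝ (v j) (ξ (j + 1))))]
  have hmono : Monotone fun j => ‖orthMap (v j) (ξ j)‖ ^ 2 :=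
    monotone_nat_of_le_succ fun j => by
      have h1 := hstep j
      have h2 : 0 ≤ (1 - ρ ^ 2) * inner ℝ (v j) (ξ (j + 1)) ^ 2 := by positivity
      linarith
  -- Without growth, every loss `(1 - ρ ^ 2) * ⟪v j, ξ (j + 1)⟫ ^ 2` is small. Then all `⟪v j, ξ (j
  -- + 1)⟫` are at most `A`, all later displacements `s (j + 1)` at most `2 * A`, and `ξ` stays near
  -- `ξ 1`.
  by_contra! hcon
  set N := ‖orthMap (v 0) (ξ 0)‖ with hNdef
  set A := μ / (4 * K) * N with hA
  have hA0 : 0 ≤ A := by positivity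
  have ha : ∀ j < K, |inner ℝ (v j) (ξ (j + 1))| ≤ A := by
    intro j hj
    have h1 := hstep j
    have h2 : ‖orthMap (v (j + 1)) (ξ (j + 1))‖ ^ 2 ≤ ‖orthMap (v K) (ξ K)‖ ^ 2 := hmono hj
    have h3 : N ^ 2 ≤ ‖orthMap (v j) (ξ j)‖ ^ 2 := hmono (Nat.zero_le j)
    have h4 : (1 - ρ ^ 2) * inner ℝ (v j) (ξ (j + 1)) ^ 2 ≤ (1 - ρ ^ 2) * A ^ 2 := by
      rw [hA, mul_pow]; linarith
    exact abs_le_of_sq_le_sq (le_of_mul_le_mul_left h4 hρ2) hA0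
  have hs : ∀ j, j + 1 < K → |s (j + 1)| ≤ 2 * A := by
    intro j hj
    have h1 : inner ℝ (v (j + 1)) (ξ (j + 1 + 1))
        = inner ℝ (v (j + 1)) (ξ (j + 1)) + s (j + 1) := by
      rw [hξ (j + 1), inner_add_right, real_inner_smul_right, real_inner_self_eq_norm_sq, hv]
      ring
    have h2 := ha (j + 1) hj
    have h3 : |inner ℝ (v (j + 1)) (ξ (j + 1))| ≤ A := by
      rw [hvg j, abs_mul]
      have := ha j (by omega)
      nlinarith [hg j, abs_nonneg (g j), abs_nonneg (inner ℝ (v j) (ξ (j + 1)))]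
    rw [h1] at h2
    rw [abs_le] at *
    constructor <;> linarith [h2.1, h2.2, h3.1, h3.2]
  have hd : ∀ j < K, ‖ξ (j + 1) - ξ 1‖ ≤ j * (2 * A) := by
    intro j hj
    induction j with
    | zero => simp
    | succ j ih =>
      have h1 := ih (by omega)
      have h2 : ξ (j + 1 + 1) - ξ 1 = (ξ (j + 1) - ξ 1) + s (j + 1) • v (j + 1) := by
        rw [hξ (j + 1)]; abel
      rw [h2]
      have h3 := norm_add_le (ξ (j + 1) - ξ 1) (s (j + 1) • v (j + 1))
      rw [norm_smul, hv, mul_one, Real.norm_eq_abs] at h3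
      have h4 := hs j hj
      push_cast
      linarith
  -- `ξ (i + 1)` is exactly orthogonal to `η i`, so `ξ 1` is nearly so. The factor `4 * K` in `r`
  -- makes the bound half of what spanning requires.
  have h1 : |inner ℝ (ξ 1) (η i)| ≤ K * (2 * A) := by
    have e : inner ℝ (ξ 1) (η i) = - inner ℝ (ξ (i + 1) - ξ 1) (η i) := by
      rw [inner_sub_left, hξη i]; ring
    rw [e, abs_neg]
    have h2 := abs_real_inner_le_norm (ξ (i + 1) - ξ 1) (η i)
    rw [hη i, mul_one] at h2
    have h3 : (i : ℝ) ≤ K := by exact_mod_cast hiK.le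
    exact (h2.trans (hd i hiK)).trans (mul_le_mul_of_nonneg_right h3 (by linarith))
  have h2 : N ≤ ‖ξ 1‖ := by
    have h3 := hN 0
    rw [zero_add, sq_eq_sq₀ (norm_nonneg _) (norm_nonneg _)] at h3
    rw [hNdef, ← h3]
    exact norm_orthMap_le (hv 0) _
  have h3 : K * (2 * A) = μ * N / 2 := by
    rw [hA]; field_simp; ring
  have h4 : μ * N ≤ μ * ‖ξ 1‖ := mul_le_mul_of_nonneg_left h2 hμ.le
  have hN0 : 0 ≤ N := norm_nonneg _
  have h5 : μ * N ≤ 0 := by linarith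
  have h6 : N = 0 := le_antisymm (by nlinarith) hN0
  rw [h6] at hcon
  have h7 : (0 : ℝ) ≤ ‖orthMap (v K) (ξ K)‖ ^ 2 := by positivity
  rw [zero_pow two_ne_zero, mul_zero] at hcon
  linarith

/-- On the hyperplane `η^⊥` only the tangential part of `v` matters, and it has length at most `√(1
- c²)`. Uniformly transversal velocities thus make the seminorm of the expansion estimate equivalent
to the norm. -/
theorem le_norm_orthMap {v η ξ : V} (hv : ‖v‖ = 1) (hη : ‖η‖ = 1) (hξ : inner ℝ ξ η = 0) {c : ℝ}
    (hc0 : 0 ≤ c) (hc : c ≤ inner ℝ v η) : c * ‖ξ‖ ≤ ‖orthMap v ξ‖ := by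
  refine le_of_sq_le_sq ?_ (norm_nonneg _)
  rw [norm_sq_orthMap hv]
  have h1 : inner ℝ v ξ = inner ℝ (orthMap η v) ξ := by
    rw [orthMap_apply, inner_sub_left, real_inner_smul_left, real_inner_comm ξ η, hξ]; ring
  have h2 : inner ℝ v ξ ^ 2 ≤ ‖orthMap η v‖ ^ 2 * ‖ξ‖ ^ 2 := by
    rw [h1, ← mul_pow, sq_le_sq, abs_of_nonneg (a := _ * _) (by positivity)]
    exact abs_real_inner_le_norm _ _
  rw [norm_sq_orthMap hη, hv, real_inner_comm v η] at h2
  have h3 : c ^ 2 ≤ inner ℝ v η ^ 2 := pow_le_pow_left₀ hc0 hc 2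
  nlinarith [mul_le_mul_of_nonneg_right h3 (sq_nonneg ‖ξ‖)]

/-- A lower bound for spanning subsets that is uniform over the subsets of a finite set. -/
theorem exists_uniform_le_abs_inner (F : Finset V) :
    ∃ μ : ℝ, 0 < μ ∧ ∀ S ⊆ F, S.Nonempty → Submodule.span ℝ (S : Set V) = ⊤ →
      ∀ u : V, ∃ η ∈ S, μ * ‖u‖ ≤ |inner ℝ u η| := by
  classical
  have h1 : ∀ S : {S : Finset V // S ∈ F.powerset ∧ S.Nonempty}, ∃ κ : ℝ, 0 < κ ∧
      ∀ u ∈ Submodule.span ℝ (S.1 : Set V), ∃ η ∈ S.1, κ * ‖u‖ ≤ |inner ℝ u η| :=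
    fun S => exists_le_abs_inner_of_mem_span S.1 S.2.2
  choose κ hκ hκS using h1
  have hfin : Finite {S : Finset V // S ∈ F.powerset ∧ S.Nonempty} :=
    (F.powerset.finite_toSet.subset (t := {S | S ∈ F.powerset ∧ S.Nonempty})
      fun S hS => hS.1).to_subtype
  by_cases hne : Nonempty {S : Finset V // S ∈ F.powerset ∧ S.Nonempty}
  · obtain ⟨S₀, hS₀⟩ := Finite.exists_min κ
    refine ⟨κ S₀, hκ _, fun S hS hSne hspan u => ?_⟩
    obtain ⟨η, hη, h2⟩ := hκS ⟨S, Finset.mem_powerset.2 hS, hSne⟩ u (by simp [hspan])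
    exact ⟨η, hη, le_trans (mul_le_mul_of_nonneg_right (hS₀ _) (norm_nonneg _)) h2⟩
  · exact ⟨1, one_pos, fun S hS hSne => absurd ⟨⟨S, Finset.mem_powerset.2 hS, hSne⟩⟩ hne⟩

end Expansion

/-! ### Expansion on position vectors, and the generating property. -/

section InvariantSet

variable {d : ℕ} {P : Set (E d)} {f : ℝ → ℝ} {x : E d × E d}

theorem maximalInvariantSet_subset_forwardSet : maximalInvariantSet f P ⊆ forwardSet f P := by
  intro x hx
  obtain ⟨y, hy, rfl⟩ := mem_iInter.1 hx 0
  exact hy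

theorem maximalInvariantSet_subset_domain : maximalInvariantSet f P ⊆ billiardDomain P :=
  maximalInvariantSet_subset_forwardSet.trans forwardSet_subset

theorem mapsTo_maximalInvariantSet :
    MapsTo (billiardMap f P) (maximalInvariantSet f P) (maximalInvariantSet f P) := by
  intro x hx
  refine mem_iInter.2 fun n => ?_
  cases n with
  | zero =>
    exact ⟨_, mapsTo_forwardSet (maximalInvariantSet_subset_forwardSet hx), rfl⟩
  | succ n =>
    obtain ⟨y, hy, rfl⟩ := mem_iInter.1 hx n
    exact ⟨y, hy, Function.iterate_succ_apply' _ _ _⟩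

/-- A point of `D` has a preimage, so its velocity has just been contracted and makes an angle of at
most `contractionRate f * π/2` with the normal. -/
theorem exists_outgoing_bound (hP : IsPolytope P) (hf : IsContractingReflectionLaw f) :
    ∃ c : ℝ, 0 < c ∧ ∀ x ∈ maximalInvariantSet f P, c ≤ inner ℝ x.2 (normalAt P x.1) := by
  have h0 := hf.rate_pos
  have h1 := hf.rate_lt_one
  have hpi := Real.pi_pos
  refine ⟨Real.cos (contractionRate f * (Real.pi / 2)),
    Real.cos_pos_of_mem_Ioo ⟨by nlinarith, by nlinarith⟩, fun x hx => ?_⟩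
  obtain ⟨y, hy, rfl⟩ := mem_iInter.1 hx 1
  rw [Function.iterate_one]
  have h := isFlight_of_mem hP (forwardSet_subset hy)
  rw [h.normalAt_billiardMap hP, h.billiardMap_eq hP]
  change _ ≤ inner ℝ (contract f (nextNormal P y) (specular (nextNormal P y) y.2)) _
  rw [inner_contract f h.facet'.1 h.norm_specular h.inner_specular_pos]
  have hθ := normalAngle_mem h.inner_specular_pos
  exact Real.cos_le_cos_of_nonneg_of_le_pi (hf.mapsTo hθ).1 (by nlinarith)
    ((hf.le_rate_mul hθ).trans (mul_le_mul_of_nonneg_left hθ.2.le h0.le))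

/-- Vectors orthogonal to the normal see only the tangential part of the velocity, which specular
reflection keeps and the law multiplies by `sinRatio`. -/
theorem exists_inner_velocity (hP : IsPolytope P) {ρ : ℝ}
    (hρ : ∀ θ ∈ Ico 0 (Real.pi / 2), |lawDeriv f θ| ≤ ρ ∧ |sinRatio f θ| ≤ ρ)
    (hx : x ∈ billiardDomain P) :
    ∃ g : ℝ, |g| ≤ ρ ∧ ∀ ξ : E d, inner ℝ ξ (nextNormal P x) = 0 →
      inner ℝ (billiardMap f P x).2 ξ = g * inner ℝ x.2 ξ := by
  have h := isFlight_of_mem hP hx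
  refine ⟨_, (hρ _ (normalAngle_mem h.inner_specular_pos)).2, fun ξ hξ => ?_⟩
  rw [h.billiardMap_eq hP]
  change inner ℝ (contract f (nextNormal P x) (specular (nextNormal P x) x.2)) ξ = _
  rw [contract_eq f h.facet'.1 h.norm_specular h.inner_specular_pos, orthMap_specular h.facet'.1,
    inner_add_left, real_inner_smul_left, real_inner_smul_left, orthMap_apply, inner_sub_left,
    real_inner_smul_left, real_inner_comm ξ, hξ]
  ring

theorem norm_orthMap_le_billiardMap (hP : IsPolytope P) (hf : IsContractingReflectionLaw f)
    (hx : x ∈ billiardDomain P) (hx' : billiardMap f P x ∈ billiardDomain P) {ξ : E d}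
    (hξ : inner ℝ ξ (nextNormal P x) = 0) :
    ‖orthMap x.2 ξ‖ ≤ ‖orthMap (billiardMap f P x).2 ξ‖ := by
  obtain ⟨ρ, hρ0, hρ1, hρ⟩ := hf.exists_factor
  obtain ⟨g, hg, hgξ⟩ := exists_inner_velocity hP hρ hx
  refine le_of_sq_le_sq ?_ (norm_nonneg _)
  rw [norm_sq_orthMap (isFlight_of_mem hP hx).unit, norm_sq_orthMap (isFlight_of_mem hP hx').unit,
    hgξ ξ hξ, mul_pow]
  have : g ^ 2 ≤ 1 := (sq_le_one_iff_abs_le_one g).2 (hg.trans hρ1.le)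
  nlinarith [mul_le_mul_of_nonneg_right this (sq_nonneg (inner ℝ x.2 ξ))]

/-- The derivative of the iterates of the billiard map on the vectors `(ξ, 0)`. -/
def uMap (f : ℝ → ℝ) (P : Set (E d)) : ℕ → E d × E d → E d →L[ℝ] E d
  | 0, _ => ContinuousLinearMap.id ℝ _
  | n + 1, x => uMap f P n (billiardMap f P x) ∘L obliqueMap x.2 (nextNormal P x)

theorem uMap_add (m n : ℕ) (x : E d × E d) :
    uMap f P (m + n) x = uMap f P n ((billiardMap f P)^[m] x) ∘L uMap f P m x := by
  induction m generalizing x with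
  | zero => rw [Nat.zero_add]; rfl
  | succ m ih =>
    rw [Nat.succ_add, Nat.succ_eq_add_one, uMap, ih, Function.iterate_succ_apply, uMap]
    rfl

theorem uMap_succ_apply (n : ℕ) (x : E d × E d) (ξ : E d) :
    uMap f P (n + 1) x ξ = obliqueMap ((billiardMap f P)^[n] x).2
      (nextNormal P ((billiardMap f P)^[n] x)) (uMap f P n x ξ) := by
  rw [uMap_add]; rfl

theorem iterDeriv_apply_zero (n : ℕ) (x : E d × E d) (ξ : E d) :
    iterDeriv f P n x (ξ, 0) = (uMap f P n x ξ, 0) := by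
  induction n generalizing x ξ with
  | zero => rfl
  | succ n ih =>
    rw [iterDeriv, ContinuousLinearMap.comp_apply, billiardDeriv_apply, smul_zero, add_zero,
      map_zero, ih]
    rfl

theorem iterate_mem_forwardSet (n : ℕ) (hx : x ∈ forwardSet f P) :
    (billiardMap f P)^[n] x ∈ forwardSet f P := mapsTo_forwardSet.iterate n hx

/-- Any `K` consecutive normals along the orbits in the invariant set generate the space. -/
def IsGenerating (f : ℝ → ℝ) (P : Set (E d)) (K : ℕ) : Prop :=
  ∀ x ∈ forwardSet f P, ∃ S : Finset (E d), (∀ η ∈ S, ∃ j < K,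
    η = nextNormal P ((billiardMap f P)^[j] x)) ∧ Submodule.span ℝ (S : Set (E d)) = ⊤ ∧ S.Nonempty

theorem uMap_expansion (hP : IsPolytope P) (hf : IsContractingReflectionLaw f) {K : ℕ}
    (hK : 0 < K) (hgen : IsGenerating f P K) :
    ∃ σ : ℝ, 1 < σ ∧ ∀ x ∈ forwardSet f P, ∀ n, ∀ ξ : E d,
      σ ^ n * ‖orthMap x.2 ξ‖ ≤ σ ^ K *
        ‖orthMap ((billiardMap f P)^[n] x).2 (uMap f P n x ξ)‖ := by
  obtain ⟨ρ, hρ0, hρ1, hρ⟩ := hf.exists_factor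
  obtain ⟨μ, hμ, hμF⟩ := exists_uniform_le_abs_inner hP.finite_facetNormals.toFinset
  obtain ⟨r, hr, hexp⟩ := exists_expansion_factor (V := E d) hρ0.le hρ1 hμ hK
  have hfl : ∀ x ∈ forwardSet f P, ∀ j, IsFlight P ((billiardMap f P)^[j] x)
      (normalAt P ((billiardMap f P)^[j] x).1) (nextNormal P ((billiardMap f P)^[j] x))
      (flightTime P ((billiardMap f P)^[j] x)) := fun x hx j => isFlight_of_mem hP (hx j)
  have hstep : ∀ x ∈ forwardSet f P, ∀ ξ : E d, (1 + r) * ‖orthMap x.2 ξ‖ ^ 2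
      ≤ ‖orthMap ((billiardMap f P)^[K] x).2 (uMap f P K x ξ)‖ ^ 2 := by
    intro x hx ξ
    choose g hg hgξ using fun j => exists_inner_velocity hP hρ (hx j)
    have hηj : ∀ j, inner ℝ (uMap f P (j + 1) x ξ)
        (nextNormal P ((billiardMap f P)^[j] x)) = 0 := fun j => by
      rw [uMap_succ_apply]
      exact inner_obliqueMap (hfl x hx j).incoming.ne _
    refine hexp (fun j => ((billiardMap f P)^[j] x).2)
      (fun j => nextNormal P ((billiardMap f P)^[j] x)) (fun j => uMap f P j x ξ)
      (fun j => - ((inner ℝ ((billiardMap f P)^[j] x).2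
        (nextNormal P ((billiardMap f P)^[j] x)))⁻¹ *
          inner ℝ (nextNormal P ((billiardMap f P)^[j] x)) (uMap f P j x ξ))) g
      (fun j => (hfl x hx j).unit) (fun j => (hfl x hx j).facet'.1) (fun j => ?_)
      hηj hg (fun j => ?_) ?_
    · rw [uMap_succ_apply, obliqueMap_apply, neg_smul, smul_smul, sub_eq_add_neg]
    · rw [Function.iterate_succ_apply']
      exact hgξ j _ (hηj j)
    · obtain ⟨S, hS, hspan, hne⟩ := hgen x hx
      obtain ⟨η, hη, hle⟩ := hμF S (fun η hη => by
        obtain ⟨j, -, rfl⟩ := hS η hη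
        simpa using (hfl x hx j).facet') hne hspan (uMap f P 1 x ξ)
      obtain ⟨j, hj, rfl⟩ := hS η hη
      exact ⟨j, hj, hle⟩
  have hmono : ∀ n, ∀ x ∈ forwardSet f P, ∀ ξ : E d, ‖orthMap x.2 ξ‖
      ≤ ‖orthMap ((billiardMap f P)^[n] x).2 (uMap f P n x ξ)‖ := by
    intro n
    induction n with
    | zero => intro x _ ξ; rfl
    | succ n ih =>
      intro x hx ξ
      have h := hfl x hx 0
      have hxd := forwardSet_subset hx
      refine le_trans ?_ (ih _ (mapsTo_forwardSet hx) _)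
      have h1 : orthMap x.2 ξ = orthMap x.2 (obliqueMap x.2 (nextNormal P x) ξ) := by
        have h2 : orthMap x.2 x.2 = 0 := by
          have : ‖x.2‖ = 1 := h.unit
          simp [this]
        rw [obliqueMap_apply, map_sub, map_smul, map_smul, h2, smul_zero, smul_zero, sub_zero]
      rw [h1]
      exact norm_orthMap_le_billiardMap hP hf hxd (forwardSet_subset (mapsTo_forwardSet hx))
        (inner_obliqueMap h.incoming.ne _)
  have hr1 : 1 < 1 + r := by linarith
  -- `1 + r` is the gain of the squared norm over `K` collisions, whence the exponent `1 / (2 * K)`.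
  -- Incomplete blocks only give monotonicity, which costs the factor `σ ^ K`.
  have hσK : ((1 + r) ^ (1 / (2 * K : ℝ))) ^ (2 * K) = 1 + r := by
    have h1 : ((2 * K : ℕ) : ℝ) = 2 * K := by push_cast; ring
    rw [← Real.rpow_natCast, ← Real.rpow_mul (by linarith), h1, one_div_mul_cancel (by positivity),
      Real.rpow_one]
  set σ := (1 + r) ^ (1 / (2 * K : ℝ)) with hσ
  have hσ1 : 1 < σ := Real.one_lt_rpow hr1 (by positivity)
  have hσ0 : 0 < σ := by linarith
  refine ⟨σ, hσ1, ?_⟩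
  intro x hx n ξ
  induction n using Nat.strong_induction_on generalizing x ξ with
  | _ n ih =>
  rcases lt_or_ge n K with hn | hn
  · exact mul_le_mul (pow_le_pow_right₀ hσ1.le hn.le) (hmono n x hx ξ) (norm_nonneg _)
      (by positivity)
  · obtain ⟨m, rfl⟩ := Nat.exists_eq_add_of_le hn
    have h1 := ih m (by omega) _ (iterate_mem_forwardSet K hx) (uMap f P K x ξ)
    rw [← Function.iterate_add_apply, add_comm m K] at h1
    rw [uMap_add, ContinuousLinearMap.comp_apply]
    refine le_trans ?_ h1
    have h2 : σ ^ K * ‖orthMap x.2 ξ‖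
        ≤ ‖orthMap ((billiardMap f P)^[K] x).2 (uMap f P K x ξ)‖ := by
      refine le_of_sq_le_sq ?_ (norm_nonneg _)
      rw [mul_pow, ← pow_mul, mul_comm K 2, hσK]
      exact hstep x hx ξ
    rw [pow_add, mul_comm (σ ^ K), mul_assoc]
    exact mul_le_mul_of_nonneg_left h2 (by positivity)

/-- Billiards with laws close to the specular one are generating. -/
theorem exists_isGenerating (hP : IsPolytope P) (hgen : InGeneralPosition P) :
    ∃ K : ℕ, 0 < K ∧ ∃ ε₀ : ℝ, 0 < ε₀ ∧ ∀ (f : ℝ → ℝ) (ℓ : ℝ), IsContractingReflectionLaw f →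
      Tendsto f (𝓝[<] (Real.pi / 2)) (𝓝 ℓ) → Real.pi / 2 - ℓ ≤ ε₀ → IsGenerating f P K := by
  classical
  set F := hP.finite_facetNormals.toFinset with hF
  have hFmem : ∀ η ∈ F, IsFacetNormal P η := fun η hη => by simpa [hF] using hη
  -- The bounds are taken over the finitely many sets of at most `d` normals, so they depend on `P`
  -- only.
  have h1 : ∀ S : {S : Finset (E d) // S ∈ F.powerset ∧ S.card ≤ d},
      ∃ K : ℕ, ∃ ε₀ : ℝ, 0 < ε₀ ∧ ∀ ε, 0 < ε → ε ≤ ε₀ → ∀ v η : ℕ → E d,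
      ¬ ∀ j < K, η j ∈ S.1 ∧ NearSpecular ε (η j) (v j) (v (j + 1)) := by
    rintro ⟨S, hS, hc⟩
    have hSF : ∀ η ∈ S, IsFacetNormal P η := fun η hη => hFmem η (Finset.mem_powerset.1 hS hη)
    exact exists_bound_chain S (fun η hη => (hSF η hη).1)
      (linearIndependent_of_card_le hP hgen hSF hc)
  choose K ε₀ hε₀ hK using h1
  have hfin : Finite {S : Finset (E d) // S ∈ F.powerset ∧ S.card ≤ d} :=
    (F.powerset.finite_toSet.subset (t := {S | S ∈ F.powerset ∧ S.card ≤ d})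
      fun S hS => hS.1).to_subtype
  have hne : Nonempty {S : Finset (E d) // S ∈ F.powerset ∧ S.card ≤ d} :=
    ⟨⟨∅, by simp, by simp⟩⟩
  obtain ⟨S₁, hS₁⟩ := Finite.exists_min ε₀
  obtain ⟨S₂, hS₂⟩ := Finite.exists_max K
  refine ⟨K S₂ + 1, Nat.succ_pos _, min 1 (ε₀ S₁), lt_min one_pos (hε₀ _), ?_⟩
  intro f ℓ hf hℓ hε x hx
  have hfl : ∀ j, IsFlight P ((billiardMap f P)^[j] x)
      (normalAt P ((billiardMap f P)^[j] x).1) (nextNormal P ((billiardMap f P)^[j] x))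
      (flightTime P ((billiardMap f P)^[j] x)) := fun j => isFlight_of_mem hP (hx j)
  set S := (Finset.range (K S₂ + 1)).image fun j => nextNormal P ((billiardMap f P)^[j] x) with hS
  have hSmem : ∀ η ∈ S, ∃ j < K S₂ + 1, η = nextNormal P ((billiardMap f P)^[j] x) := by
    intro η hη
    obtain ⟨j, hj, rfl⟩ := Finset.mem_image.1 hη
    exact ⟨j, Finset.mem_range.1 hj, rfl⟩
  have hSF : ∀ η ∈ S, IsFacetNormal P η := fun η hη => by
    obtain ⟨j, -, rfl⟩ := hSmem η hη
    exact (hfl j).facet'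
  refine ⟨S, hSmem, span_eq_top_of_le_card hgen hSF ?_, ⟨_, Finset.mem_image_of_mem _
    (Finset.mem_range.2 (Nat.succ_pos _))⟩⟩
  -- With fewer than `d` distinct normals the orbit would be a chain of nearly specular reflections
  -- in independent walls, longer than allowed.
  by_contra! hcard
  set S' : {S : Finset (E d) // S ∈ F.powerset ∧ S.card ≤ d} :=
    ⟨S, Finset.mem_powerset.2 fun η hη => by simpa [hF] using hSF η hη, hcard.le⟩
  refine hK S' (Real.pi / 2 - ℓ) (by linarith [hf.limit_lt hℓ])
    ((hε.trans (min_le_right _ _)).trans (hS₁ S')) (fun j => ((billiardMap f P)^[j] x).2)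
    (fun j => nextNormal P ((billiardMap f P)^[j] x)) fun j hj => ⟨?_, ?_⟩
  · exact Finset.mem_image_of_mem _ (Finset.mem_range.2 (by have := hS₂ S'; omega))
  · rw [Function.iterate_succ_apply', (hfl j).billiardMap_eq hP]
    exact nearSpecular_contract hf hℓ (hε.trans (min_le_left _ _)) (hfl j).facet'.1 (hfl j).unit
      (hfl j).incoming

end InvariantSet

/-! ### The invariant splitting and uniform hyperbolicity. -/

section Splitting

variable {d : ℕ} {P : Set (E d)} {f : ℝ → ℝ} {x : E d × E d}

/-- The terms of the series that defines the stable subspaces. -/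
def stableTerm (f : ℝ → ℝ) (P : Set (E d)) : ℕ → E d × E d → E d →L[ℝ] E d
  | 0, x => flightTime P x • obliqueMap x.2 (normalAt P x.1)
  | n + 1, x => obliqueMap x.2 (normalAt P x.1) ∘L stableTerm f P n (billiardMap f P x) ∘L
      velDeriv f P x

/-- The stable subspace at `x` is the graph over `v^⊥` of `-stableMap f P x`. -/
def stableMap (f : ℝ → ℝ) (P : Set (E d)) (x : E d × E d) : E d →L[ℝ] E d :=
  ∑' n, stableTerm f P n x

theorem exists_flightTime_le (hP : IsPolytope P) :
    ∃ R : ℝ, 0 ≤ R ∧ ∀ x ∈ billiardDomain P, flightTime P x ≤ R := by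
  obtain ⟨R, hR⟩ := hP.1.isBounded.exists_norm_le
  obtain ⟨p, hp⟩ := hP.nonempty
  refine ⟨2 * R, by linarith [(norm_nonneg p).trans (hR p hp)], fun x hx => ?_⟩
  have h := isFlight_of_mem hP hx
  have h1 := hR _ (intrinsicInterior_subset h.start).1
  have h2 := hR _ (intrinsicInterior_subset h.hit).1
  have h3 := norm_sub_le (x.1 + flightTime P x • x.2) x.1
  rw [add_sub_cancel_left, norm_smul, h.unit, mul_one] at h3
  linarith [Real.le_norm_self (flightTime P x)]

theorem orthMap_obliqueMap {v : E d} (hv : ‖v‖ = 1) (η w : E d) :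
    orthMap v (obliqueMap v η w) = orthMap v w := by
  have h2 : orthMap v v = 0 := by simp [hv]
  rw [obliqueMap_apply, map_sub, map_smul, map_smul, h2, smul_zero, smul_zero, sub_zero]

theorem obliqueMap_add_smul {v η : E d} (hv : inner ℝ v η ≠ 0) {w : E d} (hw : inner ℝ w η = 0)
    (c : ℝ) : obliqueMap v η (w + c • v) = w := by
  rw [obliqueMap_apply, inner_add_right, real_inner_smul_right, real_inner_comm w, hw,
    real_inner_comm v, zero_add, smul_smul, mul_comm c, inv_mul_cancel_left₀ hv,
    add_sub_cancel_right]

theorem inner_stableTerm (hP : IsPolytope P) (hx : x ∈ billiardDomain P) (n : ℕ) (w : E d) :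
    inner ℝ (stableTerm f P n x w) (normalAt P x.1) = 0 := by
  have h := isFlight_of_mem hP hx
  cases n with
  | zero =>
    rw [stableTerm, smul_apply, real_inner_smul_left, inner_obliqueMap h.outgoing.ne', mul_zero]
  | succ n => exact inner_obliqueMap h.outgoing.ne' _

/-- In the seminorm orthogonal to the velocity the oblique projections cost nothing, going back one
collision does not increase it, and each `velDeriv` contributes a factor `ρ`. -/
theorem norm_orthMap_stableTerm_le (hP : IsPolytope P) (hf : IsContractingReflectionLaw f) {ρ R : ℝ}
    (hρ0 : 0 ≤ ρ)
    (hρ : ∀ θ ∈ Ico 0 (Real.pi / 2), |lawDeriv f θ| ≤ ρ ∧ |sinRatio f θ| ≤ ρ)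
    (hR0 : 0 ≤ R) (hR : ∀ x ∈ billiardDomain P, flightTime P x ≤ R) (n : ℕ)
    (hx : x ∈ forwardSet f P) (w : E d) :
    ‖orthMap x.2 (stableTerm f P n x w)‖ ≤ R * ρ ^ n * ‖w‖ := by
  induction n generalizing x w with
  | zero =>
    have h := isFlight_of_mem hP (forwardSet_subset hx)
    rw [stableTerm, smul_apply, map_smul, orthMap_obliqueMap h.unit, norm_smul,
      Real.norm_of_nonneg h.time_pos.le, pow_zero, mul_one]
    exact mul_le_mul (hR x (forwardSet_subset hx)) (norm_orthMap_le h.unit w) (norm_nonneg _) hR0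
  | succ n ih =>
    have hxd := forwardSet_subset hx
    have hx' := mapsTo_forwardSet hx
    have h := isFlight_of_mem hP hxd
    rw [stableTerm, ContinuousLinearMap.comp_apply, ContinuousLinearMap.comp_apply,
      orthMap_obliqueMap h.unit]
    have h1 := inner_stableTerm (f := f) hP (forwardSet_subset hx') n (velDeriv f P x w)
    rw [h.normalAt_billiardMap hP] at h1
    refine (norm_orthMap_le_billiardMap hP hf hxd (forwardSet_subset hx') h1).trans ?_
    refine (ih hx' _).trans ?_
    have h2 := norm_velDeriv_apply_le hP hf hρ0 hρ hxd w
    calc R * ρ ^ n * ‖velDeriv f P x w‖ ≤ R * ρ ^ n * (ρ * ‖w‖) :=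
          mul_le_mul_of_nonneg_left h2 (by positivity)
      _ = _ := by ring

theorem norm_stableTerm_le (hP : IsPolytope P) (hf : IsContractingReflectionLaw f) {ρ R c : ℝ}
    (hρ0 : 0 ≤ ρ)
    (hρ : ∀ θ ∈ Ico 0 (Real.pi / 2), |lawDeriv f θ| ≤ ρ ∧ |sinRatio f θ| ≤ ρ)
    (hR0 : 0 ≤ R) (hR : ∀ x ∈ billiardDomain P, flightTime P x ≤ R) (hc0 : 0 < c)
    (hc : ∀ x ∈ maximalInvariantSet f P, c ≤ inner ℝ x.2 (normalAt P x.1)) (n : ℕ)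
    (hx : x ∈ maximalInvariantSet f P) :
    ‖stableTerm f P n x‖ ≤ c⁻¹ * R * ρ ^ n := by
  refine ContinuousLinearMap.opNorm_le_bound _ (by positivity) fun w => ?_
  have hxd := maximalInvariantSet_subset_domain hx
  have h := isFlight_of_mem hP hxd
  have h1 := le_norm_orthMap h.unit h.facet.1 (inner_stableTerm (f := f) hP hxd n w) hc0.le (hc x hx)
  have h2 := norm_orthMap_stableTerm_le hP hf hρ0 hρ hR0 hR n
    (maximalInvariantSet_subset_forwardSet hx) w
  rw [mul_assoc, mul_assoc, le_inv_mul_iff₀ hc0, ← mul_assoc R]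
  exact h1.trans h2

theorem continuousOn_stableTerm (hP : IsPolytope P) (hf : IsContractingReflectionLaw f) (n : ℕ) :
    ContinuousOn (stableTerm f P n) (maximalInvariantSet f P) := by
  have hQ := (continuousOn_obliqueMap_normalAt hP).mono
    (maximalInvariantSet_subset_domain (f := f) (P := P))
  induction n with
  | zero =>
    exact ((continuousOn_flightTime hP).mono maximalInvariantSet_subset_domain).smul hQ
  | succ n ih =>
    have h1 := ih.comp ((continuousOn_billiardMap hP hf).mono maximalInvariantSet_subset_domain)
      mapsTo_maximalInvariantSet
    exact hQ.clm_comp (h1.clm_comp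
      ((continuousOn_velDeriv hP hf).mono maximalInvariantSet_subset_domain))

/-- Summability, continuity and boundedness of the map that defines the stable subspaces. -/
theorem stableMap_spec (hP : IsPolytope P) (hf : IsContractingReflectionLaw f) :
    (∀ x ∈ maximalInvariantSet f P, HasSum (fun n => stableTerm f P n x) (stableMap f P x)) ∧
    ContinuousOn (stableMap f P) (maximalInvariantSet f P) ∧
    ∃ B : ℝ, ∀ x ∈ maximalInvariantSet f P, ‖stableMap f P x‖ ≤ B := by
  obtain ⟨ρ, hρ0, hρ1, hρ⟩ := hf.exists_factor
  obtain ⟨R, hR0, hR⟩ := exists_flightTime_le hP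
  obtain ⟨c, hc0, hc⟩ := exists_outgoing_bound hP hf
  have hsum : Summable fun n : ℕ => c⁻¹ * R * ρ ^ n :=
    (summable_geometric_of_lt_one hρ0.le hρ1).mul_left _
  have hle : ∀ n, ∀ x ∈ maximalInvariantSet f P, ‖stableTerm f P n x‖ ≤ c⁻¹ * R * ρ ^ n :=
    fun n x hx => norm_stableTerm_le hP hf hρ0.le hρ hR0 hR hc0 hc n hx
  exact ⟨fun x hx => (Summable.of_norm_bounded hsum fun n => hle n x hx).hasSum,
    continuousOn_tsum (continuousOn_stableTerm hP hf) hsum hle,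
    _, fun x hx => tsum_of_norm_bounded hsum.hasSum fun n => hle n x hx⟩

theorem hasSum_stableMap_apply (hP : IsPolytope P) (hf : IsContractingReflectionLaw f)
    (hx : x ∈ maximalInvariantSet f P) (w : E d) :
    HasSum (fun n => stableTerm f P n x w) (stableMap f P x w) :=
  ((stableMap_spec hP hf).1 x hx).mapL (ContinuousLinearMap.apply ℝ (E d) w)

theorem inner_stableMap (hP : IsPolytope P) (hf : IsContractingReflectionLaw f)
    (hx : x ∈ maximalInvariantSet f P) (w : E d) :
    inner ℝ (stableMap f P x w) (normalAt P x.1) = 0 := by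
  have h1 := (hasSum_stableMap_apply hP hf hx w).mapL (innerSL ℝ (normalAt P x.1))
  have h2 : (fun n => innerSL ℝ (normalAt P x.1) (stableTerm f P n x w)) = fun _ => 0 := by
    ext n
    rw [innerSL_apply_apply, real_inner_comm]
    exact inner_stableTerm hP (maximalInvariantSet_subset_domain hx) n w
  rw [h2] at h1
  rw [real_inner_comm]
  exact h1.unique hasSum_zero

/-- This is invariance of the graph, solved for the earlier point: on vectors tangent to the walls,
projecting back along the velocity inverts the projection made by the flight. Iterating the equation
produces the series of `stableTerm`. -/
theorem stableMap_eq (hP : IsPolytope P) (hf : IsContractingReflectionLaw f)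
    (hx : x ∈ maximalInvariantSet f P) (w : E d) :
    stableMap f P x w = flightTime P x • obliqueMap x.2 (normalAt P x.1) w
      + obliqueMap x.2 (normalAt P x.1)
          (stableMap f P (billiardMap f P x) (velDeriv f P x w)) := by
  have h1 := (hasSum_stableMap_apply hP hf (mapsTo_maximalInvariantSet hx)
    (velDeriv f P x w)).mapL (obliqueMap x.2 (normalAt P x.1))
  have h2 := (hasSum_nat_add_iff' 1).2 (hasSum_stableMap_apply hP hf hx w)
  have h3 := h2.unique h1
  rw [Finset.sum_range_one] at h3
  rw [← h3, stableTerm, smul_apply]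
  abel

/-- The inclusion of the stable subspace, as a graph. -/
def stableGraph (f : ℝ → ℝ) (P : Set (E d)) (x : E d × E d) : E d →L[ℝ] E d × E d :=
  (-stableMap f P x).prod (ContinuousLinearMap.id ℝ (E d))

/-- The stable subspaces. -/
def stableSpace (f : ℝ → ℝ) (P : Set (E d)) (x : E d × E d) : Submodule ℝ (E d × E d) :=
  (Submodule.span ℝ {x.2})ᗮ.map (stableGraph f P x).toLinearMap

/-- The unstable subspaces. -/
def unstableSpace (P : Set (E d)) (x : E d × E d) : Submodule ℝ (E d × E d) :=
  (Submodule.span ℝ {normalAt P x.1})ᗮ.map (LinearMap.inl ℝ (E d) (E d))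

theorem mem_stableSpace_iff {w : E d × E d} :
    w ∈ stableSpace f P x ↔ inner ℝ w.2 x.2 = 0 ∧ w.1 = -stableMap f P x w.2 := by
  rw [stableSpace, Submodule.mem_map]
  constructor
  · rintro ⟨ζ, hζ, rfl⟩
    exact ⟨Submodule.mem_orthogonal_singleton_iff_inner_left.1 hζ, rfl⟩
  · rintro ⟨h1, h2⟩
    exact ⟨w.2, Submodule.mem_orthogonal_singleton_iff_inner_left.2 h1, Prod.ext h2.symm rfl⟩

theorem mem_unstableSpace_iff {w : E d × E d} :
    w ∈ unstableSpace P x ↔ inner ℝ w.1 (normalAt P x.1) = 0 ∧ w.2 = 0 := by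
  rw [unstableSpace, Submodule.mem_map]
  constructor
  · rintro ⟨ζ, hζ, rfl⟩
    exact ⟨Submodule.mem_orthogonal_singleton_iff_inner_left.1 hζ, rfl⟩
  · rintro ⟨h1, h2⟩
    exact ⟨w.1, Submodule.mem_orthogonal_singleton_iff_inner_left.2 h1, Prod.ext rfl h2.symm⟩

theorem injective_stableGraph (f : ℝ → ℝ) (P : Set (E d)) (x : E d × E d) :
    Function.Injective (stableGraph f P x).toLinearMap := fun _ _ h => congrArg Prod.snd h

theorem finrank_stableSpace (hx : ‖x.2‖ = 1) :
    Module.finrank ℝ (stableSpace f P x) + 1 = d := by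
  rw [stableSpace, ← (Submodule.equivMapOfInjective _ (injective_stableGraph f P x) _).finrank_eq]
  exact finrank_orthogonal_unit hx

/-- A local frame of the bundle of orthogonal complements of unit vectors. -/
theorem exists_frame {X : Type*} [TopologicalSpace X] {ν : X → E d} (hν : Continuous ν) {x₀ : X}
    (h₀ : ‖ν x₀‖ = 1) :
    ∃ U : Set X, IsOpen U ∧ x₀ ∈ U ∧ ∃ (k : ℕ) (e : Fin k → X → E d), (∀ i, Continuous (e i)) ∧
      ∀ x ∈ U, ‖ν x‖ = 1 → LinearIndependent ℝ (fun i => e i x) ∧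
        Submodule.span ℝ (range fun i => e i x) = (Submodule.span ℝ {ν x})ᗮ := by
  let b := Module.finBasis ℝ (Submodule.span ℝ {ν x₀})ᗮ
  -- A fixed basis at `x₀` is projected onto the nearby hyperplanes; linear independence persists
  -- because it is an open condition.
  let e : Fin (Module.finrank ℝ (Submodule.span ℝ {ν x₀})ᗮ) → X → E d :=
    fun i x => orthMap (ν x) (b i)
  have he : ∀ i, Continuous (e i) := fun i =>
    (continuous_orthMap.comp hν).clm_apply continuous_const
  have hcont : Continuous fun x i => e i x := continuous_pi he
  have h1 : LinearIndependent ℝ (fun i => e i x₀) := by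
    have h2 : (fun i => e i x₀) = fun i => ((b i : (Submodule.span ℝ {ν x₀})ᗮ) : E d) := by
      ext1 i
      have := Submodule.mem_orthogonal_singleton_iff_inner_right.1 (b i).2
      simp [e, this]
    rw [h2]
    exact b.linearIndependent.map' (Submodule.subtype _) (Submodule.ker_subtype _)
  refine ⟨(fun x i => e i x) ⁻¹' {v | LinearIndependent ℝ v},
    isOpen_setOfPred_linearIndependent.preimage hcont, h1, _, e, he, fun x hx hνx => ⟨hx, ?_⟩⟩
  have hx : LinearIndependent ℝ (fun i => e i x) := hx
  refine Submodule.eq_of_le_of_finrank_eq ?_ ?_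
  · rw [Submodule.span_le]
    rintro _ ⟨i, rfl⟩
    exact Submodule.mem_orthogonal_singleton_iff_inner_right.2 (inner_orthMap_self hνx _)
  · rw [finrank_span_eq_card hx, Fintype.card_fin]
    have h2 := finrank_orthogonal_unit h₀
    have h3 := finrank_orthogonal_unit hνx
    omega

theorem continuousSubbundleOn_stableSpace (hP : IsPolytope P) (hf : IsContractingReflectionLaw f) :
    ContinuousSubbundleOn (stableSpace f P) (maximalInvariantSet f P) := by
  intro x₀ hx₀
  have hunit : ∀ x ∈ maximalInvariantSet f P, ‖x.2‖ = 1 := fun x hx =>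
    (isFlight_of_mem hP (maximalInvariantSet_subset_domain hx)).unit
  obtain ⟨U, hU, hxU, k, e, he, hspan⟩ := exists_frame (ν := fun x : E d × E d => x.2)
    continuous_snd (hunit x₀ hx₀)
  refine ⟨U, hU, hxU, k, fun i x => stableGraph f P x (e i x), fun i => ?_, fun x hx => ?_⟩
  · have h1 := ((stableMap_spec hP hf).2.1.mono
      (inter_subset_right : U ∩ maximalInvariantSet f P ⊆ _)).neg
    exact (h1.clm_apply (he i).continuousOn).prodMk (he i).continuousOn
  · obtain ⟨h1, h2⟩ := hspan x hx.1 (hunit x hx.2)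
    refine ⟨h1.map' (stableGraph f P x).toLinearMap
      (LinearMap.ker_eq_bot.2 (injective_stableGraph f P x)), ?_⟩
    rw [stableSpace, ← h2, Submodule.map_span, ← range_comp]
    rfl

theorem continuousSubbundleOn_unstableSpace (hP : IsPolytope P) :
    ContinuousSubbundleOn (unstableSpace P) (maximalInvariantSet f P) := by
  intro x₀ hx₀
  have hxd := maximalInvariantSet_subset_domain hx₀
  have h := isFlight_of_mem hP hxd
  obtain ⟨V, hV, hxV, hVeq⟩ := mem_nhdsWithin.1 (eventually_flight_data hP hxd)
  obtain ⟨U, hU, hxU, k, e, he, hspan⟩ := exists_frame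
    (ν := fun _ : E d × E d => normalAt P x₀.1) continuous_const (x₀ := x₀) h.facet.1
  refine ⟨U ∩ V, hU.inter hV, ⟨hxU, hxV⟩, k, fun i x => (e i x, 0), fun i => ?_, fun x hx => ?_⟩
  · exact ((he i).prodMk continuous_const).continuousOn
  · obtain ⟨h1, h2⟩ := hspan x hx.1.1 h.facet.1
    have h3 : normalAt P x.1 = normalAt P x₀.1 :=
      (hVeq ⟨hx.1.2, maximalInvariantSet_subset_domain hx.2⟩).1
    refine ⟨h1.map' (LinearMap.inl ℝ (E d) (E d)) (LinearMap.ker_eq_bot.2 LinearMap.inl_injective),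
      ?_⟩
    rw [unstableSpace, h3, ← h2, Submodule.map_span, ← range_comp]
    rfl

theorem stableSpace_le (hP : IsPolytope P) (hf : IsContractingReflectionLaw f)
    (hx : x ∈ maximalInvariantSet f P) : stableSpace f P x ≤ tangentSpace P x := by
  intro w hw
  obtain ⟨h1, h2⟩ := mem_stableSpace_iff.1 hw
  refine mem_tangentSpace_iff.2 ⟨?_, h1⟩
  rw [h2, inner_neg_left, inner_stableMap hP hf hx, neg_zero]

theorem unstableSpace_le : unstableSpace P x ≤ tangentSpace P x := by
  intro w hw
  obtain ⟨h1, h2⟩ := mem_unstableSpace_iff.1 hw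
  exact mem_tangentSpace_iff.2 ⟨h1, by rw [h2, inner_zero_left]⟩

theorem splitting (hP : IsPolytope P) (hf : IsContractingReflectionLaw f)
    (hx : x ∈ maximalInvariantSet f P) :
    Disjoint (stableSpace f P x) (unstableSpace P x) ∧
      stableSpace f P x ⊔ unstableSpace P x = tangentSpace P x := by
  constructor
  · rw [Submodule.disjoint_def]
    intro w hs hu
    obtain ⟨-, h2⟩ := mem_stableSpace_iff.1 hs
    obtain ⟨-, h3⟩ := mem_unstableSpace_iff.1 hu
    rw [h3, map_zero, neg_zero] at h2
    exact Prod.ext h2 h3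
  · refine le_antisymm (sup_le (stableSpace_le hP hf hx) unstableSpace_le) fun w hw => ?_
    obtain ⟨h1, h2⟩ := mem_tangentSpace_iff.1 hw
    have e : w = (-stableMap f P x w.2, w.2) + (w.1 + stableMap f P x w.2, 0) := by
      ext1 <;> simp
    rw [e]
    refine Submodule.add_mem_sup (mem_stableSpace_iff.2 ⟨h2, rfl⟩)
      (mem_unstableSpace_iff.2 ⟨?_, rfl⟩)
    rw [inner_add_left, h1, inner_stableMap hP hf hx, zero_add]

theorem billiardDeriv_mem_stableSpace (hP : IsPolytope P) (hf : IsContractingReflectionLaw f)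
    (hx : x ∈ maximalInvariantSet f P) {w : E d × E d} (hw : w ∈ stableSpace f P x) :
    billiardDeriv f P x w ∈ stableSpace f P (billiardMap f P x) := by
  have hxd := maximalInvariantSet_subset_domain hx
  have h := isFlight_of_mem hP hxd
  obtain ⟨h1, h2⟩ := mem_stableSpace_iff.1 hw
  rw [mem_stableSpace_iff, billiardDeriv_apply]
  refine ⟨inner_velDeriv hP hf hxd _, ?_⟩
  have h3 := inner_stableMap hP hf (mapsTo_maximalInvariantSet hx) (velDeriv f P x w.2)
  rw [h.normalAt_billiardMap hP] at h3
  have h4 : inner ℝ (-stableMap f P (billiardMap f P x) (velDeriv f P x w.2))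
      (nextNormal P x) = 0 := by rw [inner_neg_left, h3, neg_zero]
  change obliqueMap x.2 (nextNormal P x) (w.1 + flightTime P x • w.2) = _
  rw [h2, stableMap_eq hP hf hx, obliqueMap_apply x.2 (normalAt P x.1),
    obliqueMap_apply x.2 (normalAt P x.1)]
  -- The vector to be projected differs from the wanted one by a multiple of the velocity, which the
  -- projection kills.
  refine Eq.trans (congrArg _ ?_) (obliqueMap_add_smul h.incoming.ne h4
    (flightTime P x * ((inner ℝ x.2 (normalAt P x.1))⁻¹ * inner ℝ (normalAt P x.1) w.2)
      + (inner ℝ x.2 (normalAt P x.1))⁻¹ * inner ℝ (normalAt P x.1)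
        (stableMap f P (billiardMap f P x) (velDeriv f P x w.2))))
  module

theorem iterDeriv_mem_stableSpace (hP : IsPolytope P) (hf : IsContractingReflectionLaw f) {ρ : ℝ}
    (hρ0 : 0 ≤ ρ)
    (hρ : ∀ θ ∈ Ico 0 (Real.pi / 2), |lawDeriv f θ| ≤ ρ ∧ |sinRatio f θ| ≤ ρ) (n : ℕ)
    (hx : x ∈ maximalInvariantSet f P) {w : E d × E d} (hw : w ∈ stableSpace f P x) :
    iterDeriv f P n x w ∈ stableSpace f P ((billiardMap f P)^[n] x) ∧
      ‖(iterDeriv f P n x w).2‖ ≤ ρ ^ n * ‖w.2‖ := by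
  induction n generalizing x w with
  | zero => exact ⟨hw, by simp [iterDeriv]⟩
  | succ n ih =>
    obtain ⟨h1, h2⟩ := ih (mapsTo_maximalInvariantSet hx)
      (billiardDeriv_mem_stableSpace hP hf hx hw)
    refine ⟨h1, h2.trans ?_⟩
    have h3 := norm_velDeriv_apply_le hP hf hρ0 hρ (maximalInvariantSet_subset_domain hx) w.2
    calc ρ ^ n * ‖velDeriv f P x w.2‖ ≤ ρ ^ n * (ρ * ‖w.2‖) :=
          mul_le_mul_of_nonneg_left h3 (by positivity)
      _ = _ := by ring

theorem tangentMap_one (hP : IsPolytope P) (hf : IsContractingReflectionLaw f)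
    (hx : x ∈ maximalInvariantSet f P) {w : E d × E d} (hw : w ∈ tangentSpace P x) :
    tangentMap f P 1 x w = billiardDeriv f P x w :=
  tangentMap_eq hP hf 1 (maximalInvariantSet_subset_forwardSet hx) hw

theorem map_stableSpace_le (hP : IsPolytope P) (hf : IsContractingReflectionLaw f)
    (hx : x ∈ maximalInvariantSet f P) :
    (stableSpace f P x).map (tangentMap f P 1 x).toLinearMap
      ≤ stableSpace f P (billiardMap f P x) := by
  rintro _ ⟨w, hw, rfl⟩
  have := tangentMap_one hP hf hx (stableSpace_le hP hf hx hw)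
  change tangentMap f P 1 x w ∈ _
  rw [this]
  exact billiardDeriv_mem_stableSpace hP hf hx hw

theorem map_stableSpace_eq (hP : IsPolytope P) (hf : IsContractingReflectionLaw f)
    (hx : x ∈ maximalInvariantSet f P) (hinj : InjOn (tangentMap f P 1 x) (tangentSpace P x)) :
    (stableSpace f P x).map (tangentMap f P 1 x).toLinearMap
      = stableSpace f P (billiardMap f P x) := by
  refine Submodule.eq_of_le_of_finrank_eq (map_stableSpace_le hP hf hx) ?_
  have h1 := finrank_stableSpace (f := f) (P := P)
    (isFlight_of_mem hP (maximalInvariantSet_subset_domain hx)).unit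
  have h2 := finrank_stableSpace (f := f) (P := P) (isFlight_of_mem hP
    (maximalInvariantSet_subset_domain (mapsTo_maximalInvariantSet hx))).unit
  have h3 : Function.Injective
      ((tangentMap f P 1 x).toLinearMap ∘ₗ (stableSpace f P x).subtype) := fun a b hab =>
    Subtype.ext (hinj (stableSpace_le hP hf hx a.2) (stableSpace_le hP hf hx b.2) hab)
  have h4 := LinearMap.finrank_range_of_inj h3
  rw [LinearMap.range_comp, Submodule.range_subtype] at h4
  omega

/-- Surjectivity holds because the projection along the same velocity onto the previous wall gives
an explicit preimage. -/
theorem map_unstableSpace_eq (hP : IsPolytope P) (hf : IsContractingReflectionLaw f)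
    (hx : x ∈ maximalInvariantSet f P) :
    (unstableSpace P x).map (tangentMap f P 1 x).toLinearMap
      = unstableSpace P (billiardMap f P x) := by
  have h := isFlight_of_mem hP (maximalInvariantSet_subset_domain hx)
  refine le_antisymm ?_ fun w hw => ?_
  · rintro _ ⟨w, hw, rfl⟩
    have h1 := tangentMap_one hP hf hx (unstableSpace_le hw)
    change tangentMap f P 1 x w ∈ _
    rw [h1, mem_unstableSpace_iff, h.normalAt_billiardMap hP, billiardDeriv_apply]
    refine ⟨inner_obliqueMap h.incoming.ne _, ?_⟩
    rw [(mem_unstableSpace_iff.1 hw).2, map_zero]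
  · obtain ⟨h1, h2⟩ := mem_unstableSpace_iff.1 hw
    rw [h.normalAt_billiardMap hP] at h1
    have hmem : (obliqueMap x.2 (normalAt P x.1) w.1, (0 : E d)) ∈ unstableSpace P x :=
      mem_unstableSpace_iff.2 ⟨inner_obliqueMap h.outgoing.ne' _, rfl⟩
    refine ⟨_, hmem, ?_⟩
    change tangentMap f P 1 x _ = w
    rw [tangentMap_one hP hf hx (unstableSpace_le hmem), billiardDeriv_apply]
    refine Prod.ext ?_ (by rw [map_zero, h2])
    have h3 := obliqueMap_add_smul h.incoming.ne h1
      (-((inner ℝ x.2 (normalAt P x.1))⁻¹ * inner ℝ (normalAt P x.1) w.1))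
    rw [neg_smul, ← smul_smul, ← sub_eq_add_neg, ← obliqueMap_apply] at h3
    rw [smul_zero, add_zero]
    exact h3

/-- A generating billiard is uniformly hyperbolic. -/
theorem uniformlyHyperbolic_of_isGenerating (hP : IsPolytope P) (hf : IsContractingReflectionLaw f)
    {K : ℕ} (hK : 0 < K) (hgen : IsGenerating f P K) : UniformlyHyperbolic f P := by
  obtain ⟨ρ, hρ0, hρ1, hρ⟩ := hf.exists_factor
  obtain ⟨-, -, B, hB⟩ := stableMap_spec hP hf
  obtain ⟨c, hc0, hc⟩ := exists_outgoing_bound hP hf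
  obtain ⟨σ, hσ1, hσ⟩ := uMap_expansion hP hf hK hgen
  have hσ0 : 0 < σ := by linarith
  have hfor : ∀ x ∈ maximalInvariantSet f P, x ∈ forwardSet f P :=
    fun x hx => maximalInvariantSet_subset_forwardSet hx
  refine ⟨fun x hx n => (hasFDerivWithinAt_iterate hP hf n (hfor x hx)).differentiableWithinAt,
    stableSpace f P, unstableSpace P, continuousSubbundleOn_stableSpace hP hf,
    continuousSubbundleOn_unstableSpace hP, fun x hx => splitting hP hf hx,
    fun x hx => ⟨map_stableSpace_le hP hf hx, map_stableSpace_eq hP hf hx,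
      map_unstableSpace_eq hP hf hx⟩, ρ, σ, max (max 1 B) (c⁻¹ * σ ^ K), hρ0, hρ1, hσ1,
    lt_max_of_lt_left (lt_max_of_lt_left one_pos), fun x hx n _ => ⟨fun ξ hξ => ?_, fun ξ hξ => ?_⟩⟩
  · rw [tangentMap_eq hP hf n (hfor x hx) (stableSpace_le hP hf hx hξ)]
    obtain ⟨h1, h2⟩ := iterDeriv_mem_stableSpace hP hf hρ0.le hρ n hx hξ
    obtain ⟨-, h3⟩ := mem_stableSpace_iff.1 h1
    have h4 : ‖(iterDeriv f P n x ξ).2‖ ≤ ρ ^ n * ‖ξ‖ :=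
      h2.trans (mul_le_mul_of_nonneg_left (norm_snd_le ξ) (by positivity))
    have h5 : ‖(iterDeriv f P n x ξ).1‖ ≤ B * (ρ ^ n * ‖ξ‖) := by
      rw [h3, norm_neg]
      have h6 := hB _ (mapsTo_maximalInvariantSet.iterate n hx)
      exact (ContinuousLinearMap.le_of_opNorm_le _ h6 _).trans
        (mul_le_mul_of_nonneg_left h4 ((norm_nonneg _).trans h6))
    have h7 : 0 ≤ ρ ^ n * ‖ξ‖ := by positivity
    have h8 : max 1 B ≤ max (max 1 B) (c⁻¹ * σ ^ K) := le_max_left _ _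
    rw [mul_assoc]
    refine (norm_prod_le_iff.2 ⟨h5.trans ?_, h4.trans ?_⟩)
    · exact mul_le_mul_of_nonneg_right ((le_max_right 1 B).trans h8) h7
    · exact le_mul_of_one_le_left h7 ((le_max_left 1 B).trans h8)
  · rw [tangentMap_eq hP hf n (hfor x hx) (unstableSpace_le hξ)]
    obtain ⟨h1, h2⟩ := mem_unstableSpace_iff.1 hξ
    have h := isFlight_of_mem hP (maximalInvariantSet_subset_domain hx)
    obtain ⟨ξ₁, ξ₂⟩ := ξ
    simp only at h1 h2
    subst h2
    rw [iterDeriv_apply_zero]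
    have h3 := le_norm_orthMap h.unit h.facet.1 h1 hc0.le (hc x hx)
    have h4 := hσ x (hfor x hx) n ξ₁
    have h5 : ‖orthMap ((billiardMap f P)^[n] x).2 (uMap f P n x ξ₁)‖ ≤ ‖uMap f P n x ξ₁‖ :=
      norm_orthMap_le (isFlight_of_mem hP (hfor x hx n)).unit _
    have e : ∀ a : E d, ‖(a, (0 : E d))‖ = ‖a‖ := fun a => by simp
    rw [e, e]
    have h6 : ‖ξ₁‖ ≤ (c⁻¹ * σ ^ K) * (σ ^ n)⁻¹ * ‖uMap f P n x ξ₁‖ := by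
      have h7 : σ ^ n * (c * ‖ξ₁‖) ≤ σ ^ K * ‖uMap f P n x ξ₁‖ :=
        (mul_le_mul_of_nonneg_left h3 (by positivity)).trans
          (h4.trans (mul_le_mul_of_nonneg_left h5 (by positivity)))
      have h8 : (c⁻¹ * σ ^ K) * (σ ^ n)⁻¹ * ‖uMap f P n x ξ₁‖
          = (σ ^ K * ‖uMap f P n x ξ₁‖) / (σ ^ n * c) := by field_simp
      rw [h8, le_div_iff₀ (by positivity)]
      linarith
    refine h6.trans ?_
    have h9 : c⁻¹ * σ ^ K ≤ max (max 1 B) (c⁻¹ * σ ^ K) := le_max_right _ _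
    gcongr

end Splitting

end PolytopeBilliard

end

theorem corollary2p12 (d : ℕ) (hd : 2 ≤ d) (P : Set (PolytopeBilliard.E d))
    (hP : PolytopeBilliard.IsPolytope P) (hgen : PolytopeBilliard.InGeneralPosition P) :
    ∃ lam₀ : ℝ, 0 < lam₀ ∧ lam₀ < 1 ∧
      ∀ (f : ℝ → ℝ) (ℓ : ℝ), PolytopeBilliard.IsContractingReflectionLaw f →
        Filter.Tendsto f (nhdsWithin (Real.pi / 2) (Set.Iio (Real.pi / 2))) (nhds ℓ) →
        lam₀ < ℓ / (Real.pi / 2) →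
        PolytopeBilliard.UniformlyHyperbolic f P := by
  obtain ⟨K, hK, ε₀, hε₀, h⟩ := PolytopeBilliard.exists_isGenerating hP hgen
  have hpi := Real.pi_pos
  -- The second entry turns the hypothesis into `π/2 - ℓ < ε₀`; the entry `1 / 2` only keeps the
  -- constant positive.
  refine ⟨max (1 / 2) (1 - ε₀ / (Real.pi / 2)), lt_max_of_lt_left (by norm_num),
    max_lt (by norm_num) (by linarith [div_pos hε₀ (half_pos hpi)]), fun f ℓ hf hℓ hlt => ?_⟩
  have h1 := (le_max_right _ _).trans_lt hlt
  rw [lt_div_iff₀ (half_pos hpi), sub_mul, div_mul_cancel₀ _ (half_pos hpi).ne'] at h1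
  exact PolytopeBilliard.uniformlyHyperbolic_of_isGenerating hP hf hK
    (h f ℓ hf hℓ (by linarith))
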